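/- **Notation.** An Orlicz N-function is a continuous, even, convex $\varphi:\mathbb R\to\mathbb R$, increasing on $(0,\infty)$, with $\varphi(0)=0$, $\varphi(x)/x\to0$ as $x\to0$ and $\varphi(x)/x\to\infty$ as $x\to\infty$. Let $\varphi$ be an N-function with $\lim_{x\to0}\varphi(x)/x^2\in(0,+\infty]$; let $f$ be its density, i.e. $f$ is nondecreasing and right-continuous on $[0,\infty)$, $f(0)=0$, $f(x)\to\infty$ as $x\to\infty$, and $\varphi(u)=\int_0^{|u|}f(v)\,dv$; let $\varphi^*(x)=\sup_{y\in\mathbb R}(xy-\varphi(y))$. On a probability space, $Sub_\varphi(\Omega)$ is the space of zero-mean real random variables $\xi$ for which there is $r\ge0$ with $\mathbf E e^{\lambda\xi}\le e^{\varphi(r\lambda)}$ for all $\lambda\in\mathbb R$, and $\tau_\varphi(\xi)$ is the infimum of such $r$. A process $X(t)$, $t\in\mathbb R$, belongs to $Sub_\varphi(\Omega)$ if every $X(t)$ does and $\sup_t\tau_\varphi(X(t))<\infty$; it is strictly $Sub_\varphi(\Omega)$ with determinative constant $C_X>0$ if moreover $\tau_\varphi(\sum_i\lambda_iX(t_i))\le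 C_X\big(\mathbf E(\sum_i\lambda_iX(t_i))^2\big)^{1/2}$ for all finite linear combinations. **Wavelets.** Write $\widehat g(y)=\int_{\mathbb R} e^{-iyx}g(x)\,dx$. Let $\phi,\psi\in L_2(\mathbb R)$ be real-valued and continuous. Assume $\phi$ is an $f$-wavelet: $\widehat\phi(0)\neq0$, $\widehat\phi$ is continuous at $0$, $\sum_{k\in\mathbb Z}|\widehat\phi(y+2\pi k)|^2=1$ a.e., and $\widehat\phi(y)=m_0(y/2)\widehat\phi(y/2)$ a.e. for a $2\pi$-periodic $m_0\in L_2([0,2\pi])$. Let $\psi$ be the corresponding $m$-wavelet, $\widehat\psi(y)=\overline{m_0(y/2+\pi)}\,e^{-iy/2}\,\widehat\phi(y/2)$ a.e. Assume there is a nonincreasing $\Phi:[0,\infty)\to\mathbb R$ with $\int_{\mathbb R}\Phi(|x|)\,dx<\infty$ and $|\phi(x)|\le\Phi(|x|)$, $|\psi(x)|\le\Phi(|x|)$ a.e. Put $\phi_{0k}(x)=\phi(x-k)$, $\psi_{jk}(x)=2^{j/2}\psi(2^jx-k)$. **Process.** Let $X(t)$, $t\in\mathbb R$, be a measurable strictly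 $Sub_\varphi(\Omega)$ process with determinative constant $C_X$, continuous in the norm $\tau_\varphi$. Let $c:\mathbb R\to\mathbb R$ be even, nondecreasing on $[0,\infty)$, with $c(0)>1$, $\int_{\mathbb R}c(x)\Phi(|x|)\,dx<\infty$ and $\tau_\varphi(X(t))\le c(t)$ for all $t\in\mathbb R$; assume there are $A:(0,\infty)\to(0,\infty)$ and $x_0\in\mathbb R$ with $c(ax)\le c(x)A(a)$ for all $a>0$, $x\ge x_0$. Let $\xi_{0k}=\int_{\mathbb R}X(t)\phi_{0k}(t)\,dt$ and $\eta_{jk}=\int_{\mathbb R}X(t)\psi_{jk}(t)\,dt$ (mean-square integrals), and $$X_{n,\mathbf k_n}(t)=\sum_{|k|\le k_0'}\xi_{0k}\phi_{0k}(t)+\sum_{j=0}^{n-1}\sum_{|k|\le k_j}\eta_{jk}\psi_{jk}(t),\qquad \mathbf k_n=(k_0',k_0,\dots,k_{n-1}),$$ where $k_0'=k_0'(n)$, $k_j=k_j(n)$; $\mathbf k_n\to\infty$ means $n\to\infty$, $k_0'\to\infty$ and $k_j\to\infty$ for every $j\ge0$. **Statement.** Let $T>0$, $p\ge1$, and suppose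 that the series $$\sum_{k\in\mathbb Z}(\mathbf E\xi_{0k}^2)^{1/2}|\phi_{0k}(t)|+\sum_{j=0}^\infty\sum_{k\in\mathbb Z}(\mathbf E\eta_{jk}^2)^{1/2}|\psi_{jk}(t)|$$ converges uniformly on $[0,T]$. Then: 1. if $\int_0^T(\mathbf E X(t)^2)^{p/2}dt<\infty$, then $\int_0^T\tau_\varphi(X(t))^p\,dt<\infty$; 2. $\int_0^T\tau_\varphi\big(X_{n,\mathbf k_n}(t)-X_{m,\mathbf k_m}(t)\big)^p\,dt\to0$ as $\mathbf k_n,\mathbf k_m\to\infty$; 3. $X$ and all $X_{n,\mathbf k_n}$ have almost surely paths in $L_p([0,T])$, and $X_{n,\mathbf k_n}\to X$ in $L_p([0,T])$ in probability: for every $\varepsilon>0$, $\mathbf P\big\{\big(\int_0^T|X_{n,\mathbf k_n}(t)-X(t)|^p\,dt\big)^{1/p}>\varepsilon\big\}\to0$ as $\mathbf k_n\to\infty$; 4. for all $n$ and $\mathbf k_n$, $$\mathbf P\Big\{\int_0^T|X_{n,\mathbf k_n}(t)-X(t)|^p\,dt>\varepsilon\Big\}\le2\exp\Big\{-\varphi^*\big((\varepsilon/c_n^\infty)^{1/p}\big)\Big\}$$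 for every $\varepsilon>0$ with $\varepsilon>c_n^\infty\big(f(p(c_n^\infty/\varepsilon)^{1/p})\big)^p$ (the right-hand side being read as $0$ if $c_n^\infty=0$), both for $c_n^\infty=C_X^p\int_0^T\big(\mathbf E(X_{n,\mathbf k_n}(t)-X(t))^2\big)^{p/2}dt$ and for $$c_n^\infty=C_X^p\,T\sup_{0\le t\le T}\Big(\sum_{|k|\ge k_0'}(\mathbf E\xi_{0k}^2)^{1/2}|\phi_{0k}(t)|+\sum_{j=0}^{n-1}\sum_{|k|\ge k_j}(\mathbf E\eta_{jk}^2)^{1/2}|\psi_{jk}(t)|+\sum_{j=n}^\infty\sum_{k\in\mathbb Z}(\mathbf E\eta_{jk}^2)^{1/2}|\psi_{jk}(t)|\Big)^p.$$ -/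

import Mathlib

open MeasureTheory Filter Topology Set

noncomputable section

namespace SubPhi

/-! ### Orlicz N-functions -/

/-- `φ` is an Orlicz N-function. -/
structure IsNFunction (φ : ℝ → ℝ) : Prop where
  continuous : Continuous φ
  even : ∀ x, φ (-x) = φ x
  convex : ConvexOn ℝ univ φ
  strictMono : StrictMonoOn φ (Ioi 0)
  map_zero : φ 0 = 0
  div_tendsto_zero : Tendsto (fun x => φ x / x) (𝓝[≠] 0) (𝓝 0)
  div_tendsto_atTop : Tendsto (fun x => φ x / x) atTop atTop

/-- Assumption Q: `φ x / x ^ 2` has a positive, possibly infinite, limit as `x → 0`. -/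
def AssumptionQ (φ : ℝ → ℝ) : Prop :=
  ∃ l : EReal, 0 < l ∧ Tendsto (fun x : ℝ => ((φ x / x ^ 2 : ℝ) : EReal)) (𝓝[≠] 0) (𝓝 l)

/-- `f` (as a function on `[0, ∞)`) is the density of the N-function `φ`. -/
structure IsDensity (φ f : ℝ → ℝ) : Prop where
  monotoneOn : MonotoneOn f (Ici 0)
  rightCont : ∀ x, 0 ≤ x → ContinuousWithinAt f (Ici x) x
  map_zero : f 0 = 0
  tendsto_atTop : Tendsto f atTop atTop
  eq_integral : ∀ u, φ u = ∫ v in (0 : ℝ)..|u|, f v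

/-- Young-Fenchel transform; the supremum is finite for every N-function. -/
def youngFenchel (φ : ℝ → ℝ) (x : ℝ) : ℝ := ⨆ y : ℝ, (x * y - φ y)

/-! ### `φ`-sub-Gaussian random variables and processes -/

section Prob

variable {Ω : Type*} [MeasurableSpace Ω]

/-- `E exp (l ξ) ≤ exp (φ (a l))` for all real `l` (the left-hand side being finite). -/
def MgfBound (P : Measure Ω) (φ : ℝ → ℝ) (ξ : Ω → ℝ) (a : ℝ) : Prop :=
  ∀ l : ℝ, Integrable (fun ω => Real.exp (l * ξ ω)) P ∧
    ∫ ω, Real.exp (l * ξ ω) ∂P ≤ Real.exp (φ (a * l))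

/-- `ξ` belongs to the space `Sub_φ(Ω)`. -/
def IsSub (P : Measure Ω) (φ : ℝ → ℝ) (ξ : Ω → ℝ) : Prop :=
  Integrable ξ P ∧ ∫ ω, ξ ω ∂P = 0 ∧ ∃ r : ℝ, 0 ≤ r ∧ MgfBound P φ ξ r

/-- The norm `τ_φ` of the space `Sub_φ(Ω)`. -/
def tau (P : Measure Ω) (φ : ℝ → ℝ) (ξ : Ω → ℝ) : ℝ :=
  sInf {a : ℝ | 0 ≤ a ∧ MgfBound P φ ξ a}

/-- The process `X(t)`, `t ∈ ℝ`, belongs to `Sub_φ(Ω)`. -/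
def IsSubProcess (P : Measure Ω) (φ : ℝ → ℝ) (X : ℝ → Ω → ℝ) : Prop :=
  (∀ t, IsSub P φ (X t)) ∧ BddAbove (range fun t => tau P φ (X t))

/-- `(E Y ^ 2) ^ (1/2)`. -/
def rms (P : Measure Ω) (Y : Ω → ℝ) : ℝ := Real.sqrt (∫ ω, Y ω ^ 2 ∂P)

/-- The family `Ξ` is strictly `Sub_φ(Ω)` with determinative constant `C`. -/
def IsStrictlySubFamily (P : Measure Ω) (φ : ℝ → ℝ) (Ξ : Set (Ω → ℝ)) (C : ℝ) : Prop :=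
  (∀ ξ ∈ Ξ, IsSub P φ ξ) ∧ 0 < C ∧
    ∀ (n : ℕ) (ξ : Fin n → Ω → ℝ) (l : Fin n → ℝ), (∀ i, ξ i ∈ Ξ) →
      tau P φ (fun ω => ∑ i, l i * ξ i ω) ≤ C * rms P (fun ω => ∑ i, l i * ξ i ω)

/-- The process `X(t)`, `t ∈ ℝ`, is strictly `Sub_φ(Ω)` with determinative constant `C`. -/
def IsStrictlySubProcess (P : Measure Ω) (φ : ℝ → ℝ) (X : ℝ → Ω → ℝ) (C : ℝ) : Prop :=
  IsSubProcess P φ X ∧ IsStrictlySubFamily P φ (range X) C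

/-- `X` is continuous in the norm `τ_φ`. -/
def TauContinuous (P : Measure Ω) (φ : ℝ → ℝ) (X : ℝ → Ω → ℝ) : Prop :=
  ∀ t, Tendsto (fun s => tau P φ (fun ω => X s ω - X t ω)) (𝓝 t) (𝓝 0)

end Prob

/-! ### Wavelets

Wavelets are real-valued, because `Sub_φ(Ω)` consists of real random variables.  The wavelets
below satisfy Assumption S, hence are integrable, and their Fourier transform is given by the
absolutely convergent integral. -/

/-- `ĝ(y) = ∫ exp (-i y x) g(x) dx`. -/
def fourierHat (g : ℝ → ℝ) (y : ℝ) : ℂ :=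
  ∫ x : ℝ, Complex.exp (-(Complex.I * (y : ℂ) * (x : ℂ))) * (g x : ℂ)

/-- `w` is an `f`-wavelet, with associated `2π`-periodic function `m₀`. -/
structure IsFWavelet (w : ℝ → ℝ) (m₀ : ℝ → ℂ) : Prop where
  memLp : MemLp w 2 volume
  hat_zero_ne : fourierHat w 0 ≠ 0
  hat_continuousAt : ContinuousAt (fourierHat w) 0
  sum_hat_sq : ∀ᵐ y : ℝ, HasSum (fun k : ℤ => ‖fourierHat w (y + 2 * Real.pi * k)‖ ^ 2) 1
  periodic : Function.Periodic m₀ (2 * Real.pi)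
  memLp_m₀ : MemLp m₀ 2 (volume.restrict (Icc 0 (2 * Real.pi)))
  refinement : ∀ᵐ y : ℝ, fourierHat w y = m₀ (y / 2) * fourierHat w (y / 2)

/-- `ψ` is the `m`-wavelet of the `f`-wavelet `w`: its Fourier transform is
`conj (m₀ (y/2 + π)) * exp (-i y/2) * ŵ(y/2)`. -/
structure IsMWavelet (w : ℝ → ℝ) (m₀ : ℝ → ℂ) (ψ : ℝ → ℝ) : Prop where
  memLp : MemLp ψ 2 volume
  hat_eq : ∀ᵐ y : ℝ, fourierHat ψ y =
    (starRingEnd ℂ) (m₀ (y / 2 + Real.pi)) * Complex.exp (-(Complex.I * (y : ℂ) / 2)) *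
      fourierHat w (y / 2)

/-- Assumption S for the function `g`, with decreasing majorant `Φ`. -/
structure AssumptionS (g Φ : ℝ → ℝ) : Prop where
  antitoneOn : AntitoneOn Φ (Ici 0)
  bound : ∀ᵐ x : ℝ, |g x| ≤ Φ |x|
  integrable : Integrable (fun x : ℝ => Φ |x|) volume

/-- `g_{jk}(x) = 2^{j/2} g(2^j x - k)`. -/
def dilate (g : ℝ → ℝ) (j : ℕ) (k : ℤ) (x : ℝ) : ℝ :=
  (2 : ℝ) ^ ((j : ℝ) / 2) * g ((2 : ℝ) ^ j * x - k)

/-! ### Wavelet expansions of processes -/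

section Expansion

variable {Ω : Type*} [MeasurableSpace Ω]

open Classical in
/-- The class in `L_2(Ω)` of a square integrable random variable (`0` for any other function). -/
def toL2 (P : Measure Ω) (Y : Ω → ℝ) : Lp ℝ 2 P :=
  if h : MemLp Y 2 P then h.toLp Y else 0

/-- The mean-square integral `∫ X(t) g(t) dt`: the integral of the `L_2(Ω)`-valued function
`t ↦ g(t) X(t)`. -/
def msIntegral (P : Measure Ω) (X : ℝ → Ω → ℝ) (g : ℝ → ℝ) : Ω → ℝ :=
  ((∫ t : ℝ, g t • toL2 P (X t) : Lp ℝ 2 P) : Ω → ℝ)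

/-- `ξ_{0k}` -/
def xi (P : Measure Ω) (X : ℝ → Ω → ℝ) (w : ℝ → ℝ) (k : ℤ) : Ω → ℝ :=
  msIntegral P X (dilate w 0 k)

/-- `η_{jk}` -/
def eta (P : Measure Ω) (X : ℝ → Ω → ℝ) (ψ : ℝ → ℝ) (j : ℕ) (k : ℤ) : Ω → ℝ :=
  msIntegral P X (dilate ψ j k)

/-- The approximant `∑_{|k| ≤ K₀} ξ_{0k} w_{0k}(t) + ∑_{j<n} ∑_{|k| ≤ K j} η_{jk} ψ_{jk}(t)`. -/
def approx (P : Measure Ω) (X : ℝ → Ω → ℝ) (w ψ : ℝ → ℝ) (n K₀ : ℕ) (K : ℕ → ℕ)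
    (t : ℝ) (ω : Ω) : ℝ :=
  (∑ k ∈ Finset.Icc (-(K₀ : ℤ)) (K₀ : ℤ), xi P X w k ω * dilate w 0 k t) +
    ∑ j ∈ Finset.range n, ∑ k ∈ Finset.Icc (-(K j : ℤ)) (K j : ℤ),
      eta P X ψ j k ω * dilate ψ j k t

/-- `(E ξ_{0k}²)^{1/2} |w_{0k}(t)|` -/
def termF (P : Measure Ω) (X : ℝ → Ω → ℝ) (w : ℝ → ℝ) (k : ℤ) (t : ℝ) : ℝ :=
  rms P (xi P X w k) * |dilate w 0 k t|

/-- `(E η_{jk}²)^{1/2} |ψ_{jk}(t)|` -/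
def termM (P : Measure Ω) (X : ℝ → Ω → ℝ) (ψ : ℝ → ℝ) (j : ℕ) (k : ℤ) (t : ℝ) : ℝ :=
  rms P (eta P X ψ j k) * |dilate ψ j k t|

/-- The tail at `t` of the series `∑_k termF + ∑_j ∑_k termM`: indices `|k| ≥ K₀` in the first
sum, `|k| ≥ K j` on the levels `j < n`, and all `k` on the levels `j ≥ n`. -/
def tail (P : Measure Ω) (X : ℝ → Ω → ℝ) (w ψ : ℝ → ℝ) (n K₀ : ℕ) (K : ℕ → ℕ) (t : ℝ) : ℝ :=
  (∑' k : {k : ℤ // (K₀ : ℤ) ≤ |k|}, termF P X w k t) +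
    (∑ j ∈ Finset.range n, ∑' k : {k : ℤ // (K j : ℤ) ≤ |k|}, termM P X ψ j k t) +
    ∑' j : ℕ, ∑' k : ℤ, termM P X ψ (n + j) k t

/-- `C^p T (sup_{0 ≤ t ≤ T} tail(t))^p` -/
def tailConst (P : Measure Ω) (X : ℝ → Ω → ℝ) (w ψ : ℝ → ℝ) (C p T : ℝ)
    (n K₀ : ℕ) (K : ℕ → ℕ) : ℝ :=
  C ^ p * T * (⨆ t : Icc (0 : ℝ) T, tail P X w ψ n K₀ K t) ^ p

/-- `∫_0^T |Y(t)|^p dt`, as an element of `[0, ∞]`. -/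
def pathInt (p T : ℝ) (Y : ℝ → Ω → ℝ) (ω : Ω) : ENNReal :=
  ∫⁻ t in Icc (0 : ℝ) T, ENNReal.ofReal (|Y t ω| ^ p)

/-- The process `Y` belongs to `L_p([0,T])` (with probability one). -/
def InLp (P : Measure Ω) (p T : ℝ) (Y : ℝ → Ω → ℝ) : Prop :=
  ∀ᵐ ω ∂P, pathInt p T Y ω ^ (1 / p) < ⊤

/-- `Yₙ → Y` in the space `L_p([0,T])` in probability. -/
def TendstoLpInProb (P : Measure Ω) (p T : ℝ) (Yn : ℕ → ℝ → Ω → ℝ) (Y : ℝ → Ω → ℝ) : Prop :=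
  (∀ n, InLp P p T (Yn n)) ∧ InLp P p T Y ∧
    ∀ ε : ℝ, 0 < ε → Tendsto
      (fun n => P {ω | ENNReal.ofReal ε < pathInt p T (fun t ω => Yn n t ω - Y t ω) ω ^ (1 / p)})
      atTop (𝓝 0)

/-- `P {∫_0^T |Y(t)|^p dt > ε} ≤ 2 exp (-φ^*((ε / c)^{1/p}))` for every `ε > 0` such that
`ε > c (f (p (c / ε)^{1/p}))^p`; for `c = 0` the right-hand side is read as `0`. -/
def TailBound (P : Measure Ω) (φ f : ℝ → ℝ) (p T : ℝ) (Y : ℝ → Ω → ℝ) (c : ℝ) : Prop :=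
  ∀ ε : ℝ, 0 < ε → c * f (p * (c / ε) ^ (1 / p)) ^ p < ε →
    (0 < c → P {ω | ENNReal.ofReal ε < pathInt p T Y ω} ≤
      ENNReal.ofReal (2 * Real.exp (-(youngFenchel φ ((ε / c) ^ (1 / p)))))) ∧
    (c = 0 → P {ω | ENNReal.ofReal ε < pathInt p T Y ω} = 0)

end Expansion

end SubPhi

end

namespace SubPhi

/-! ### Elementary properties of N-functions -/

/-! The proof combines two independent facts.

Probability. On the closed linear span of `X` in L_2(Ω), exponential moments are controlled by the
L_2 norm alone. A finite combination `y` satisfies `MgfBound` with parameter C‖y‖ by strictness, and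
Fatou's lemma carries this to L_2 limits (`mgfBound_of_mem`). The wavelet coefficients are
L_2-valued integrals of `X`, so the process, the approximants and their differences all lie in this
span up to null sets.

If Y(t) has parameter W(t), its absolute moments are bounded by powers of W(t). Jensen's inequality
for the measure W(t)^p dt, followed by Tonelli, bounds every moment of order q ≥ 1 of ∫|Y|^p
(`lintegral_pathInt_rpow_le`). Markov's inequality with pq = lx, where x = (ε/c)^(1/p), gives 2
exp(-(xl - φ(l))) for each l ≥ p/x. The condition on ε says f(p/x) < x, so smaller l do not matter
for the supremum defining φ*(x) (`tailBound_of_mgfBound`).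

Wavelets. As a map into L_2(Ω), t ↦ X(t) is bounded and continuous. For every such map into a Banach
space, consecutive multiresolution projections differ by one wavelet level (`tsum_levelTerm_succ`),
and the projections converge pointwise (`tendsto_tsum_levelTerm`). Fourier analysis supplies only
the orthonormality of translates and the two-scale equations. The remaining identities are
rearrangements of absolutely convergent series.

Hence X(t) is the sum of its expansion (`toL2_eq_tsum`), and the mean-square error is at most the
sum of the omitted term norms. Uniform convergence of the series makes this error uniformly small on
[0,T]. -/

theorem IsNFunction.nonneg {φ : ℝ → ℝ} (hφ : IsNFunction φ) (x : ℝ) : 0 ≤ φ x := by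
  have h := hφ.convex.2 (mem_univ x) (mem_univ (-x)) (by norm_num : (0 : ℝ) ≤ 1 / 2)
    (by norm_num : (0 : ℝ) ≤ 1 / 2) (by norm_num)
  have h0 : (1 / 2 : ℝ) • x + (1 / 2 : ℝ) • (-x) = 0 := by simp
  rw [h0, hφ.map_zero, hφ.even, smul_eq_mul] at h
  linarith

theorem IsNFunction.le_of_abs_le {φ : ℝ → ℝ} (hφ : IsNFunction φ) {x y : ℝ} (h : |x| ≤ |y|) :
    φ x ≤ φ y := by
  have habs : ∀ z, φ z = φ |z| := fun z => by
    rcases abs_cases z with ⟨h, _⟩ | ⟨h, _⟩ <;> rw [h]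
    exact (hφ.even z).symm
  rw [habs x, habs y]
  rcases (abs_nonneg x).eq_or_lt with h0 | h0
  · rw [← h0, hφ.map_zero]; exact hφ.nonneg _
  · exact hφ.strictMono.monotoneOn h0 (h0.trans_le h) h

/-! ### The moment generating function bound -/

section Mgf

variable {Ω : Type*} [MeasurableSpace Ω] {P : Measure Ω} {φ : ℝ → ℝ} {ξ η : Ω → ℝ} {a b : ℝ}

/-- A finite bound on the extended integral already contains integrability. This is the form to
which Fatou's lemma applies. -/
theorem mgfBound_iff_lintegral (hξ : AEMeasurable ξ P) :
    MgfBound P φ ξ a ↔ ∀ l : ℝ, ∫⁻ ω, ENNReal.ofReal (Real.exp (l * ξ ω)) ∂P ≤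
      ENNReal.ofReal (Real.exp (φ (a * l))) := by
  refine forall_congr' fun l => ?_
  have hm : AEStronglyMeasurable (fun ω => Real.exp (l * ξ ω)) P :=
    (hξ.const_mul l).exp.aestronglyMeasurable
  have h0 : 0 ≤ᵐ[P] fun ω => Real.exp (l * ξ ω) := ae_of_all _ fun ω => (Real.exp_pos _).le
  constructor
  · rintro ⟨hi, hb⟩
    rw [← ofReal_integral_eq_lintegral_ofReal hi h0]
    exact ENNReal.ofReal_le_ofReal hb
  · intro hb
    refine ⟨⟨hm, ?_⟩, ?_⟩
    · rw [hasFiniteIntegral_iff_ofReal h0]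
      exact hb.trans_lt ENNReal.ofReal_lt_top
    · rw [integral_eq_lintegral_of_nonneg_ae h0 hm]
      exact ENNReal.toReal_le_of_le_ofReal (Real.exp_pos _).le hb

theorem MgfBound.congr_ae (h : MgfBound P φ ξ a) (he : ξ =ᵐ[P] η) : MgfBound P φ η a := by
  intro l
  have he' : (fun ω => Real.exp (l * ξ ω)) =ᵐ[P] fun ω => Real.exp (l * η ω) := by
    filter_upwards [he] with ω hω
    rw [hω]
  rw [← integrable_congr he', ← integral_congr_ae he']
  exact h l

theorem MgfBound.mono (hφ : IsNFunction φ) (h : MgfBound P φ ξ a) (ha : 0 ≤ a) (hab : a ≤ b) :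
    MgfBound P φ ξ b := fun l => by
  refine ⟨(h l).1, (h l).2.trans (Real.exp_le_exp.2 (hφ.le_of_abs_le ?_))⟩
  rw [abs_mul, abs_mul, abs_of_nonneg ha, abs_of_nonneg (ha.trans hab)]
  gcongr

/-- Fatou's lemma on the left and continuity of φ on the right; no uniform integrability is needed.
-/
theorem MgfBound.of_tendsto (hφ : IsNFunction φ) {ξs : ℕ → Ω → ℝ} {as : ℕ → ℝ}
    (hm : ∀ n, AEMeasurable (ξs n) P) (h : ∀ n, MgfBound P φ (ξs n) (as n))
    (hlim : ∀ᵐ ω ∂P, Tendsto (fun n => ξs n ω) atTop (𝓝 (ξ ω)))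
    (has : Tendsto as atTop (𝓝 a)) : MgfBound P φ ξ a := by
  have hξ : AEMeasurable ξ P := aemeasurable_of_tendsto_metrizable_ae atTop hm hlim
  rw [mgfBound_iff_lintegral hξ]
  intro l
  calc ∫⁻ ω, ENNReal.ofReal (Real.exp (l * ξ ω)) ∂P
      = ∫⁻ ω, liminf (fun n => ENNReal.ofReal (Real.exp (l * ξs n ω))) atTop ∂P := by
        refine lintegral_congr_ae ?_
        filter_upwards [hlim] with ω hω
        exact (((ENNReal.continuous_ofReal.comp Real.continuous_exp).tendsto _).comp
          (hω.const_mul l)).liminf_eq.symm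
    _ ≤ liminf (fun n => ∫⁻ ω, ENNReal.ofReal (Real.exp (l * ξs n ω)) ∂P) atTop :=
        lintegral_liminf_le' fun n => ((hm n).const_mul l).exp.ennreal_ofReal
    _ ≤ liminf (fun n => ENNReal.ofReal (Real.exp (φ (as n * l)))) atTop := by
        refine liminf_le_liminf (Eventually.of_forall fun n => ?_)
        exact (mgfBound_iff_lintegral (hm n)).1 (h n) l
    _ = ENNReal.ofReal (Real.exp (φ (a * l))) := by
        refine Tendsto.liminf_eq ?_
        exact ((ENNReal.continuous_ofReal.comp (Real.continuous_exp.comp hφ.continuous)).tendsto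
          _).comp (has.mul_const l)

theorem MgfBound.zero [IsProbabilityMeasure P] (hφ : IsNFunction φ) :
    MgfBound P φ (fun _ => 0) a := fun l => by
  simp only [mul_zero, Real.exp_zero]
  refine ⟨integrable_const _, ?_⟩
  simpa using hφ.nonneg (a * l)

theorem MgfBound.const_mul (h : MgfBound P φ ξ a) (c : ℝ) :
    MgfBound P φ (fun ω => c * ξ ω) (a * c) := fun l => by
  have := h (l * c)
  simpa only [mul_assoc, mul_comm c l] using this

/-- From uv ≤ (u² + v²)/2. The factor 2 is crude, but only membership in the space is drawn from it;
sharp constants come from the determinative constant. -/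
theorem MgfBound.add (hξ : AEMeasurable ξ P) (hη : AEMeasurable η P)
    (h1 : MgfBound P φ ξ a) (h2 : MgfBound P φ η a) :
    MgfBound P φ (fun ω => ξ ω + η ω) (2 * a) := fun l => by
  have hle : ∀ ω, Real.exp (l * (ξ ω + η ω)) ≤
      (Real.exp (2 * l * ξ ω) + Real.exp (2 * l * η ω)) / 2 := fun ω => by
    have e1 : Real.exp (2 * l * ξ ω) = Real.exp (l * ξ ω) ^ 2 := by
      rw [← Real.exp_nat_mul]; push_cast; ring_nf
    have e2 : Real.exp (2 * l * η ω) = Real.exp (l * η ω) ^ 2 := by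
      rw [← Real.exp_nat_mul]; push_cast; ring_nf
    rw [e1, e2, mul_add, Real.exp_add]
    nlinarith [sq_nonneg (Real.exp (l * ξ ω) - Real.exp (l * η ω))]
  have hi : Integrable (fun ω => (Real.exp (2 * l * ξ ω) + Real.exp (2 * l * η ω)) / 2) P :=
    ((h1 (2 * l)).1.add (h2 (2 * l)).1).div_const 2
  have hi' : Integrable (fun ω => Real.exp (l * (ξ ω + η ω))) P := by
    refine hi.mono' ((hξ.add hη).const_mul l).exp.aestronglyMeasurable (ae_of_all _ fun ω => ?_)
    rw [Real.norm_eq_abs, Real.abs_exp]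
    exact hle ω
  refine ⟨hi', (integral_mono hi' hi hle).trans ?_⟩
  rw [integral_div, integral_add (h1 (2 * l)).1 (h2 (2 * l)).1]
  have e1 := (h1 (2 * l)).2
  have e2 := (h2 (2 * l)).2
  rw [show a * (2 * l) = 2 * a * l by ring] at e1 e2
  linarith

/-! ### The space `Sub_φ` and its norm -/

theorem IsSub.zero [IsProbabilityMeasure P] (hφ : IsNFunction φ) :
    IsSub P φ (fun _ => 0) :=
  ⟨integrable_zero _ _ _, by simp, 0, le_rfl, MgfBound.zero hφ⟩

theorem IsSub.const_mul (hφ : IsNFunction φ) (h : IsSub P φ ξ) (c : ℝ) :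
    IsSub P φ (fun ω => c * ξ ω) := by
  obtain ⟨hi, h0, r, hr, hb⟩ := h
  refine ⟨hi.const_mul c, by rw [integral_const_mul, h0, mul_zero], r * |c|, by positivity, ?_⟩
  intro l
  have := hb.const_mul c l
  refine ⟨this.1, this.2.trans (Real.exp_le_exp.2 (hφ.le_of_abs_le ?_))⟩
  simp [abs_mul]

theorem IsSub.add (hφ : IsNFunction φ) (h : IsSub P φ ξ) (h' : IsSub P φ η) :
    IsSub P φ (fun ω => ξ ω + η ω) := by
  obtain ⟨hi, h0, r, hr, hb⟩ := h
  obtain ⟨hi', h0', r', hr', hb'⟩ := h'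
  refine ⟨hi.add hi', by rw [integral_add hi hi', h0, h0', add_zero], 2 * max r r',
    by positivity, ?_⟩
  exact MgfBound.add hi.aemeasurable hi'.aemeasurable (hb.mono hφ hr (le_max_left _ _))
    (hb'.mono hφ hr' (le_max_right _ _))

theorem IsSub.sum [IsProbabilityMeasure P] (hφ : IsNFunction φ) {ι : Type*} (s : Finset ι)
    (ξ : ι → Ω → ℝ) (h : ∀ i ∈ s, IsSub P φ (ξ i)) : IsSub P φ (fun ω => ∑ i ∈ s, ξ i ω) := by
  classical
  induction s using Finset.induction_on with
  | empty => simpa using IsSub.zero hφ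
  | insert i s hi ih =>
    simp only [Finset.sum_insert hi]
    exact (h i (Finset.mem_insert_self i s)).add hφ
      (ih fun j hj => h j (Finset.mem_insert_of_mem hj))

theorem tau_nonneg (ξ : Ω → ℝ) : 0 ≤ tau P φ ξ := Real.sInf_nonneg fun _ h => h.1

theorem tau_le (ha : 0 ≤ a) (h : MgfBound P φ ξ a) : tau P φ ξ ≤ a :=
  csInf_le ⟨0, fun _ h => h.1⟩ ⟨ha, h⟩

/-- The infimum is attained: apply closedness under limits to a minimizing sequence of parameters
with the variable held fixed. -/
theorem IsSub.mgfBound_tau (hφ : IsNFunction φ) (h : IsSub P φ ξ) :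
    MgfBound P φ ξ (tau P φ ξ) := by
  obtain ⟨hi, -, r, hr, hb⟩ := h
  have hne : {a : ℝ | 0 ≤ a ∧ MgfBound P φ ξ a}.Nonempty := ⟨r, hr, hb⟩
  obtain ⟨u, -, hu, hmem⟩ := exists_seq_tendsto_sInf hne ⟨0, fun _ h => h.1⟩
  exact MgfBound.of_tendsto hφ (fun _ => hi.aemeasurable) (fun n => (hmem n).2)
    (ae_of_all _ fun ω => tendsto_const_nhds) hu

/-! ### Moments -/

/-- The constant in the moment estimate `E |ξ| ^ s ≤ a ^ s * momentConst φ s l`. -/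
noncomputable def momentConst (φ : ℝ → ℝ) (s l : ℝ) : ℝ :=
  2 * (s / (Real.exp 1 * l)) ^ s * Real.exp (φ l)

theorem momentConst_nonneg {s l : ℝ} (hs : 0 < s) (hl : 0 < l) : 0 ≤ momentConst φ s l := by
  unfold momentConst; positivity

/-- This is u ≤ exp(u - 1) at u = lx/s, raised to the power s; equality holds at x = s/l. -/
theorem rpow_le_mul_exp {x s l : ℝ} (hx : 0 ≤ x) (hs : 0 < s) (hl : 0 < l) :
    x ^ s ≤ (s / (Real.exp 1 * l)) ^ s * Real.exp (l * x) := by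
  have h1 : l * x / s ≤ Real.exp (l * x / s - 1) := by
    have := Real.add_one_le_exp (l * x / s - 1); linarith
  have h2 : (l * x / s) ^ s ≤ Real.exp (l * x / s - 1) ^ s :=
    Real.rpow_le_rpow (by positivity) h1 hs.le
  have h3 : Real.exp (l * x / s - 1) ^ s = Real.exp (l * x) * (1 / Real.exp 1) ^ s := by
    rw [← Real.exp_zero, ← Real.exp_sub, ← Real.exp_mul, ← Real.exp_mul, ← Real.exp_add]
    congr 1; field_simp; ring
  calc x ^ s = (s / l) ^ s * (l * x / s) ^ s := by
        rw [← Real.mul_rpow (by positivity) (by positivity)]; congr 1; field_simp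
    _ ≤ (s / l) ^ s * (Real.exp (l * x) * (1 / Real.exp 1) ^ s) := by rw [← h3]; gcongr
    _ = _ := by
        rw [mul_comm (Real.exp _), ← mul_assoc, ← Real.mul_rpow (by positivity) (by positivity)]
        congr 2; field_simp

/-- Evaluate the bound at ±l/a, so that the exponent becomes φ(±l) and a enters only through a^s.
Using both signs covers |ξ| and produces the factor 2. -/
theorem MgfBound.lintegral_rpow_le_of_pos {s l : ℝ} (hφ : IsNFunction φ)
    (hξ : AEMeasurable ξ P) (h : MgfBound P φ ξ a) (ha : 0 < a) (hs : 0 < s) (hl : 0 < l) :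
    ∫⁻ ω, ENNReal.ofReal (|ξ ω| ^ s) ∂P ≤ ENNReal.ofReal (a ^ s * momentConst φ s l) := by
  set A := (s / (Real.exp 1 * (l / a))) ^ s with hA
  have hA0 : 0 ≤ A := by positivity
  have hpt : ∀ ω, ENNReal.ofReal (|ξ ω| ^ s) ≤ ENNReal.ofReal A *
      (ENNReal.ofReal (Real.exp (l / a * ξ ω)) + ENNReal.ofReal (Real.exp (-(l / a) * ξ ω))) := by
    intro ω
    rw [← ENNReal.ofReal_add (Real.exp_pos _).le (Real.exp_pos _).le, ← ENNReal.ofReal_mul hA0]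
    refine ENNReal.ofReal_le_ofReal ((rpow_le_mul_exp (abs_nonneg _) hs
      (div_pos hl ha)).trans (mul_le_mul_of_nonneg_left ?_ hA0))
    have p1 := Real.exp_pos (l / a * ξ ω)
    have p2 := Real.exp_pos (-(l / a) * ξ ω)
    rcases abs_cases (ξ ω) with ⟨h, _⟩ | ⟨h, _⟩ <;> rw [h]
    · linarith
    · rw [mul_neg, ← neg_mul]; linarith
  have hb := (mgfBound_iff_lintegral hξ).1 h
  have hb1 := hb (l / a)
  have hb2 := hb (-(l / a))
  rw [mul_div_cancel₀ _ ha.ne'] at hb1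
  rw [mul_neg, mul_div_cancel₀ _ ha.ne', hφ.even] at hb2
  calc _ ≤ ∫⁻ ω, ENNReal.ofReal A * (ENNReal.ofReal (Real.exp (l / a * ξ ω)) +
        ENNReal.ofReal (Real.exp (-(l / a) * ξ ω))) ∂P := lintegral_mono hpt
    _ = ENNReal.ofReal A * (∫⁻ ω, ENNReal.ofReal (Real.exp (l / a * ξ ω)) ∂P +
        ∫⁻ ω, ENNReal.ofReal (Real.exp (-(l / a) * ξ ω)) ∂P) := by
        rw [lintegral_const_mul' _ _ ENNReal.ofReal_ne_top,
          lintegral_add_left' (hξ.const_mul _).exp.ennreal_ofReal]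
    _ ≤ ENNReal.ofReal A * (ENNReal.ofReal (Real.exp (φ l)) + ENNReal.ofReal (Real.exp (φ l))) := by
        gcongr
    _ = ENNReal.ofReal (a ^ s * momentConst φ s l) := by
        rw [← ENNReal.ofReal_add (Real.exp_pos _).le (Real.exp_pos _).le, ← ENNReal.ofReal_mul hA0]
        congr 1
        have : A = a ^ s * (s / (Real.exp 1 * l)) ^ s := by
          rw [hA, ← Real.mul_rpow ha.le (by positivity)]; congr 1; field_simp
        rw [this, momentConst]; ring

/-- Enlarge a to a + δ and let δ → 0. The case a = 0 forces ξ = 0 almost surely. -/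
theorem MgfBound.lintegral_rpow_le {s l : ℝ} (hφ : IsNFunction φ)
    (hξ : AEMeasurable ξ P) (h : MgfBound P φ ξ a) (ha : 0 ≤ a) (hs : 0 < s) (hl : 0 < l) :
    ∫⁻ ω, ENNReal.ofReal (|ξ ω| ^ s) ∂P ≤ ENNReal.ofReal (a ^ s * momentConst φ s l) := by
  have hlim : Tendsto (fun δ : ℝ => ENNReal.ofReal ((a + δ) ^ s * momentConst φ s l)) (𝓝[>] 0)
      (𝓝 (ENNReal.ofReal ((a + 0) ^ s * momentConst φ s l))) := by
    refine ((ENNReal.continuous_ofReal.comp (((continuous_const.add continuous_id).rpow_const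
      fun _ => Or.inr hs.le).mul_const _)).tendsto 0).mono_left nhdsWithin_le_nhds
  rw [add_zero] at hlim
  refine ge_of_tendsto hlim ?_
  filter_upwards [self_mem_nhdsWithin] with δ hδ
  have hδ' : (0 : ℝ) < δ := hδ
  exact (h.mono hφ ha (le_add_of_nonneg_right hδ'.le)).lintegral_rpow_le_of_pos hφ hξ
    (by positivity) hs hl

theorem MgfBound.memLp_two (hφ : IsNFunction φ) (hξ : AEMeasurable ξ P) (h : MgfBound P φ ξ a)
    (ha : 0 ≤ a) : MemLp ξ 2 P := by
  rw [memLp_two_iff_integrable_sq hξ.aestronglyMeasurable]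
  refine ⟨(hξ.pow_const 2).aestronglyMeasurable, ?_⟩
  rw [hasFiniteIntegral_iff_ofReal (ae_of_all _ fun ω => sq_nonneg _)]
  have := h.lintegral_rpow_le hφ hξ ha (s := 2) (l := 1) (by norm_num) one_pos
  refine lt_of_le_of_lt ?_ (this.trans_lt ENNReal.ofReal_lt_top)
  simp

/-- Makes τ_φ dominate the L_2 norm, so that boundedness and continuity in τ_φ pass to L_2(Ω). -/
theorem MgfBound.rms_le (hφ : IsNFunction φ) (hξ : AEMeasurable ξ P) (h : MgfBound P φ ξ a)
    (ha : 0 ≤ a) : rms P ξ ≤ a * Real.sqrt (momentConst φ 2 1) := by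
  have hB := momentConst_nonneg (φ := φ) (s := 2) (l := 1) two_pos one_pos
  have := h.lintegral_rpow_le hφ hξ ha (s := 2) (l := 1) (by norm_num) one_pos
  simp only [Real.rpow_two, sq_abs] at this
  rw [rms, integral_eq_lintegral_of_nonneg_ae (ae_of_all _ fun ω => sq_nonneg _)
    (hξ.pow_const 2).aestronglyMeasurable]
  refine (Real.sqrt_le_sqrt (ENNReal.toReal_le_of_le_ofReal (by positivity) this)).trans ?_
  rw [Real.sqrt_mul (sq_nonneg a), Real.sqrt_sq ha]

end Mgf

end SubPhi

/-! ### Tail bounds for the L_p norms of paths. -/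

namespace SubPhi

theorem lintegral_rpow_le_rpow_measure_univ {α : Type*} [MeasurableSpace α] {μ : Measure α}
    {g : α → ENNReal} (hg : AEMeasurable g μ) {q : ℝ} (hq : 1 ≤ q) :
    (∫⁻ a, g a ∂μ) ^ q ≤ μ univ ^ (q - 1) * ∫⁻ a, g a ^ q ∂μ := by
  have hq0 : 0 < q := zero_lt_one.trans_le hq
  have h := eLpNorm'_le_eLpNorm'_mul_rpow_measure_univ one_pos hq hg.aestronglyMeasurable
  simp only [eLpNorm', enorm_eq_self, ENNReal.rpow_one, div_one] at h
  refine (ENNReal.rpow_le_rpow h hq0.le).trans_eq ?_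
  rw [ENNReal.mul_rpow_of_nonneg _ _ hq0.le, ← ENNReal.rpow_mul, ← ENNReal.rpow_mul,
    one_div_mul_cancel hq0.ne', ENNReal.rpow_one, mul_comm, sub_mul, one_mul,
    one_div_mul_cancel hq0.ne']

section TailBound

variable {Ω : Type*} [MeasurableSpace Ω] {P : Measure Ω} {φ : ℝ → ℝ} {p T : ℝ}
  {Y : ℝ → Ω → ℝ} {W : ℝ → ℝ}

theorem measurable_pathInt (hY : Measurable (Function.uncurry Y)) :
    Measurable (pathInt p T Y) := by
  unfold pathInt
  exact Measurable.lintegral_prod_left' (f := fun z : ℝ × Ω => ENNReal.ofReal (|Y z.1 z.2| ^ p))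
    (by
      have : Measurable fun z : ℝ × Ω => Y z.1 z.2 := hY
      fun_prop)

/-- Write |Y|^p = W^p (|Y|/W)^p and regard W^p dt as a finite or infinite measure `M`. Jensen's
inequality in `M` and Tonelli reduce the claim to moments of |Y|/W, which are bounded by a constant
independent of t. -/
theorem lintegral_pathInt_rpow_le [IsProbabilityMeasure P] (hφ : IsNFunction φ)
    (hp : 1 ≤ p) (hY : Measurable (Function.uncurry Y)) (hW : Measurable W) (hW0 : ∀ t, 0 ≤ W t)
    (hYW : ∀ t ∈ Icc 0 T, MgfBound P φ (Y t) (W t)) {q l : ℝ} (hq : 1 ≤ q) (hl : 0 < l) :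
    ∫⁻ ω, pathInt p T Y ω ^ q ∂P ≤ ENNReal.ofReal (momentConst φ (p * q) l) *
      (∫⁻ t in Icc (0 : ℝ) T, ENNReal.ofReal (W t ^ p)) ^ q := by
  have hp0 : 0 < p := zero_lt_one.trans_le hp
  have hq0 : 0 < q := zero_lt_one.trans_le hq
  have hYm : Measurable fun z : ℝ × Ω => Y z.1 z.2 := hY
  have hYt : ∀ t, Measurable (Y t) := fun t => hYm.comp measurable_prodMk_left
  have hYω : ∀ ω, Measurable fun t => Y t ω := fun ω => hYm.comp measurable_prodMk_right
  set ν := (volume : Measure ℝ).restrict (Icc 0 T) with hν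
  set D : ℝ → ENNReal := fun t => ENNReal.ofReal (W t ^ p) with hD
  have hDm : Measurable D := (hW.pow_const p).ennreal_ofReal
  set M := ν.withDensity D with hM
  set Z : ℝ → Ω → ENNReal := fun t ω => ENNReal.ofReal ((|Y t ω| / W t) ^ p) with hZ
  have hZm : Measurable fun z : ℝ × Ω => Z z.1 z.2 := by
    have : Measurable fun z : ℝ × Ω => W z.1 := hW.comp measurable_fst
    fun_prop
  have hMuniv : M univ = ∫⁻ t, D t ∂ν := by
    rw [hM, withDensity_apply _ .univ, Measure.restrict_univ]
  have hmc := momentConst_nonneg (φ := φ) (s := p * q) (l := l) (by positivity) hl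
  -- almost surely `Y` vanishes where `W` does
  have hzero : ∀ᵐ ω ∂P, ∀ᵐ t ∂ν, W t = 0 → Y t ω = 0 := by
    have hs : MeasurableSet {z : ℝ × Ω | W z.1 = 0 → Y z.1 z.2 = 0} := by
      have e : {z : ℝ × Ω | W z.1 = 0 → Y z.1 z.2 = 0} =
          (fun z : ℝ × Ω => W z.1) ⁻¹' {0}ᶜ ∪ (fun z : ℝ × Ω => Y z.1 z.2) ⁻¹' {0} := by
        ext z; simp only [mem_ofPred_eq, mem_union, mem_preimage, mem_compl_iff, mem_singleton_iff]
        tauto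
      rw [e]
      exact ((hW.comp measurable_fst) (measurableSet_singleton 0).compl).union
        (hYm (measurableSet_singleton 0))
    rw [← Measure.ae_ae_comm hs]
    filter_upwards [ae_restrict_mem measurableSet_Icc] with t ht
    by_cases hWt : W t = 0
    -- The first moment bound with a = 0 reads E|Y(t)| = 0.
    · have h := (hYW t ht).lintegral_rpow_le hφ (hYt t).aemeasurable (hW0 t) one_pos one_pos
      rw [hWt, Real.zero_rpow one_ne_zero, zero_mul, ENNReal.ofReal_zero, nonpos_iff_eq_zero,
        lintegral_eq_zero_iff (by have := hYt t; fun_prop)] at h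
      filter_upwards [h] with ω hω _
      simpa [ENNReal.ofReal_eq_zero] using hω
    · exact ae_of_all _ fun ω h => absurd h hWt
  have hpath : ∀ᵐ ω ∂P, pathInt p T Y ω = ∫⁻ t, Z t ω ∂M := by
    filter_upwards [hzero] with ω hω
    have hZω : Measurable fun t => Z t ω := hZm.comp measurable_prodMk_right
    rw [hM, lintegral_withDensity_eq_lintegral_mul _ hDm hZω]
    refine lintegral_congr_ae ?_
    filter_upwards [hω] with t ht
    simp only [Pi.mul_apply, hD, hZ]
    rw [← ENNReal.ofReal_mul (by have := hW0 t; positivity),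
      ← Real.mul_rpow (hW0 t) (div_nonneg (abs_nonneg _) (hW0 t))]
    by_cases hWt : W t = 0
    · rw [ht hWt]; simp [hWt]
    · rw [mul_div_cancel₀ _ hWt]
  calc ∫⁻ ω, pathInt p T Y ω ^ q ∂P
      = ∫⁻ ω, (∫⁻ t, Z t ω ∂M) ^ q ∂P := lintegral_congr_ae (by
        filter_upwards [hpath] with ω hω
        rw [hω])
    _ ≤ ∫⁻ ω, M univ ^ (q - 1) * ∫⁻ t, Z t ω ^ q ∂M ∂P := lintegral_mono fun ω =>
        lintegral_rpow_le_rpow_measure_univ (hZm.comp measurable_prodMk_right).aemeasurable hq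
    _ = M univ ^ (q - 1) * ∫⁻ ω, ∫⁻ t, Z t ω ^ q ∂M ∂P := by
        refine lintegral_const_mul _ ?_
        exact Measurable.lintegral_prod_left' (f := fun z : ℝ × Ω => Z z.1 z.2 ^ q)
          (hZm.pow_const q)
    _ = M univ ^ (q - 1) * ∫⁻ t, ∫⁻ ω, Z t ω ^ q ∂P ∂M := by
        rw [lintegral_lintegral_swap]
        exact ((hZm.pow_const q).comp measurable_swap).aemeasurable
    _ ≤ M univ ^ (q - 1) * ∫⁻ _, ENNReal.ofReal (momentConst φ (p * q) l) ∂M := by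
        gcongr M univ ^ (q - 1) * ?_
        have hm : Measurable fun t => ∫⁻ ω, Z t ω ^ q ∂P :=
          Measurable.lintegral_prod_right' (f := fun z : ℝ × Ω => Z z.1 z.2 ^ q)
            (hZm.pow_const q)
        rw [hM, lintegral_withDensity_eq_lintegral_mul _ hDm hm,
          lintegral_withDensity_eq_lintegral_mul _ hDm measurable_const]
        refine lintegral_mono_ae ?_
        filter_upwards [ae_restrict_mem measurableSet_Icc] with t ht
        simp only [Pi.mul_apply, hD]
        rcases (hW0 t).eq_or_lt with h0 | h0
        · simp [← h0, Real.zero_rpow hp0.ne']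
        gcongr
        have hs : 0 < p * q := by positivity
        have h := (hYW t ht).lintegral_rpow_le hφ (hYt t).aemeasurable (hW0 t) hs hl
        have e : ∀ ω, Z t ω ^ q = ENNReal.ofReal ((W t ^ (p * q))⁻¹) *
            ENNReal.ofReal (|Y t ω| ^ (p * q)) := fun ω => by
          have h1 : 0 ≤ |Y t ω| / W t := by positivity
          simp only [hZ]
          rw [ENNReal.ofReal_rpow_of_nonneg (by positivity) hq0.le, ← Real.rpow_mul h1,
            Real.div_rpow (abs_nonneg _) h0.le, div_eq_inv_mul, ENNReal.ofReal_mul (by positivity)]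
        simp only [e]
        rw [lintegral_const_mul' _ _ ENNReal.ofReal_ne_top]
        refine (mul_le_mul_right h _).trans_eq ?_
        rw [← ENNReal.ofReal_mul (by positivity), ← mul_assoc,
          inv_mul_cancel₀ (by positivity), one_mul]
    _ = ENNReal.ofReal (momentConst φ (p * q) l) * M univ ^ q := by
        rw [lintegral_const, mul_left_comm]
        congr 1
        -- The exponent law M^(q-1) · M = M^q needs 0 and ∞ treated apart.
        by_cases h0 : M univ = 0
        · rw [h0, ENNReal.zero_rpow_of_pos hq0, mul_zero]
        by_cases h1 : M univ = ⊤
        · rw [h1, ENNReal.top_rpow_of_pos hq0]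
          rcases hq.eq_or_lt with h | h
          · simp [← h]
          · rw [ENNReal.top_rpow_of_pos (by linarith)]; simp
        · conv_lhs => rw [← ENNReal.rpow_one (M univ), ← ENNReal.rpow_mul,
            ← ENNReal.rpow_add _ _ h0 h1]
          congr 1; ring
    _ = _ := by rw [hMuniv]

/-- Markov's inequality for the q-th power. Both q and l stay free, to be linked by pq = lx later.
-/
theorem measure_pathInt_gt_le [IsProbabilityMeasure P] (hφ : IsNFunction φ)
    (hp : 1 ≤ p) (hY : Measurable (Function.uncurry Y)) (hW : Measurable W) (hW0 : ∀ t, 0 ≤ W t)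
    (hYW : ∀ t ∈ Icc 0 T, MgfBound P φ (Y t) (W t)) {q l : ℝ} (hq : 1 ≤ q) (hl : 0 < l)
    {c ε : ℝ} (hc : 0 ≤ c) (hε : 0 < ε)
    (hWc : ∫⁻ t in Icc (0 : ℝ) T, ENNReal.ofReal (W t ^ p) ≤ ENNReal.ofReal c) :
    P {ω | ENNReal.ofReal ε < pathInt p T Y ω} ≤
      ENNReal.ofReal (momentConst φ (p * q) l * (c / ε) ^ q) := by
  have hq0 : 0 < q := zero_lt_one.trans_le hq
  have hmc := momentConst_nonneg (φ := φ) (s := p * q) (l := l) (by positivity) hl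
  have hεq : ENNReal.ofReal ε ^ q = ENNReal.ofReal (ε ^ q) :=
    ENNReal.ofReal_rpow_of_nonneg hε.le hq0.le
  have hεq0 : 0 < ε ^ q := by positivity
  calc P {ω | ENNReal.ofReal ε < pathInt p T Y ω}
      ≤ P {ω | ENNReal.ofReal ε ^ q ≤ pathInt p T Y ω ^ q} :=
        measure_mono fun ω hω => ENNReal.rpow_le_rpow (le_of_lt hω) hq0.le
    _ ≤ (∫⁻ ω, pathInt p T Y ω ^ q ∂P) / ENNReal.ofReal ε ^ q := by
        refine meas_ge_le_lintegral_div ((measurable_pathInt hY).pow_const q).aemeasurable ?_ ?_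
        · rw [hεq]; simpa using hεq0
        · rw [hεq]; exact ENNReal.ofReal_ne_top
    _ ≤ (ENNReal.ofReal (momentConst φ (p * q) l) * ENNReal.ofReal c ^ q) /
          ENNReal.ofReal ε ^ q := by
        gcongr
        refine (lintegral_pathInt_rpow_le hφ hp hY hW hW0 hYW hq hl).trans ?_
        gcongr
    _ = _ := by
        rw [hεq, ENNReal.ofReal_rpow_of_nonneg hc hq0.le, ← ENNReal.ofReal_mul hmc,
          ← ENNReal.ofReal_div_of_pos hεq0, Real.div_rpow hc hε.le, mul_div_assoc]

theorem IsDensity.sub_le {φ f : ℝ → ℝ} (hf : IsDensity φ f) {y z : ℝ} (hy : 0 ≤ y) (hyz : y ≤ z) :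
    φ z - φ y ≤ (z - y) * f z := by
  have hint : ∀ a b : ℝ, 0 ≤ a → 0 ≤ b → IntervalIntegrable f volume a b := fun a b ha hb =>
    (hf.monotoneOn.mono (fun x hx => by
      rcases le_total a b with h | h
      · rw [uIcc_of_le h] at hx; exact ha.trans hx.1
      · rw [uIcc_of_ge h] at hx; exact hb.trans hx.1)).intervalIntegrable
  have hz := hy.trans hyz
  rw [hf.eq_integral z, hf.eq_integral y, abs_of_nonneg hy, abs_of_nonneg hz,
    intervalIntegral.integral_interval_sub_left (hint _ _ le_rfl hz) (hint _ _ le_rfl hy)]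
  calc ∫ v in y..z, f v ≤ ∫ _ in y..z, f z := by
        refine intervalIntegral.integral_mono_on hyz (hint _ _ hy hz) (by simp) fun x hx => ?_
        exact hf.monotoneOn (hy.trans hx.1) hz hx.2
    _ = (z - y) * f z := by simp

/-- It is enough to control `x * l - φ l` for `l ≥ z`, where `f z < x`. -/
theorem youngFenchel_le {φ f : ℝ → ℝ} (hφ : IsNFunction φ) (hf : IsDensity φ f) {x z b : ℝ}
    (hx : 0 ≤ x) (hfz : f z ≤ x) (hb : ∀ l, z ≤ l → x * l - φ l ≤ b) :
    youngFenchel φ x ≤ b := by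
  have h1 : ∀ l, 0 ≤ l → x * l - φ l ≤ b := fun l hl => by
    rcases le_total z l with h | h
    · exact hb l h
    · have e1 := hf.sub_le hl h
      have e2 : (z - l) * f z ≤ (z - l) * x := by gcongr
      have e3 := hb z le_rfl
      nlinarith
  refine ciSup_le fun y => ?_
  rcases le_total 0 y with h | h
  · exact h1 y h
  -- For y ≤ 0 the expression is at most 0, its value at the origin.
  · have e1 := h1 0 le_rfl
    rw [hφ.map_zero] at e1
    have e2 := hφ.nonneg y
    nlinarith [mul_nonneg hx (neg_nonneg.2 h)]

theorem tailBound_of_mgfBound [IsProbabilityMeasure P] {f : ℝ → ℝ} (hφ : IsNFunction φ)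
    (hf : IsDensity φ f) (hp : 1 ≤ p)
    (hY : Measurable (Function.uncurry Y)) (hW : Measurable W) (hW0 : ∀ t, 0 ≤ W t)
    (hYW : ∀ t ∈ Icc 0 T, MgfBound P φ (Y t) (W t)) {c : ℝ}
    (hWc : ∫⁻ t in Icc (0 : ℝ) T, ENNReal.ofReal (W t ^ p) ≤ ENNReal.ofReal c) :
    TailBound P φ f p T Y c := by
  have hp0 : 0 < p := zero_lt_one.trans_le hp
  intro ε hε hcε
  refine ⟨fun hc => ?_, fun hc => ?_⟩
  swap
  -- For c = 0 the first moment, q = 1, already gives probability zero.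
  · have h := measure_pathInt_gt_le hφ hp hY hW hW0 hYW le_rfl one_pos hc.ge hε hWc
    rw [hc, zero_div, Real.zero_rpow one_ne_zero, mul_zero, ENNReal.ofReal_zero] at h
    exact le_antisymm h zero_le
  set x := (ε / c) ^ (1 / p) with hx
  have hx0 : 0 < x := by positivity
  have hxp : x ^ p = ε / c := by
    rw [hx, ← Real.rpow_mul (by positivity), one_div_mul_cancel hp0.ne', Real.rpow_one]
  have hz : p * (c / ε) ^ (1 / p) = p / x := by
    rw [hx, div_eq_mul_inv p, ← Real.inv_rpow (by positivity), inv_div]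
  rw [hz] at hcε
  have hz0 : 0 < p / x := by positivity
  -- The condition on ε, after division by c, is f(p/x)^p < x^p.
  have hfz : f (p / x) ≤ x := by
    by_contra hlt
    push Not at hlt
    have h1 : x ^ p < f (p / x) ^ p := Real.rpow_lt_rpow hx0.le hlt hp0
    rw [hxp, div_lt_iff₀ hc] at h1
    linarith
  set m := P {ω | ENNReal.ofReal ε < pathInt p T Y ω} with hm
  have hmtop : m ≠ ⊤ := measure_ne_top _ _
  have key : ∀ l, p / x ≤ l → m ≤ ENNReal.ofReal (2 * Real.exp (-(x * l - φ l))) := by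
    intro l hl
    have hl0 : 0 < l := hz0.trans_le hl
    -- The choice q = lx/p makes the powers of x cancel and leaves exp(-xl); the requirement q ≥ 1
    -- is exactly l ≥ p/x.
    have hq : 1 ≤ l * x / p := by
      rw [le_div_iff₀ hp0, one_mul]; exact (div_le_iff₀ hx0).1 hl
    refine (measure_pathInt_gt_le hφ hp hY hW hW0 hYW hq hl0 hc.le hε hWc).trans_eq ?_
    congr 1
    have e1 : p * (l * x / p) = l * x := by field_simp
    have e2 : (c / ε) ^ (l * x / p) = (x⁻¹) ^ (l * x) := by
      rw [← inv_div ε c, ← hxp, ← Real.inv_rpow hx0.le, ← Real.rpow_mul (by positivity), e1]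
    have e3 : (l * x / (Real.exp 1 * l)) ^ (l * x) * x⁻¹ ^ (l * x) = Real.exp (-(x * l)) := by
      rw [← Real.mul_rpow (by positivity) (by positivity),
        show l * x / (Real.exp 1 * l) * x⁻¹ = Real.exp (-1) by rw [Real.exp_neg]; field_simp,
        ← Real.exp_mul]
      congr 1; ring
    rw [e1, e2, momentConst, neg_sub, sub_eq_add_neg, Real.exp_add, ← e3]
    ring
  rcases eq_or_ne m 0 with h0 | h0
  · rw [h0]; exact zero_le
  have hmr : 0 < m.toReal := ENNReal.toReal_pos h0 hmtop
  -- Taking logarithms turns a bound valid for each l into a bound on the supremum; this needs m ≠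
  -- 0.
  have hY' : youngFenchel φ x ≤ -Real.log (m.toReal / 2) := by
    refine youngFenchel_le hφ hf hx0.le hfz fun l hl => ?_
    have h := ENNReal.toReal_le_of_le_ofReal (by positivity) (key l hl)
    have h2 : m.toReal / 2 ≤ Real.exp (-(x * l - φ l)) := by linarith
    have h3 := (Real.log_le_iff_le_exp (by positivity)).2 h2
    linarith
  rw [← ENNReal.ofReal_toReal hmtop]
  refine ENNReal.ofReal_le_ofReal ?_
  have h4 : m.toReal / 2 ≤ Real.exp (-youngFenchel φ x) := by
    rw [← Real.log_le_iff_le_exp (by positivity)]; linarith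
  linarith

end TailBound

end SubPhi

/-! ### Continuous functions with summable local suprema, and the passage to them from Assumption S.
-/

namespace SubPhi

/-- `g` is continuous and its suprema over the unit intervals `[k, k + 1]` are summable. -/
structure IsAmalgam (g : ℝ → ℝ) (b : ℤ → ℝ) : Prop where
  continuous : Continuous g
  summable : Summable b
  bound : ∀ (k : ℤ), ∀ x ∈ Icc (0 : ℝ) 1, |g (x + k)| ≤ b k

namespace IsAmalgam

variable {g : ℝ → ℝ} {b : ℤ → ℝ}

theorem nonneg (hg : IsAmalgam g b) (k : ℤ) : 0 ≤ b k :=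
  (abs_nonneg _).trans (hg.bound k 0 ⟨le_rfl, zero_le_one⟩)

theorem abs_sub_le (hg : IsAmalgam g b) (x : ℝ) (k : ℤ) : |g (x - k)| ≤ b (⌊x⌋ - k) := by
  have h := hg.bound (⌊x⌋ - k) (Int.fract x) ⟨Int.fract_nonneg x, (Int.fract_lt_one x).le⟩
  rwa [show Int.fract x + ((⌊x⌋ - k : ℤ) : ℝ) = x - k by
    push_cast; rw [← Int.self_sub_floor]; ring] at h

theorem summable_sub (hg : IsAmalgam g b) (n : ℤ) : Summable fun k : ℤ => b (n - k) :=
  hg.summable.comp_injective (Equiv.subLeft n).injective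

theorem tsum_sub (_hg : IsAmalgam g b) (n : ℤ) : ∑' k : ℤ, b (n - k) = ∑' k, b k :=
  (Equiv.subLeft n).tsum_eq b

theorem summable_abs (hg : IsAmalgam g b) (x : ℝ) : Summable fun k : ℤ => |g (x - k)| :=
  Summable.of_nonneg_of_le (fun _ => abs_nonneg _) (hg.abs_sub_le x) (hg.summable_sub ⌊x⌋)

theorem tsum_abs_le (hg : IsAmalgam g b) (x : ℝ) : ∑' k : ℤ, |g (x - k)| ≤ ∑' k, b k := by
  rw [← hg.tsum_sub ⌊x⌋]
  exact (hg.summable_abs x).tsum_le_tsum (hg.abs_sub_le x) (hg.summable_sub ⌊x⌋)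

theorem sum_abs_le (hg : IsAmalgam g b) (x : ℝ) (s : Finset ℤ) :
    ∑ k ∈ s, |g (x - k)| ≤ ∑' k, b k :=
  ((hg.summable_abs x).sum_le_tsum s fun _ _ => abs_nonneg _).trans (hg.tsum_abs_le x)

theorem abs_le (hg : IsAmalgam g b) (x : ℝ) : |g x| ≤ ∑' k, b k := by
  have h := hg.sum_abs_le x {0}
  simpa using h

theorem integrable (hg : IsAmalgam g b) : Integrable g := by
  refine Real.integrable_of_summable_norm_Icc (f := ⟨g, hg.continuous⟩)
    (Summable.of_nonneg_of_le (fun _ => norm_nonneg _) (fun k => ?_) hg.summable)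
  rw [ContinuousMap.norm_le _ (hg.nonneg k)]
  rintro ⟨x, hx⟩
  simpa using hg.bound k x hx

theorem integrable_comp_sub (hg : IsAmalgam g b) (k : ℝ) : Integrable fun x => g (x - k) :=
  hg.integrable.comp_sub_right k

variable {h : ℤ → ℝ} {v : ℝ → ℝ}

theorem summable_conv (hg : IsAmalgam g b) (hh : Summable fun l => |h l|) :
    Summable fun z : ℤ × ℤ => |h z.2| * b (z.1 - z.2) := by
  have h1 : Summable fun z : ℤ × ℤ => |h z.1| * b z.2 :=
    hh.mul_of_nonneg hg.summable (fun _ => abs_nonneg _) hg.nonneg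
  have hi : Function.Injective fun z : ℤ × ℤ => (z.2, z.1 - z.2) := by
    rintro ⟨a, b⟩ ⟨c, d⟩ h
    simp only [Prod.mk.injEq] at h ⊢
    omega
  have h2 := h1.comp_injective hi
  simpa only [Function.comp_def] using h2

/-- This class is stable under ℓ¹ combinations of integer translates: the new majorant is the
convolution of |h| with b. -/
theorem series (hg : IsAmalgam g b) (hh : Summable fun l => |h l|)
    (hv : ∀ x, HasSum (fun l : ℤ => h l * g (x - l)) (v x)) :
    IsAmalgam v fun k => ∑' l, |h l| * b (k - l) := by
  have hsum := hg.summable_conv hh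
  refine ⟨?_, hsum.prod, fun k x hx => ?_⟩
  · have e : v = fun x => ∑' l : ℤ, h l * g (x - l) := funext fun x => (hv x).tsum_eq.symm
    rw [e]
    refine continuous_tsum (fun l => ?_) (hh.mul_right (∑' k, b k)) fun l x => ?_
    · have := hg.continuous; fun_prop
    · rw [norm_mul, Real.norm_eq_abs, Real.norm_eq_abs]
      exact mul_le_mul_of_nonneg_left (hg.abs_le _) (abs_nonneg _)
  · rw [← (hv (x + k)).tsum_eq, ← Real.norm_eq_abs]
    refine tsum_of_norm_bounded (g := fun l => |h l| * b (k - l))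
      (hsum.prod_factor k).hasSum fun l => ?_
    rw [norm_mul, Real.norm_eq_abs, Real.norm_eq_abs]
    refine mul_le_mul_of_nonneg_left ?_ (abs_nonneg _)
    have := hg.bound (k - l) x hx
    rwa [Int.cast_sub, ← add_sub_assoc] at this

/-- One exchange of sum and integral for all later uses: Z is an exponential (Fourier transforms), a
translate or dilate of the wavelet (inner products), the constant 1, or the L_2-valued process. -/
theorem hasSum_integral_series {E : Type*} [NormedAddCommGroup E] [NormedSpace ℝ E]
    [CompleteSpace E] (hg : IsAmalgam g b) (hh : Summable fun l => |h l|)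
    (hv : ∀ x, HasSum (fun l : ℤ => h l * g (x - l)) (v x)) {Z : ℝ → E} (hZ : Continuous Z)
    {M : ℝ} (hM : ∀ x, ‖Z x‖ ≤ M) :
    HasSum (fun l : ℤ => h l • ∫ x, g (x - l) • Z x) (∫ x, v x • Z x) := by
  have hM0 : 0 ≤ M := (norm_nonneg _).trans (hM 0)
  have hint : ∀ l : ℤ, Integrable fun x => g (x - l) • Z x := fun l =>
    (hg.integrable_comp_sub l).smul_bdd M hZ.aestronglyMeasurable (ae_of_all _ hM)
  have hs : Summable fun l : ℤ => ∫ x, ‖h l • g (x - l) • Z x‖ := by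
    refine Summable.of_nonneg_of_le (fun l => integral_nonneg fun x => norm_nonneg _) (fun l => ?_)
      (hh.mul_right ((∫ x, |g x|) * M))
    calc ∫ x, ‖h l • g (x - l) • Z x‖ ≤ ∫ x, |h l| * (|g (x - l)| * M) := by
          refine integral_mono ((hint l).smul (h l)).norm
            (((hg.integrable_comp_sub l).abs.mul_const M).const_mul _) fun x => ?_
          simp only [norm_smul, Real.norm_eq_abs]
          gcongr
          exact hM x
      _ = |h l| * ((∫ x, |g x|) * M) := by
          rw [integral_const_mul, integral_mul_const,
            integral_sub_right_eq_self (fun x => |g x|) (l : ℝ)]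
  have hmain := hasSum_integral_of_summable_integral_norm (fun l => (hint l).smul (h l)) hs
  simp only [Pi.smul_apply] at hmain
  convert hmain using 1
  · ext l; rw [integral_smul]
  · refine integral_congr_ae (ae_of_all _ fun x => ?_)
    have := (hv x).smul_const (Z x)
    simp only [mul_smul] at this
    exact this.tsum_eq.symm

end IsAmalgam

/-! ### Consequences of Assumption S -/

section AssumptionS

variable {g Φ : ℝ → ℝ}

/-- Φ may jump, so density of the good points alone does not suffice. Approaching x from larger
absolute values lets monotonicity give Φ(|y|) ≤ Φ(|x|). -/
theorem AssumptionS.abs_le (hS : AssumptionS g Φ) (hg : Continuous g) (x : ℝ) :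
    |g x| ≤ Φ |x| := by
  have hd : Dense {y : ℝ | |g y| ≤ Φ |y|} := Measure.dense_of_ae hS.bound
  -- approximate `x` by such points of larger absolute value
  have hcl : x ∈ closure {y : ℝ | |x| < |y|} := by
    rw [Metric.mem_closure_iff]
    intro δ hδ
    rcases le_total 0 x with h | h
    · refine ⟨x + δ / 2, ?_, ?_⟩
      · rw [mem_ofPred_eq, abs_of_nonneg h, abs_of_nonneg (by positivity)]; linarith
      · rw [Real.dist_eq, abs_lt]; constructor <;> linarith
    · refine ⟨x - δ / 2, ?_, ?_⟩
      · rw [mem_ofPred_eq, abs_of_nonpos h, abs_of_nonpos (by linarith)]; linarith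
      · rw [Real.dist_eq, abs_lt]; constructor <;> linarith
  have ho : IsOpen {y : ℝ | |x| < |y|} := isOpen_lt continuous_const continuous_abs
  have hcl' : x ∈ closure ({y : ℝ | |x| < |y|} ∩ {y : ℝ | |g y| ≤ Φ |y|}) :=
    closure_minimal (hd.open_subset_closure_inter ho) isClosed_closure hcl
  have hcl2 : IsClosed {y : ℝ | |g y| ≤ Φ |x|} := isClosed_le hg.abs continuous_const
  refine hcl2.closure_subset_iff.2 ?_ hcl'
  rintro y ⟨h1, h2⟩
  exact le_trans h2 (hS.antitoneOn (abs_nonneg x) (abs_nonneg y) (le_of_lt h1))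

theorem AssumptionS.exists_isAmalgam (hS : AssumptionS g Φ) (hg : Continuous g) :
    ∃ b, IsAmalgam g b := by
  have h0 : ∀ x, 0 ≤ x → 0 ≤ Φ x := fun x hx => by
    have := (abs_nonneg _).trans (hS.abs_le hg x)
    rwa [abs_of_nonneg hx] at this
  have hnat : Summable fun n : ℕ => Φ n := by
    -- The integral controls Φ(n+1) through the interval [n, n+1]; Φ(0) is a single extra term.
    rw [← summable_nat_add_iff 1]
    refine summable_of_sum_range_le (c := ∫ x, Φ |x|) (fun n => h0 _ (by positivity)) fun n => ?_
    have ha : AntitoneOn Φ (Icc 0 (0 + (n : ℝ))) := hS.antitoneOn.mono fun x hx => hx.1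
    have h := ha.sum_le_integral
    simp only [zero_add] at h
    refine h.trans ?_
    rw [intervalIntegral.integral_of_le (by positivity)]
    calc ∫ x in Ioc 0 (n : ℝ), Φ x = ∫ x in Ioc 0 (n : ℝ), Φ |x| :=
          setIntegral_congr_fun measurableSet_Ioc fun x hx => by simp only [abs_of_pos hx.1]
      _ ≤ ∫ x, Φ |x| := setIntegral_le_integral hS.integrable
          (ae_of_all _ fun x => h0 _ (abs_nonneg x))
  have hint : Summable fun k : ℤ => Φ |(k : ℝ)| := by
    refine Summable.of_nat_of_neg ?_ ?_ <;> simpa using hnat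
  have hint' : Summable fun k : ℤ => Φ |((k + 1 : ℤ) : ℝ)| :=
    hint.comp_injective (add_left_injective (1 : ℤ))
  -- On [k, k+1] the majorant is largest at the end nearer to 0, which is k for k ≥ 0 and k+1 for k
  -- < 0; the sum covers both.
  refine ⟨fun k => Φ |(k : ℝ)| + Φ |((k + 1 : ℤ) : ℝ)|, hg, hint.add hint', fun k x hx => ?_⟩
  refine (hS.abs_le hg _).trans ?_
  have h1 := h0 _ (abs_nonneg (k : ℝ))
  have h2 := h0 _ (abs_nonneg ((k + 1 : ℤ) : ℝ))
  rcases le_or_gt 0 k with hk | hk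
  · have hk' : (0 : ℝ) ≤ k := by exact_mod_cast hk
    have : Φ |x + k| ≤ Φ |(k : ℝ)| := hS.antitoneOn (abs_nonneg (k : ℝ)) (abs_nonneg (x + k)) (by
      rw [abs_of_nonneg hk', abs_of_nonneg (by linarith [hx.1])]; linarith [hx.1])
    linarith
  · have hk' : (k : ℝ) + 1 ≤ 0 := by exact_mod_cast hk
    have : Φ |x + k| ≤ Φ |((k + 1 : ℤ) : ℝ)| :=
      hS.antitoneOn (abs_nonneg ((k + 1 : ℤ) : ℝ)) (abs_nonneg (x + k)) (by
        push_cast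
        rw [abs_of_nonpos hk', abs_of_nonpos (by linarith [hx.2])]; linarith [hx.2])
    linarith

end AssumptionS

end SubPhi

namespace SubPhi

open FourierTransform ComplexConjugate

/-! ### The Fourier transform of integrable real functions -/

/-- The Fourier transform with frequency measured in full turns. -/
noncomputable def ft (g : ℝ → ℝ) (ξ : ℝ) : ℂ := 𝓕 (fun x => (g x : ℂ)) ξ

theorem ft_eq (g : ℝ → ℝ) (ξ : ℝ) :
    ft g ξ = ∫ x : ℝ, g x • Complex.exp (↑(-2 * Real.pi * x * ξ) * Complex.I) := by
  rw [ft, Real.fourier_real_eq_integral_exp_smul]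
  simp only [smul_eq_mul, Complex.real_smul, mul_comm]

theorem fourierHat_two_pi_mul (g : ℝ → ℝ) (ξ : ℝ) :
    fourierHat g (2 * Real.pi * ξ) = ft g ξ := by
  rw [fourierHat, ft_eq]
  refine integral_congr_ae (ae_of_all _ fun x => ?_)
  simp only [Complex.real_smul]
  rw [mul_comm]
  congr 2
  push_cast
  ring

theorem fourierHat_eq (g : ℝ → ℝ) (y : ℝ) : fourierHat g y = ft g (y / (2 * Real.pi)) := by
  rw [← fourierHat_two_pi_mul]
  congr 1
  have := Real.pi_ne_zero
  field_simp

theorem continuous_ft {g : ℝ → ℝ} (hg : Integrable g) : Continuous (ft g) :=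
  VectorFourier.fourierIntegral_continuous Real.continuous_fourierChar
    (L := innerₗ ℝ) (by exact continuous_inner) hg.ofReal

theorem ft_zero (g : ℝ → ℝ) : ft g 0 = ((∫ x, g x : ℝ) : ℂ) := by
  rw [ft_eq]
  simp [integral_complex_ofReal]

theorem ft_sub {u v : ℝ → ℝ} (hu : Integrable u) (hv : Integrable v) (ξ : ℝ) :
    ft (fun x => u x - v x) ξ = ft u ξ - ft v ξ := by
  have hb : ∀ x : ℝ, ‖Complex.exp (↑(-2 * Real.pi * x * ξ) * Complex.I)‖ ≤ 1 := fun x => by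
    rw [Complex.norm_exp_ofReal_mul_I]
  have hc : Continuous fun x : ℝ => Complex.exp (↑(-2 * Real.pi * x * ξ) * Complex.I) := by
    fun_prop
  rw [ft_eq, ft_eq, ft_eq]
  simp only [sub_smul]
  exact integral_sub (hu.smul_bdd 1 hc.aestronglyMeasurable (ae_of_all _ hb))
    (hv.smul_bdd 1 hc.aestronglyMeasurable (ae_of_all _ hb))

theorem eq_zero_of_ft_ae_eq_zero {d : ℝ → ℝ} (hd : Continuous d) (hi : Integrable d)
    (h : ∀ᵐ ξ, ft d ξ = 0) : d = 0 := by
  have h0 : 𝓕 (fun x => (d x : ℂ)) =ᵐ[volume] fun _ => 0 := h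
  have hinv := Continuous.fourierInv_fourier_eq (f := fun x => (d x : ℂ))
    (Complex.continuous_ofReal.comp hd) hi.ofReal ((integrable_zero _ _ _).congr h0.symm)
  ext x
  have hx := congrFun hinv x
  rw [Real.fourierInv_congr_ae h0, Real.fourierInv_eq'] at hx
  simp only [smul_zero, integral_zero] at hx
  exact_mod_cast hx.symm

/-- Fourier inversion turns almost everywhere identities between transforms into identities at every
point. -/
theorem eq_of_ft_ae_eq {u v : ℝ → ℝ} (hu : Continuous u) (hui : Integrable u) (hv : Continuous v)
    (hvi : Integrable v) (h : ∀ᵐ ξ, ft u ξ = ft v ξ) : u = v := by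
  have := eq_zero_of_ft_ae_eq_zero (hu.sub hv) (hui.sub hvi) (by
    filter_upwards [h] with ξ hξ
    have := ft_sub hui hvi ξ
    simp only [Pi.sub_def] at *
    rw [this, hξ, sub_self])
  exact sub_eq_zero.1 this

theorem ft_comp_div_two (g : ℝ → ℝ) (ξ : ℝ) : ft (fun x => g (x / 2)) ξ = 2 * ft g (2 * ξ) := by
  rw [ft_eq, ft_eq]
  have h := Measure.integral_comp_div
    (fun x : ℝ => g x • Complex.exp (↑(-2 * Real.pi * x * (2 * ξ)) * Complex.I)) 2
  rw [abs_of_pos two_pos, Complex.real_smul, Complex.ofReal_ofNat] at h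
  rw [← h]
  refine integral_congr_ae (ae_of_all _ fun x => ?_)
  simp only
  congr 3
  push_cast
  ring

theorem ft_comp_neg (g : ℝ → ℝ) (ξ : ℝ) : ft (fun x => g (-x)) ξ = conj (ft g ξ) := by
  rw [ft_eq, ft_eq, ← integral_conj, ← integral_neg_eq_self]
  refine integral_congr_ae (ae_of_all _ fun x => ?_)
  simp only [neg_neg, Complex.real_smul, map_mul, Complex.conj_ofReal, ← Complex.exp_conj,
    Complex.conj_I]
  congr 2
  push_cast
  ring

theorem ft_series {g : ℝ → ℝ} {b : ℤ → ℝ} (hg : IsAmalgam g b) {h : ℤ → ℝ} {v : ℝ → ℝ}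
    (hh : Summable fun l => |h l|) (hv : ∀ x, HasSum (fun l : ℤ => h l * g (x - l)) (v x)) (ξ : ℝ) :
    HasSum (fun l : ℤ => (h l : ℂ) * Complex.exp (↑(-2 * Real.pi * l * ξ) * Complex.I) * ft g ξ)
      (ft v ξ) := by
  have := hg.hasSum_integral_series hh hv
    (Z := fun x => Complex.exp (↑(-2 * Real.pi * x * ξ) * Complex.I)) (by fun_prop)
    (M := 1) fun x => by rw [Complex.norm_exp_ofReal_mul_I]
  rw [← ft_eq] at this
  have e : ∀ l : ℤ, (h l : ℂ) * Complex.exp (↑(-2 * Real.pi * l * ξ) * Complex.I) * ft g ξ =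
      h l • ∫ x, g (x - l) • Complex.exp (↑(-2 * Real.pi * x * ξ) * Complex.I) := fun l => ?_
  · simpa only [e] using this
  rw [ft_eq, Complex.real_smul, mul_assoc]
  congr 1
  rw [← integral_sub_right_eq_self _ (l : ℝ), ← integral_const_mul]
  refine integral_congr_ae (ae_of_all _ fun x => ?_)
  simp only [Complex.real_smul]
  rw [mul_left_comm, ← Complex.exp_add]
  congr 2
  push_cast
  ring

/-- Correlations in terms of Fourier transforms. -/
theorem integral_mul_comp_sub_eq {u v : ℝ → ℝ} (hui : Integrable u)
    (hv : Continuous v) (hvi : Integrable v) {M : ℝ} (hM : ∀ x, |v x| ≤ M)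
    (hint : Integrable fun ξ => ft u ξ * conj (ft v ξ)) (t : ℝ) :
    ((∫ x, u x * v (x - t) : ℝ) : ℂ) =
      ∫ ξ : ℝ, Complex.exp (↑(2 * Real.pi * t * ξ) * Complex.I) * (ft u ξ * conj (ft v ξ)) := by
  set U : ℝ → ℂ := fun x => u x
  set V : ℝ → ℂ := fun x => (v (-x) : ℝ)
  have hU : Integrable U := hui.ofReal
  have hV : Integrable V := hvi.comp_neg.ofReal
  have hVc : Continuous V := by fun_prop
  -- The correlation is the convolution of u with the reflection of v, whose transform is the
  -- conjugate of that of v; inversion then gives the formula.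
  set c : ℝ → ℂ := convolution U V (ContinuousLinearMap.mul ℂ ℂ) volume with hc
  have hcc : Continuous c :=
    BddAbove.continuous_convolution_right_of_integrable _
      ⟨M, by rintro _ ⟨x, rfl⟩; simpa [V] using hM (-x)⟩ hU hVc
  have hci : Integrable c := hU.integrable_convolution _ hV
  have hF : 𝓕 c = fun ξ => ft u ξ * conj (ft v ξ) := by
    ext ξ
    rw [hc, Real.fourier_mul_convolution_eq hU hV, ← ft_comp_neg]
    rfl
  have hinv := congrFun (Continuous.fourierInv_fourier_eq hcc hci (by rwa [hF])) t
  rw [hF, Real.fourierInv_eq'] at hinv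
  have hct : c t = ((∫ x, u x * v (x - t) : ℝ) : ℂ) := by
    rw [hc, convolution_def, ← integral_complex_ofReal]
    refine integral_congr_ae (ae_of_all _ fun x => ?_)
    simp [U, V]
  rw [← hct, ← hinv]
  refine integral_congr_ae (ae_of_all _ fun ξ => ?_)
  simp only [smul_eq_mul, RCLike.inner_apply, conj_trivial]
  congr 3
  push_cast
  ring

end SubPhi

namespace SubPhi

open FourierTransform ComplexConjugate

/-! ### Periodization -/

theorem lintegral_eq_lintegral_tsum_add_int {f : ℝ → ENNReal} (hf : Measurable f) :
    ∫⁻ x, f x = ∫⁻ x in Ioc (0 : ℝ) 1, ∑' n : ℤ, f (x + n) := by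
  have e := lintegral_tsum (μ := volume.restrict (Ioc (0 : ℝ) 1)) (f := fun (n : ℤ) x => f (x + n))
    fun n => (hf.comp (measurable_add_const (n : ℝ))).aemeasurable
  rw [e, ← setLIntegral_univ, ← iUnion_Ioc_intCast ℝ, lintegral_iUnion (fun _ => measurableSet_Ioc)
      (pairwise_disjoint_Ioc_intCast ℝ)]
  refine tsum_congr fun n => ?_
  have h := (measurePreserving_add_right volume (n : ℝ)).setLIntegral_comp_preimage
    (s := Ioc (n : ℝ) (n + 1)) measurableSet_Ioc hf
  rw [← h]
  congr 2
  ext x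
  simp

theorem ae_of_ae_restrict_Ioc_of_periodic {p : ℝ → Prop} (hp : ∀ x, p (x + 1) ↔ p x)
    (h : ∀ᵐ x ∂(volume.restrict (Ioc (0 : ℝ) 1)), p x) : ∀ᵐ x : ℝ, p x := by
  rw [ae_restrict_iff' measurableSet_Ioc] at h
  have hpn : ∀ (n : ℤ) x, p (x - n) ↔ p x := by
    intro n
    induction n using Int.induction_on with
    | zero => simp
    | succ i ih =>
      intro x
      rw [← ih x, ← hp (x - ((i + 1 : ℤ) : ℝ))]
      push_cast; ring_nf
    | pred i ih =>
      intro x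
      rw [← ih x, ← hp (x - ((-i : ℤ) : ℝ))]
      push_cast; ring_nf
  have h' : ∀ n : ℤ, ∀ᵐ x : ℝ, x - n ∈ Ioc (0 : ℝ) 1 → p (x - n) := fun n =>
    (measurePreserving_sub_right volume (n : ℝ)).quasiMeasurePreserving.ae h
  filter_upwards [ae_all_iff.2 h'] with x hx
  have hmem : x - (⌈x⌉ - 1 : ℤ) ∈ Ioc (0 : ℝ) 1 := by
    have h1 := Int.ceil_lt_add_one x
    have h2 := Int.le_ceil x
    push_cast
    constructor <;> linarith
  exact (hpn _ x).1 (hx _ hmem)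

theorem ae_comp_mul_left {p : ℝ → Prop} (h : ∀ᵐ y, p y) {c : ℝ} (hc : c ≠ 0) :
    ∀ᵐ ξ, p (c * ξ) :=
  (Measure.quasiMeasurePreserving_smul (volume : Measure ℝ) hc).ae h

/-- Periodization of an integral against a partition of unity. -/
theorem integral_eq_of_periodization {N : ℝ → ℂ} {G : ℝ → ℝ}
    (hsum : ∀ᵐ ξ, HasSum (fun k : ℤ => G (ξ + k)) 1) (hN : ∀ ξ, N (ξ + 1) = N ξ)
    (hint : Integrable fun ξ => N ξ * G ξ) :
    ∫ ξ, N ξ * G ξ = ∫ ξ in (0 : ℝ)..1, N ξ := by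
  have hNn : ∀ (n : ℤ) ξ, N (ξ + n) = N ξ := fun n ξ => by
    have hper : Function.Periodic N 1 := hN
    simpa using hper.int_mul n ξ
  have h1 := hint.hasSum_intervalIntegral_comp_add_int
  have h2 := hint.norm.hasSum_intervalIntegral_comp_add_int
  rw [← h1.tsum_eq]
  simp only [intervalIntegral.integral_of_le zero_le_one] at h1 h2 ⊢
  have hi : ∀ n : ℤ, Integrable (fun ξ => N (ξ + n) * G (ξ + n))
      (volume.restrict (Ioc (0 : ℝ) 1)) := fun n => (hint.comp_add_right (n : ℝ)).integrableOn
  rw [integral_tsum_of_summable_integral_norm hi h2.summable]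
  refine integral_congr_ae ?_
  filter_upwards [ae_restrict_of_ae hsum] with ξ hξ
  simp only [hNn]
  have := (Complex.hasSum_ofReal.2 hξ).mul_left (N ξ)
  rw [Complex.ofReal_one, mul_one] at this
  exact this.tsum_eq

/-! ### The two-scale relations in the frequency domain -/

section Wavelet

variable {w ψ : ℝ → ℝ} {m₀ : ℝ → ℂ}

theorem IsFWavelet.ae_hasSum (hw : IsFWavelet w m₀) :
    ∀ᵐ ξ, HasSum (fun k : ℤ => ‖ft w (ξ + k)‖ ^ 2) 1 := by
  have h := ae_comp_mul_left hw.sum_hat_sq Real.two_pi_pos.ne'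
  filter_upwards [h] with ξ hξ
  simpa only [← mul_add, fourierHat_two_pi_mul] using hξ

theorem IsFWavelet.ae_refinement (hw : IsFWavelet w m₀) :
    ∀ᵐ ξ, ft w (2 * ξ) = m₀ (2 * Real.pi * ξ) * ft w ξ := by
  have h := ae_comp_mul_left hw.refinement (mul_ne_zero Real.two_pi_pos.ne' two_ne_zero)
  filter_upwards [h] with ξ hξ
  rw [show 2 * Real.pi * 2 * ξ / 2 = 2 * Real.pi * ξ by ring, fourierHat_two_pi_mul,
    mul_assoc (2 * Real.pi), fourierHat_two_pi_mul] at hξ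
  exact hξ

theorem IsMWavelet.ae_eq (hψ : IsMWavelet w m₀ ψ) :
    ∀ᵐ ξ, ft ψ (2 * ξ) = conj (m₀ (2 * Real.pi * (ξ + 1 / 2))) *
      Complex.exp (↑(-2 * Real.pi * ξ) * Complex.I) * ft w ξ := by
  have h := ae_comp_mul_left hψ.hat_eq (mul_ne_zero Real.two_pi_pos.ne' two_ne_zero)
  filter_upwards [h] with ξ hξ
  rw [show 2 * Real.pi * 2 * ξ / 2 = 2 * Real.pi * ξ by ring, fourierHat_two_pi_mul,
    mul_assoc (2 * Real.pi), fourierHat_two_pi_mul] at hξ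
  rw [hξ]
  congr 3
  · congr 1; ring
  · push_cast; ring

/-- Periodizing |ŵ|² over the integers gives 1, so its integral equals that of 1 over a period;
Plancherel is not needed. -/
theorem IsFWavelet.integrable_norm_sq (hw : IsFWavelet w m₀) (hwi : Integrable w) :
    Integrable fun ξ => ‖ft w ξ‖ ^ 2 := by
  have hc := continuous_ft hwi
  refine ⟨by fun_prop, ?_⟩
  rw [hasFiniteIntegral_iff_ofReal (ae_of_all _ fun ξ => by positivity),
    lintegral_eq_lintegral_tsum_add_int (by fun_prop)]
  have : ∫⁻ ξ in Ioc (0 : ℝ) 1, ∑' n : ℤ, ENNReal.ofReal (‖ft w (ξ + n)‖ ^ 2) =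
      ∫⁻ ξ in Ioc (0 : ℝ) 1, 1 := by
    refine lintegral_congr_ae ?_
    filter_upwards [ae_restrict_of_ae hw.ae_hasSum] with ξ hξ
    rw [← ENNReal.ofReal_tsum_of_nonneg (fun n => by positivity) hξ.summable, hξ.tsum_eq,
      ENNReal.ofReal_one]
  rw [this]
  simp

theorem IsFWavelet.memLp_ft (hw : IsFWavelet w m₀) (hwi : Integrable w) :
    MemLp (ft w) 2 :=
  (memLp_two_iff_integrable_sq_norm (continuous_ft hwi).aestronglyMeasurable).2
    (hw.integrable_norm_sq hwi)

theorem mul_conj_eq_norm_sq (z : ℂ) : z * conj z = ((‖z‖ ^ 2 : ℝ) : ℂ) := by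
  rw [Complex.mul_conj, Complex.normSq_eq_norm_sq]

/-- The integer translates of an `f`-wavelet are orthonormal. -/
theorem IsFWavelet.integral_mul_translate (hw : IsFWavelet w m₀) {b : ℤ → ℝ}
    (hb : IsAmalgam w b) (k : ℤ) : ∫ x, w x * w (x - k) = if k = 0 then 1 else 0 := by
  have hi := hb.integrable
  have hsq := hw.integrable_norm_sq hi
  have hsq' : Integrable fun ξ => ft w ξ * conj (ft w ξ) := by
    simp only [mul_conj_eq_norm_sq]; exact hsq.ofReal
  have h := integral_mul_comp_sub_eq hi hb.continuous hi hb.abs_le hsq' k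
  simp only [mul_conj_eq_norm_sq] at h hsq'
  -- At an integer shift the exponential is 1-periodic, so the correlation becomes a Fourier
  -- coefficient of the constant 1.
  rw [integral_eq_of_periodization (N := fun ξ => Complex.exp (↑(2 * Real.pi * k * ξ) * Complex.I))
    (G := fun ξ => ‖ft w ξ‖ ^ 2) hw.ae_hasSum (fun ξ => ?_) ?_] at h
  rotate_left
  · exact hsq'.bdd_mul (c := 1) (by fun_prop)
      (ae_of_all _ fun ξ => by rw [Complex.norm_exp_ofReal_mul_I])
  · rw [Complex.exp_eq_exp_iff_exists_int]
    exact ⟨k, by push_cast; ring⟩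
  have hval : ∫ ξ in (0 : ℝ)..1, Complex.exp (↑(2 * Real.pi * k * ξ) * Complex.I) =
      ((if k = 0 then 1 else 0 : ℝ) : ℂ) := by
    split_ifs with hk
    · simp [hk]
    · have hc : (2 * Real.pi * k * Complex.I : ℂ) ≠ 0 := by
        have : (k : ℂ) ≠ 0 := by exact_mod_cast hk
        have : (Real.pi : ℂ) ≠ 0 := by exact_mod_cast Real.pi_ne_zero
        simp [*]
      have e : ∀ ξ : ℝ, Complex.exp (↑(2 * Real.pi * k * ξ) * Complex.I) =
          Complex.exp (2 * Real.pi * k * Complex.I * ξ) := fun ξ => by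
        congr 1; push_cast; ring
      simp only [e]
      rw [integral_exp_mul_complex hc, Complex.ofReal_one, mul_one, Complex.ofReal_zero, mul_zero,
        Complex.exp_zero, show (2 * Real.pi * k * Complex.I : ℂ) = k * (2 * Real.pi * Complex.I) by
          ring, Complex.exp_int_mul_two_pi_mul_I]
      simp
  rw [hval] at h
  exact_mod_cast h

end Wavelet

end SubPhi

/-! ### Two-scale equations in the time domain. -/

namespace SubPhi

open FourierTransform ComplexConjugate

section TwoScale

variable {w ψ : ℝ → ℝ} {m₀ : ℝ → ℂ} {b b' : ℤ → ℝ}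

/-- The scaling coefficients `∫ w (x / 2) w (x - l) dx`. -/
noncomputable def scalingCoeff (w : ℝ → ℝ) (l : ℤ) : ℝ := ∫ x, w (x / 2) * w (x - l)

/-- The coefficients of the `m`-wavelet, `(-1) ^ (1 - l) h (1 - l)`. -/
noncomputable def mirrorCoeff (w : ℝ → ℝ) (l : ℤ) : ℝ := (-1) ^ (1 - l) * scalingCoeff w (1 - l)

theorem IsAmalgam.continuous_comp_div_two (hb : IsAmalgam w b) :
    Continuous fun x => w (x / 2) := hb.continuous.comp (continuous_id.div_const 2)

theorem IsAmalgam.integrable_comp_div_two (hb : IsAmalgam w b) :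
    Integrable fun x => w (x / 2) := hb.integrable.comp_div two_ne_zero

theorem IsAmalgam.integrable_mul_translate (hb : IsAmalgam w b) {u : ℝ → ℝ} (hu : Integrable u)
    (l : ℤ) : Integrable fun x => u x * w (x - l) := by
  have hc := hb.continuous
  exact hu.mul_bdd (c := ∑' k, b k) (by fun_prop) (ae_of_all _ fun x => hb.abs_le _)

/-- The sum of |w(x-l)| over l is bounded uniformly in x; this puts the scaling coefficients in ℓ¹.
-/
theorem IsAmalgam.summable_integral_abs (hb : IsAmalgam w b) {u : ℝ → ℝ} (hu : Integrable u) :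
    Summable fun l : ℤ => ∫ x, |u x * w (x - l)| := by
  have hint : ∀ l : ℤ, Integrable fun x => |u x * w (x - l)| := fun l =>
    (hb.integrable_mul_translate hu l).abs
  refine summable_of_sum_le (c := (∫ x, |u x|) * ∑' k, b k)
    (fun _ => integral_nonneg fun _ => abs_nonneg _) fun s => ?_
  calc ∑ l ∈ s, ∫ x, |u x * w (x - l)|
      = ∫ x, ∑ l ∈ s, |u x * w (x - l)| := (integral_finsetSum s fun l _ => hint l).symm
    _ ≤ ∫ x, |u x| * ∑' k, b k := by
        refine integral_mono (integrable_finsetSum s fun l _ => hint l)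
          (hu.abs.mul_const _) fun x => ?_
        simp only [abs_mul, ← Finset.mul_sum]
        exact mul_le_mul_of_nonneg_left (hb.sum_abs_le x s) (abs_nonneg _)
    _ = _ := integral_mul_const _ _

theorem IsAmalgam.summable_scalingCoeff (hb : IsAmalgam w b) :
    Summable fun l => |scalingCoeff w l| :=
  Summable.of_nonneg_of_le (fun _ => abs_nonneg _) (fun _ => abs_integral_le_integral_abs)
    (hb.summable_integral_abs hb.integrable_comp_div_two)

theorem summable_mirrorCoeff (hb : IsAmalgam w b) : Summable fun l => |mirrorCoeff w l| := by
  have h := hb.summable_scalingCoeff.comp_injective (Equiv.subLeft (1 : ℤ)).injective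
  refine h.congr fun l => ?_
  simp [mirrorCoeff, abs_mul, abs_zpow]

theorem IsAmalgam.hasSum_translates (hb : IsAmalgam w b) {h : ℤ → ℝ}
    (hh : Summable fun l => |h l|) (x : ℝ) :
    HasSum (fun l : ℤ => h l * w (x - l)) (∑' l : ℤ, h l * w (x - l)) := by
  refine (Summable.of_norm_bounded (hh.mul_right (∑' k, b k)) fun l => ?_).hasSum
  rw [norm_mul, Real.norm_eq_abs, Real.norm_eq_abs]
  exact mul_le_mul_of_nonneg_left (hb.abs_le _) (abs_nonneg _)

theorem IsFWavelet.integral_translate_mul_translate (hw : IsFWavelet w m₀) (hb : IsAmalgam w b)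
    (k l : ℤ) : ∫ x, w (x - k) * w (x - l) = if k = l then 1 else 0 := by
  have h := hw.integral_mul_translate hb (l - k)
  rw [← integral_sub_right_eq_self _ (k : ℝ)] at h
  simp only [sub_eq_zero, eq_comm (a := l)] at h
  rw [← h]
  refine integral_congr_ae (ae_of_all _ fun x => ?_)
  simp only
  congr 2
  push_cast; ring

/-- The trigonometric series with coefficients `h`. -/
noncomputable def trigSeries (h : ℤ → ℝ) (ξ : ℝ) : ℂ :=
  ∑' l : ℤ, (h l : ℂ) * Complex.exp (↑(-2 * Real.pi * l * ξ) * Complex.I)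

theorem norm_trigSeries_term (h : ℤ → ℝ) (l : ℤ) (ξ : ℝ) :
    ‖(h l : ℂ) * Complex.exp (↑(-2 * Real.pi * l * ξ) * Complex.I)‖ = |h l| := by
  rw [norm_mul, Complex.norm_exp_ofReal_mul_I, mul_one, Complex.norm_real, Real.norm_eq_abs]

theorem hasSum_trigSeries {h : ℤ → ℝ} (hh : Summable fun l => |h l|) (ξ : ℝ) :
    HasSum (fun l : ℤ => (h l : ℂ) * Complex.exp (↑(-2 * Real.pi * l * ξ) * Complex.I))
      (trigSeries h ξ) :=
  (Summable.of_norm_bounded hh fun l => (norm_trigSeries_term h l ξ).le).hasSum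

theorem continuous_trigSeries {h : ℤ → ℝ} (hh : Summable fun l => |h l|) :
    Continuous (trigSeries h) :=
  continuous_tsum (fun l => by fun_prop) hh fun l ξ => (norm_trigSeries_term h l ξ).le

theorem norm_trigSeries_le {h : ℤ → ℝ} (hh : Summable fun l => |h l|) (ξ : ℝ) :
    ‖trigSeries h ξ‖ ≤ ∑' l, |h l| :=
  tsum_of_norm_bounded hh.hasSum fun l => (norm_trigSeries_term h l ξ).le

theorem trigSeries_add_one (h : ℤ → ℝ) (ξ : ℝ) : trigSeries h (ξ + 1) = trigSeries h ξ := by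
  refine tsum_congr fun l => ?_
  congr 1
  rw [Complex.exp_eq_exp_iff_exists_int]
  exact ⟨-l, by push_cast; ring⟩

theorem ft_eq_trigSeries_mul (hb : IsAmalgam w b) {h : ℤ → ℝ} (hh : Summable fun l => |h l|)
    {v : ℝ → ℝ} (hv : ∀ x, HasSum (fun l : ℤ => h l * w (x - l)) (v x)) (ξ : ℝ) :
    ft v ξ = trigSeries h ξ * ft w ξ :=
  (ft_series hb hh hv ξ).unique ((hasSum_trigSeries hh ξ).mul_right _)

/-- A square integrable periodic function with vanishing Fourier coefficients vanishes. -/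
theorem ae_eq_zero_of_fourier_coeff {D : ℝ → ℂ} (hD : MemLp D 2 (volume.restrict (Ioc 0 1)))
    (hper : ∀ ξ, D (ξ + 1) = D ξ)
    (h0 : ∀ l : ℤ, ∫ ξ in (0 : ℝ)..1, Complex.exp (↑(2 * Real.pi * l * ξ) * Complex.I) * D ξ = 0) :
    ∀ᵐ ξ, D ξ = 0 := by
  refine ae_of_ae_restrict_Ioc_of_periodic (fun ξ => by rw [hper]) ?_
  have hc : ∀ n, fourierCoeffOn (zero_lt_one' ℝ) D n = 0 := fun n => by
    have e : ∫ ξ in (0 : ℝ)..1, fourier (-n) (ξ : AddCircle (1 - 0 : ℝ)) • D ξ = 0 := by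
      refine (intervalIntegral.integral_congr fun ξ _ => ?_).trans (h0 (-n))
      simp only [fourier_coe_apply, smul_eq_mul]
      congr 2
      push_cast
      ring
    rw [fourierCoeffOn_eq_integral, e, smul_zero]
  -- Parseval: the L_2 norm over one period vanishes.
  have hs := hasSum_sq_fourierCoeffOn (zero_lt_one' ℝ) hD
  simp only [hc, norm_zero, ne_eq, OfNat.ofNat_ne_zero, not_false_eq_true, zero_pow, sub_zero,
    inv_one, one_smul] at hs
  have hz := hs.unique hasSum_zero
  rw [intervalIntegral.integral_of_le zero_le_one,
    integral_eq_zero_iff_of_nonneg (fun _ => by positivity)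
      ((memLp_two_iff_integrable_sq_norm hD.1).1 hD)] at hz
  filter_upwards [hz] with ξ hξ
  simpa using hξ

theorem IsFWavelet.memLp_mask (hw : IsFWavelet w m₀) :
    MemLp (fun ξ => m₀ (2 * Real.pi * ξ)) 2 (volume.restrict (Ioc 0 1)) := by
  have hpi := Real.two_pi_pos
  have h1 : IntervalIntegrable m₀ volume 0 (2 * Real.pi) := by
    rw [intervalIntegrable_iff_integrableOn_Icc_of_le hpi.le]
    exact hw.memLp_m₀.integrable one_le_two
  have h2 : IntervalIntegrable (fun y => ‖m₀ y‖ ^ 2) volume 0 (2 * Real.pi) := by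
    rw [intervalIntegrable_iff_integrableOn_Icc_of_le hpi.le]
    exact (memLp_two_iff_integrable_sq_norm hw.memLp_m₀.1).1 hw.memLp_m₀
  have h1' := h1.comp_mul_left (c := 2 * Real.pi)
  have h2' := h2.comp_mul_left (c := 2 * Real.pi)
  rw [zero_div, div_self hpi.ne', intervalIntegrable_iff_integrableOn_Ioc_of_le zero_le_one]
    at h1' h2'
  exact (memLp_two_iff_integrable_sq_norm h1'.1).2 h2'

theorem IsFWavelet.mask_add_one (hw : IsFWavelet w m₀) (ξ : ℝ) :
    m₀ (2 * Real.pi * (ξ + 1)) = m₀ (2 * Real.pi * ξ) := by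
  rw [mul_add, mul_one]; exact hw.periodic _

/-- The correlations of d with the translates of w are, after periodization of |ŵ|² to 1, the
Fourier coefficients of D. -/
theorem IsFWavelet.ae_eq_zero_of_orthogonal (hw : IsFWavelet w m₀) (hb : IsAmalgam w b)
    {d : ℝ → ℝ} {D : ℝ → ℂ} (hdi : Integrable d) (hL2 : MemLp (ft d) 2)
    (hD : MemLp D 2 (volume.restrict (Ioc 0 1))) (hper : ∀ ξ, D (ξ + 1) = D ξ)
    (hftD : ∀ᵐ ξ, ft d ξ = D ξ * ft w ξ) (horth : ∀ l : ℤ, ∫ x, d x * w (x - l) = 0) :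
    ∀ᵐ ξ, D ξ = 0 := by
  have hi := hb.integrable
  have hprod : Integrable fun ξ => ft d ξ * conj (ft w ξ) :=
    hL2.integrable_mul (hw.memLp_ft hi).star
  have hprod' : Integrable fun ξ => D ξ * ((‖ft w ξ‖ ^ 2 : ℝ) : ℂ) := by
    refine hprod.congr ?_
    filter_upwards [hftD] with ξ hξ
    rw [hξ, mul_assoc, mul_conj_eq_norm_sq]
  refine ae_eq_zero_of_fourier_coeff hD hper fun l => ?_
  have h := integral_mul_comp_sub_eq hdi hb.continuous hi hb.abs_le hprod l
  rw [horth l, Complex.ofReal_zero] at h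
  have hNper : ∀ ξ : ℝ, Complex.exp (↑(2 * Real.pi * l * (ξ + 1)) * Complex.I) * D (ξ + 1) =
      Complex.exp (↑(2 * Real.pi * l * ξ) * Complex.I) * D ξ := fun ξ => by
    rw [hper]
    congr 1
    rw [Complex.exp_eq_exp_iff_exists_int]
    exact ⟨l, by push_cast; ring⟩
  have hNint : Integrable fun ξ => Complex.exp (↑(2 * Real.pi * l * ξ) * Complex.I) * D ξ *
      ((‖ft w ξ‖ ^ 2 : ℝ) : ℂ) := by
    simp only [mul_assoc]
    exact hprod'.bdd_mul (c := 1) (by fun_prop)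
      (ae_of_all _ fun ξ => by rw [Complex.norm_exp_ofReal_mul_I])
  refine (integral_eq_of_periodization
    (N := fun ξ => Complex.exp (↑(2 * Real.pi * l * ξ) * Complex.I) * D ξ)
    (G := fun ξ => ‖ft w ξ‖ ^ 2) hw.ae_hasSum hNper hNint).symm.trans (Eq.trans ?_ h.symm)
  refine integral_congr_ae ?_
  filter_upwards [hftD] with ξ hξ
  rw [hξ, ← mul_conj_eq_norm_sq]
  ring

/-- Orthonormality of the translates recovers the coefficients of the series. -/
theorem IsFWavelet.integral_series_mul_translate (hw : IsFWavelet w m₀) (hb : IsAmalgam w b)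
    {h : ℤ → ℝ} (hh : Summable fun l => |h l|) {v : ℝ → ℝ}
    (hv : ∀ x, HasSum (fun l : ℤ => h l * w (x - l)) (v x)) (l : ℤ) :
    ∫ x, v x * w (x - l) = h l := by
  have hZ : Continuous fun x => w (x - l) := hb.continuous.comp (continuous_sub_right _)
  have hs := hb.hasSum_integral_series hh hv (Z := fun x => w (x - l)) hZ
    (M := ∑' k, b k) fun x => hb.abs_le _
  simp only [smul_eq_mul, hw.integral_translate_mul_translate hb] at hs
  have hs' : HasSum (fun k : ℤ => h k * if k = l then 1 else 0) (h l) := by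
    convert hasSum_ite_eq l (h l) using 2 with k
    split_ifs with hk <;> simp [hk]
  exact hs.unique hs'

theorem IsFWavelet.memLp_ft_sub (hw : IsFWavelet w m₀) (hi : Integrable w) {h : ℤ → ℝ}
    (hh : Summable fun l => |h l|) :
    MemLp (fun ξ => 2 * ft w (2 * ξ) - trigSeries h ξ * ft w ξ) 2 := by
  have hF := hw.memLp_ft hi
  have h1 : MemLp (fun ξ => ft w (2 * ξ)) 2 := by
    refine (memLp_two_iff_integrable_sq_norm ?_).2 ?_
    · exact ((continuous_ft hi).comp (continuous_const_mul 2)).aestronglyMeasurable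
    · exact (hw.integrable_norm_sq hi).comp_mul_left' two_ne_zero
  have h2 : MemLp (fun ξ => trigSeries h ξ * ft w ξ) 2 := by
    refine hF.of_le_mul (c := ∑' l, |h l|)
      ((continuous_trigSeries hh).mul (continuous_ft hi)).aestronglyMeasurable
      (ae_of_all _ fun ξ => ?_)
    rw [norm_mul]
    exact mul_le_mul_of_nonneg_right (norm_trigSeries_le hh ξ) (norm_nonneg _)
  exact (h1.const_mul 2).sub h2

/-- The mask of an `f`-wavelet is half the trigonometric series of the scaling coefficients. -/
theorem IsFWavelet.ae_mask_eq (hw : IsFWavelet w m₀) (hb : IsAmalgam w b) :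
    ∀ᵐ ξ, 2 * m₀ (2 * Real.pi * ξ) = trigSeries (scalingCoeff w) ξ := by
  have hi := hb.integrable
  have hh := hb.summable_scalingCoeff
  have hv := hb.hasSum_translates hh
  have hvA := hb.series hh hv
  have hui := hb.integrable_comp_div_two
  have hftd : ∀ ξ, ft (fun x => w (x / 2) - ∑' l : ℤ, scalingCoeff w l * w (x - l)) ξ =
      2 * ft w (2 * ξ) - trigSeries (scalingCoeff w) ξ * ft w ξ := fun ξ => by
    rw [ft_sub hui hvA.integrable, ft_comp_div_two, ft_eq_trigSeries_mul hb hh hv]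
  have hDL2 : MemLp (fun ξ => 2 * m₀ (2 * Real.pi * ξ) - trigSeries (scalingCoeff w) ξ) 2
      (volume.restrict (Ioc 0 1)) :=
    (hw.memLp_mask.const_mul 2).sub
      (MemLp.of_bound (continuous_trigSeries hh).aestronglyMeasurable _
        (ae_of_all _ (norm_trigSeries_le hh)))
  -- The difference between w(x/2) and its series in translates is orthogonal to every translate by
  -- the choice of coefficients. Its transform is ŵ times the difference of the two candidate masks.
  have hmain := hw.ae_eq_zero_of_orthogonal hb (hui.sub hvA.integrable)
    (by have := hw.memLp_ft_sub hi hh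
        rwa [← funext hftd] at this) hDL2
    (fun ξ => by simp only [hw.mask_add_one, trigSeries_add_one])
    (by
      filter_upwards [hw.ae_refinement] with ξ hξ
      refine (hftd ξ).trans ?_
      rw [hξ]; ring)
    (fun l => by
      have hZ : Continuous fun x => w (x - l) := hb.continuous.comp (continuous_sub_right _)
      have hbd : ∀ᵐ x : ℝ, ‖w (x - l)‖ ≤ ∑' k, b k := ae_of_all _ fun x => hb.abs_le _
      simp only [Pi.sub_apply, sub_mul]
      rw [integral_sub (hui.mul_bdd hZ.aestronglyMeasurable hbd)
        (hvA.integrable.mul_bdd hZ.aestronglyMeasurable hbd),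
        hw.integral_series_mul_translate hb hh hv]
      exact sub_self _)
  filter_upwards [hmain] with ξ hξ
  exact sub_eq_zero.1 hξ

/-- The refinement equation in the time domain. -/
theorem IsFWavelet.hasSum_scalingCoeff (hw : IsFWavelet w m₀) (hb : IsAmalgam w b) (x : ℝ) :
    HasSum (fun l : ℤ => scalingCoeff w l * w (x - l)) (w (x / 2)) := by
  have hh := hb.summable_scalingCoeff
  have hv := hb.hasSum_translates hh
  have hvA := hb.series hh hv
  have := eq_of_ft_ae_eq hvA.continuous hvA.integrable hb.continuous_comp_div_two
    hb.integrable_comp_div_two (by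
      filter_upwards [hw.ae_refinement, hw.ae_mask_eq hb] with ξ h1 h2
      rw [ft_eq_trigSeries_mul hb hh hv, ft_comp_div_two, h1, ← h2]; ring)
  rw [← congrFun this x]
  exact hv x

/-- The equation for the `m`-wavelet in the time domain. -/
theorem IsMWavelet.hasSum_mirrorCoeff (hψ : IsMWavelet w m₀ ψ) (hw : IsFWavelet w m₀)
    (hb : IsAmalgam w b) (hb' : IsAmalgam ψ b') (x : ℝ) :
    HasSum (fun l : ℤ => mirrorCoeff w l * w (x - l)) (ψ (x / 2)) := by
  have hh := summable_mirrorCoeff hb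
  have hv := hb.hasSum_translates hh
  have hvA := hb.series hh hv
  -- Conjugation and l ↦ 1 - l give the modulation; the half-period shift produces the sign
  -- (-1)^(1-l).
  have htrig : ∀ ξ : ℝ, trigSeries (mirrorCoeff w) ξ =
      conj (trigSeries (scalingCoeff w) (ξ + 1 / 2)) *
        Complex.exp (↑(-2 * Real.pi * ξ) * Complex.I) := fun ξ => by
    have h1 := (Complex.hasSum_conj'.2
      (hasSum_trigSeries hb.summable_scalingCoeff (ξ + 1 / 2))).mul_right
        (Complex.exp (↑(-2 * Real.pi * ξ) * Complex.I))
    rw [← (Equiv.subLeft (1 : ℤ)).hasSum_iff] at h1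
    refine (hasSum_trigSeries hh ξ).unique ?_
    have e0 : ∀ l : ℤ, (mirrorCoeff w l : ℂ) *
        Complex.exp (↑(-2 * Real.pi * l * ξ) * Complex.I) =
        conj ((scalingCoeff w (1 - l) : ℂ) * Complex.exp (↑(-2 * Real.pi * ((1 - l : ℤ) : ℝ) *
          (ξ + 1 / 2)) * Complex.I)) * Complex.exp (↑(-2 * Real.pi * ξ) * Complex.I) := fun l => ?_
    · simp only [e0]; exact h1
    simp only [map_mul, Complex.conj_ofReal,
      ← Complex.exp_conj, Complex.conj_I, mirrorCoeff]
    have e : ((-1 : ℝ) ^ (1 - l) : ℝ) = (Complex.exp (Real.pi * Complex.I)) ^ (1 - l) := by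
      rw [Complex.exp_pi_mul_I]; push_cast; rfl
    rw [Complex.ofReal_mul, e, ← Complex.exp_int_mul, mul_comm (Complex.exp _) (scalingCoeff w _ : ℂ),
      mul_assoc (scalingCoeff w (1 - l) : ℂ), mul_assoc (scalingCoeff w (1 - l) : ℂ),
      ← Complex.exp_add, ← Complex.exp_add]
    congr 2
    push_cast
    ring
  have hae : ∀ᵐ ξ : ℝ, 2 * m₀ (2 * Real.pi * (ξ + 1 / 2)) =
      trigSeries (scalingCoeff w) (ξ + 1 / 2) :=
    (measurePreserving_add_right volume (1 / 2 : ℝ)).quasiMeasurePreserving.ae (hw.ae_mask_eq hb)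
  have := eq_of_ft_ae_eq hvA.continuous hvA.integrable hb'.continuous_comp_div_two
    hb'.integrable_comp_div_two (by
      filter_upwards [hψ.ae_eq, hae] with ξ h1 h2
      rw [ft_eq_trigSeries_mul hb hh hv, ft_comp_div_two, h1, htrig, ← h2, map_mul,
        Complex.conj_ofNat]
      ring)
  rw [← congrFun this x]
  exact hv x

end TwoScale

end SubPhi

/-! ### Identities for the scaling coefficients and the partition of unity. -/

namespace SubPhi

theorem hasSum_of_forall_eq {ι E : Type*} [AddCommMonoid E] [TopologicalSpace E] {f g : ι → E}
    {a : E} (h : HasSum f a) (e : ∀ i, g i = f i) : HasSum g a := by rwa [funext e]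

/-- Summation over `ℤ` along two complementary residue classes modulo two. -/
theorem hasSum_int_of_parity {q : ℤ → ℝ} {a c : ℤ} (hac : Odd (a + c)) {s t : ℝ}
    (hs : HasSum (fun k : ℤ => q (a - 2 * k)) s) (ht : HasSum (fun k : ℤ => q (c + 2 * k)) t) :
    HasSum q (s + t) := by
  have hi1 : Function.Injective fun k : ℤ => a - 2 * k := fun x y h => by
    simp only at h; omega
  have hi2 : Function.Injective fun k : ℤ => c + 2 * k := fun x y h => by
    simp only at h; omega
  have h1 := hi1.hasSum_range_iff.2 hs
  have h2 := hi2.hasSum_range_iff.2 ht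
  refine h1.add_isCompl ?_ h2
  rw [isCompl_iff, Set.disjoint_left, codisjoint_iff]
  obtain ⟨r, hr⟩ := hac
  refine ⟨?_, ?_⟩
  · rintro x ⟨k, hk⟩ ⟨l, hl⟩
    simp only at hk hl
    omega
  · refine eq_univ_of_forall fun x => ?_
    rcases Int.even_or_odd' (a - x) with ⟨k, hk | hk⟩
    · exact Or.inl ⟨k, by simp only; omega⟩
    · exact Or.inr ⟨r - k - c, by simp only; omega⟩

theorem summable_mul_comp {ι : Type*} {p q : ℤ → ℝ} (hp : Summable fun l => |p l|)
    (hq : Summable fun l => |q l|) {i : ι → ℤ × ℤ} (hi : Function.Injective i) :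
    Summable fun z => p (i z).1 * q (i z).2 := by
  have h := (hp.mul_of_nonneg hq (fun _ => abs_nonneg _) fun _ => abs_nonneg _).comp_injective hi
  refine Summable.of_norm ?_
  simpa only [Real.norm_eq_abs, abs_mul, Function.comp_def] using h

section Coefficients

variable {w ψ : ℝ → ℝ} {m₀ : ℝ → ℂ} {b b' : ℤ → ℝ}

/-- Expand w(x/2) by the refinement equation and integrate against w(x/2 - d); the substitution x =
2y produces the 2. -/
theorem IsFWavelet.hasSum_scalingCoeff_mul (hw : IsFWavelet w m₀) (hb : IsAmalgam w b) (d : ℤ) :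
    HasSum (fun l => scalingCoeff w l * scalingCoeff w (l - 2 * d)) (if d = 0 then 2 else 0) := by
  have hc := hb.continuous
  have h := hb.hasSum_integral_series hb.summable_scalingCoeff (hw.hasSum_scalingCoeff hb)
    (Z := fun x => w ((x - 2 * d) / 2)) (by fun_prop) (M := ∑' k, b k) fun x => hb.abs_le _
  have e1 : ∀ l : ℤ, ∫ x, w (x - l) • w ((x - 2 * d) / 2) = scalingCoeff w (l - 2 * d) := by
    intro l
    rw [scalingCoeff, ← integral_sub_right_eq_self (fun x => w (x / 2) * w (x - ↑(l - 2 * d)))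
      (2 * d : ℝ)]
    refine integral_congr_ae (ae_of_all _ fun x => ?_)
    simp only [smul_eq_mul]
    rw [mul_comm]
    congr 2
    push_cast; ring
  have e2 : ∫ x, w (x / 2) • w ((x - 2 * d) / 2) = if d = 0 then 2 else 0 := by
    have h2 := Measure.integral_comp_div (fun y => w y * w (y - d)) 2
    rw [hw.integral_mul_translate hb d, abs_of_pos two_pos, smul_eq_mul, mul_ite, mul_one,
      mul_zero] at h2
    rw [← h2]
    refine integral_congr_ae (ae_of_all _ fun x => ?_)
    simp only [smul_eq_mul]
    congr 2
    ring
  rw [e2] at h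
  exact hasSum_of_forall_eq h fun l => by rw [e1, smul_eq_mul]

theorem mirrorCoeff_mul (w : ℝ → ℝ) (m m' k : ℤ) :
    mirrorCoeff w (m' - 2 * k) * mirrorCoeff w (m - 2 * k) =
      (-1) ^ (m + m') * (scalingCoeff w (1 - m' + 2 * k) * scalingCoeff w (1 - m + 2 * k)) := by
  have e : ((-1 : ℝ) ^ (1 - (m' - 2 * k))) * (-1) ^ (1 - (m - 2 * k)) = (-1) ^ (m + m') := by
    rw [← zpow_add₀ (by norm_num), show 1 - (m' - 2 * k) + (1 - (m - 2 * k)) =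
      (m + m') + 2 * (1 - m - m' + 2 * k) by ring, zpow_add₀ (by norm_num),
      Even.neg_one_zpow (even_two_mul _), mul_one]
  rw [mirrorCoeff, mirrorCoeff, ← e]
  rw [show 1 - (m' - 2 * k) = 1 - m' + 2 * k by ring, show 1 - (m - 2 * k) = 1 - m + 2 * k by ring]
  ring

theorem summable_coeff_mul {h : ℤ → ℝ} (hh : Summable fun l => |h l|) (m m' : ℤ) :
    Summable fun k : ℤ => h (m' - 2 * k) * h (m - 2 * k) :=
  summable_mul_comp hh hh (i := fun k : ℤ => (m' - 2 * k, m - 2 * k)) fun x y h => by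
    simp only [Prod.mk.injEq] at h; omega

/-- The two families of coefficients form an orthogonal matrix (up to the factor `2`). -/
theorem IsFWavelet.hasSum_gram (hw : IsFWavelet w m₀) (hb : IsAmalgam w b) (m m' : ℤ) :
    HasSum (fun k : ℤ => scalingCoeff w (m' - 2 * k) * scalingCoeff w (m - 2 * k) +
      mirrorCoeff w (m' - 2 * k) * mirrorCoeff w (m - 2 * k)) (if m' = m then 2 else 0) := by
  have hh := hb.summable_scalingCoeff
  have hs := (summable_coeff_mul hh m m').hasSum
  have ht := (summable_coeff_mul (summable_mirrorCoeff hb) m m').hasSum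
  convert hs.add ht using 1
  rcases Int.even_or_odd (m + m') with hp | hp
  -- Equal parity: the mirror terms carry sign +1 and run over the complementary residue class, so
  -- the two sums together form the full double-shift sum.
  · simp only [mirrorCoeff_mul, hp.neg_one_zpow, one_mul] at ht ⊢
    obtain ⟨d, hd⟩ : ∃ d, m' - m = 2 * d := by
      obtain ⟨r, hr⟩ := hp; exact ⟨m' - r, by omega⟩
    have hq := hw.hasSum_scalingCoeff_mul hb d
    have h2 := hasSum_int_of_parity
      (q := fun l => scalingCoeff w l * scalingCoeff w (l - 2 * d)) (a := m') (c := 1 - m)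
      ⟨d, by omega⟩ (hasSum_of_forall_eq hs fun k => by
        rw [show m' - 2 * k - 2 * d = m - 2 * k by omega])
      (hasSum_of_forall_eq ht fun k => by
        rw [mul_comm, show 1 - m + 2 * k - 2 * d = 1 - m' + 2 * k by omega])
    rw [h2.unique hq]
    refine if_congr ?_ rfl rfl
    omega
  · obtain ⟨r, hr⟩ := hp
    -- Opposite parity: k ↦ r - k identifies the mirror sum with the first one, and its sign -1
    -- cancels it.
    have h2 : HasSum (fun k : ℤ => scalingCoeff w (1 - m' + 2 * k) * scalingCoeff w (1 - m + 2 * k))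
        (∑' k : ℤ, scalingCoeff w (m' - 2 * k) * scalingCoeff w (m - 2 * k)) := by
      rw [← (Equiv.subLeft r).hasSum_iff]
      refine hasSum_of_forall_eq hs fun k => ?_
      rw [Function.comp_apply, Equiv.subLeft_apply, mul_comm,
        show 1 - m + 2 * (r - k) = m' - 2 * k by omega,
        show 1 - m' + 2 * (r - k) = m - 2 * k by omega]
    have h3 := h2.mul_left ((-1) ^ (m + m'))
    simp only [mirrorCoeff_mul]
    rw [h3.tsum_eq, Odd.neg_one_zpow ⟨r, hr⟩, if_neg (by omega)]
    ring

theorem IsFWavelet.integral_ne_zero (hw : IsFWavelet w m₀) : ∫ x, w x ≠ 0 := by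
  intro h
  apply hw.hat_zero_ne
  rw [fourierHat_eq, zero_div, ft_zero, h, Complex.ofReal_zero]

/-- The scaling coefficients sum to one over each residue class modulo two. -/
theorem IsFWavelet.hasSum_scalingCoeff_residue (hw : IsFWavelet w m₀) (hb : IsAmalgam w b)
    (m : ℤ) : HasSum (fun k : ℤ => scalingCoeff w (m - 2 * k)) 1 := by
  have hh := hb.summable_scalingCoeff
  set h := scalingCoeff w with hdef
  have hsum : Summable h := hh.of_abs
  set s0 := ∑' k : ℤ, h (0 - 2 * k) with hs0
  set s1 := ∑' k : ℤ, h (1 + 2 * k) with hs1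
  have i0 : HasSum (fun k : ℤ => h (0 - 2 * k)) s0 :=
    (hsum.comp_injective (i := fun k : ℤ => 0 - 2 * k) fun x y h => by
      simp only at h; omega).hasSum
  have i1 : HasSum (fun k : ℤ => h (1 + 2 * k)) s1 :=
    (hsum.comp_injective (i := fun k : ℤ => 1 + 2 * k) fun x y h => by
      simp only at h; omega).hasSum
  have heven : ∀ r : ℤ, HasSum (fun k : ℤ => h (2 * r - 2 * k)) s0 := fun r => by
    rw [← (Equiv.addRight r).hasSum_iff]
    refine hasSum_of_forall_eq i0 fun k => ?_
    rw [Function.comp_apply, Equiv.coe_addRight]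
    ring_nf
  have hodd : ∀ r : ℤ, HasSum (fun k : ℤ => h (2 * r + 1 - 2 * k)) s1 := fun r => by
    rw [← (Equiv.subLeft r).hasSum_iff]
    refine hasSum_of_forall_eq i1 fun k => ?_
    rw [Function.comp_apply, Equiv.subLeft_apply]
    ring_nf
  have htot : HasSum h (s0 + s1) := hasSum_int_of_parity (by norm_num) i0 i1
  -- Integrate the refinement equation and divide by ∫ w ≠ 0.
  have hone : s0 + s1 = 2 := by
    have hθ := hb.hasSum_integral_series hh (hw.hasSum_scalingCoeff hb) (Z := fun _ => (1 : ℝ))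
      continuous_const (M := 1) (by simp)
    simp only [smul_eq_mul, mul_one] at hθ
    have e1 : ∀ l : ℤ, ∫ x, w (x - l) = ∫ x, w x := fun l => integral_sub_right_eq_self _ _
    simp only [e1] at hθ
    have e2 := hθ.unique (htot.mul_right _)
    rw [Measure.integral_comp_div, abs_of_pos two_pos, smul_eq_mul] at e2
    exact (mul_right_cancel₀ hw.integral_ne_zero e2).symm
  -- Sum h(l)h(l - 2d) over all pairs: over l first gives Σ_d 2δ_{d,0} = 2, over d first gives h(l)
  -- times the sum over the class of l.
  have htwo : s0 ^ 2 + s1 ^ 2 = 2 := by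
    have hd : Summable fun z : ℤ × ℤ => h z.1 * h (z.1 - 2 * z.2) :=
      summable_mul_comp hh hh (i := fun z : ℤ × ℤ => (z.1, z.1 - 2 * z.2)) fun x y h => by
        simp only [Prod.mk.injEq] at h
        ext <;> omega
    have hd' : HasSum (fun z : ℤ × ℤ => h z.2 * h (z.2 - 2 * z.1))
        (∑' z : ℤ × ℤ, h z.1 * h (z.1 - 2 * z.2)) :=
      (Equiv.prodComm ℤ ℤ).hasSum_iff.2 hd.hasSum
    have h1 := hd'.prod_fiberwise fun d => hw.hasSum_scalingCoeff_mul hb d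
    have h1' : HasSum (fun d : ℤ => if d = 0 then (2 : ℝ) else 0) 2 := hasSum_ite_eq 0 2
    have h2 := hd.hasSum.prod_fiberwise fun l => ((hd.prod_factor l).hasSum)
    rw [h1.unique h1'] at h2
    have h3 := hasSum_int_of_parity (a := 0) (c := 1) (by norm_num)
      (q := fun l => ∑' k : ℤ, h l * h (l - 2 * k)) (s := s0 * s0) (t := s1 * s1)
      (hasSum_of_forall_eq (i0.mul_right s0) fun k => by
        rw [tsum_mul_left, ← (heven (-k)).tsum_eq]
        ring_nf) (hasSum_of_forall_eq (i1.mul_right s1) fun k => by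
        rw [tsum_mul_left, ← (hodd k).tsum_eq]
        ring_nf)
    have := h2.unique h3
    rw [this]; ring
  -- The two relations give (s0 - 1)² + (s1 - 1)² = 0.
  have h0 : s0 = 1 := by nlinarith [sq_nonneg (s0 - 1), sq_nonneg (s1 - 1)]
  have h1 : s1 = 1 := by linarith
  rcases Int.even_or_odd' m with ⟨r, rfl | rfl⟩
  · rw [← h0]; exact heven r
  · rw [← h1]; exact hodd r

/-- The integer translates of an `f`-wavelet form a partition of a constant. -/
theorem IsFWavelet.hasSum_translates (hw : IsFWavelet w m₀) (hb : IsAmalgam w b) (x : ℝ) :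
    HasSum (fun k : ℤ => w (x - k)) (∫ y, w y)⁻¹ := by
  have hh := hb.summable_scalingCoeff
  set G : ℝ → ℝ := fun x => ∑' k : ℤ, w (x - k) with hG
  have hGs : ∀ x, HasSum (fun k : ℤ => w (x - k)) (G x) := fun x =>
    (hb.summable_abs x).of_abs.hasSum
  -- Insert the refinement equation and sum over k first; each residue sum is 1.
  have hscale : ∀ x, G (x / 2) = G x := fun x => by
    have hd : Summable fun z : ℤ × ℤ => scalingCoeff w (z.2 - 2 * z.1) * w (x - z.2) :=
      summable_mul_comp hh (q := fun l : ℤ => w (x - l)) (hb.summable_abs x)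
        (i := fun z : ℤ × ℤ => (z.2 - 2 * z.1, z.2)) fun x y h => by
          simp only [Prod.mk.injEq] at h
          ext <;> omega
    have h1 := hd.hasSum.prod_fiberwise (g := fun k : ℤ => w (x / 2 - k)) fun k => by
      have := hw.hasSum_scalingCoeff hb (x - 2 * k)
      rw [← (Equiv.subRight (2 * k)).hasSum_iff] at this
      rw [show (x - 2 * k) / 2 = x / 2 - k by ring] at this
      refine hasSum_of_forall_eq this fun m => ?_
      rw [Function.comp_apply, Equiv.subRight_apply]
      congr 2
      push_cast; ring
    have h2 := ((Equiv.prodComm ℤ ℤ).hasSum_iff.2 hd.hasSum).prod_fiberwise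
      (g := fun m : ℤ => 1 * w (x - m)) fun m =>
        (hw.hasSum_scalingCoeff_residue hb m).mul_right (w (x - m))
    simp only [one_mul] at h2
    rw [(hGs (x / 2)).unique h1, (hGs x).unique h2]
  have hcont : ContinuousAt G 0 := by
    have hc := hb.continuous
    -- Near 0 the floor is only 0 or -1, so two shifts of b dominate the series uniformly.
    have hon : ContinuousOn G (Ioo (-1) 1) := by
      refine continuousOn_tsum (u := fun k : ℤ => b (0 - k) + b (-1 - k))
        (fun k => by fun_prop) ((hb.summable_sub 0).add (hb.summable_sub (-1))) fun k x hx => ?_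
      have h1 := hb.abs_sub_le x k
      have h2 := hb.nonneg (0 - k)
      have h3 := hb.nonneg (-1 - k)
      rw [Real.norm_eq_abs]
      rcases le_or_gt 0 x with h | h
      · rw [Int.floor_eq_zero_iff.2 ⟨h, hx.2⟩] at h1; linarith
      · have hf : ⌊x⌋ = -1 := Int.floor_eq_iff.2 (by push_cast; constructor <;> linarith [hx.1])
        rw [hf] at h1
        linarith
    exact hon.continuousAt (Ioo_mem_nhds (by norm_num) (by norm_num))
  -- G(x) = G(x/2^n), and the argument tends to 0.
  have hconst : ∀ x, G x = G 0 := fun x => by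
    have hn : ∀ n : ℕ, G (x / 2 ^ n) = G x := fun n => by
      induction n with
      | zero => simp
      | succ n ih => rw [pow_succ, ← div_div, hscale, ih]
    have hlim : Tendsto (fun n : ℕ => x / 2 ^ n) atTop (𝓝 0) :=
      tendsto_const_nhds.div_atTop (tendsto_pow_atTop_atTop_of_one_lt one_lt_two)
    have h1 := hcont.tendsto.comp hlim
    refine tendsto_nhds_unique ?_ h1
    simp only [Function.comp_def, hn]
    exact tendsto_const_nhds
  -- Summing the correlations ∫ w(x) w(x-k) dx over k gives 1 by orthonormality and ∫ wG by
  -- exchange.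
  have hnorm : (∫ y, w y) * G 0 = 1 := by
    have hi := hb.integrable
    have h1 := hasSum_integral_of_summable_integral_norm
      (F := fun (k : ℤ) x => w x * w (x - k)) (fun k => hb.integrable_mul_translate hi k)
      (by simpa only [Real.norm_eq_abs] using hb.summable_integral_abs hi)
    simp only [hw.integral_mul_translate hb] at h1
    have h2 := h1.unique (hasSum_ite_eq 0 1)
    rw [← h2, ← integral_mul_const]
    refine integral_congr_ae (ae_of_all _ fun x => ?_)
    simp only
    rw [tsum_mul_left, ← hconst x]
  rw [inv_eq_of_mul_eq_one_right hnorm, ← hconst x]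
  exact hGs x

end Coefficients

end SubPhi

/-! ### Multiresolution projections of bounded continuous Banach-valued functions. -/

namespace SubPhi

section Expansion

variable {E : Type*} [NormedAddCommGroup E] [NormedSpace ℝ E]
  {w ψ : ℝ → ℝ} {m₀ : ℝ → ℂ} {b b' : ℤ → ℝ} {Z : ℝ → E} {M : ℝ}

theorem IsAmalgam.norm_integral_le (hb : IsAmalgam w b) (hM : ∀ x, ‖Z x‖ ≤ M) (l : ℝ) :
    ‖∫ x, w (x - l) • Z x‖ ≤ (∫ x, |w x|) * M := by
  refine (norm_integral_le_of_norm_le ((hb.integrable_comp_sub l).abs.mul_const M)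
    (ae_of_all _ fun x => ?_)).trans_eq ?_
  · rw [norm_smul, Real.norm_eq_abs]
    exact mul_le_mul_of_nonneg_left (hM x) (abs_nonneg _)
  · rw [integral_mul_const, integral_sub_right_eq_self (fun x => |w x|) l]

/-- The `k`-th term of the level `n` projection of `Z`. -/
noncomputable def levelTerm (g : ℝ → ℝ) (Z : ℝ → E) (n : ℕ) (k : ℤ) (t : ℝ) : E :=
  dilate g n k t • ∫ s, dilate g n k s • Z s

/-- The two factors 2^(n/2) cancel the Jacobian of u = 2^n s, so every level looks like level 0 for
a rescaled Z. -/
theorem levelTerm_eq (g : ℝ → ℝ) (Z : ℝ → E) (n : ℕ) (k : ℤ) (t : ℝ) :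
    levelTerm g Z n k t = g (2 ^ n * t - k) • ∫ u, g (u - k) • Z (u / 2 ^ n) := by
  have h2 : (0 : ℝ) < 2 ^ n := by positivity
  have hsq : (2 : ℝ) ^ ((n : ℝ) / 2) * (2 : ℝ) ^ ((n : ℝ) / 2) = 2 ^ n := by
    rw [← Real.rpow_add two_pos, add_halves, Real.rpow_natCast]
  have h3 := Measure.integral_comp_mul_left (fun u => g (u - k) • Z (u / 2 ^ n)) (2 ^ n)
  rw [abs_of_pos (inv_pos.2 h2)] at h3
  simp only [mul_div_cancel_left₀ _ h2.ne'] at h3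
  simp only [levelTerm, dilate, mul_smul, integral_smul]
  rw [h3, smul_comm (g _) ((2 : ℝ) ^ ((n : ℝ) / 2)), smul_smul, hsq,
    smul_comm (g _), smul_smul, mul_inv_cancel₀ h2.ne', one_smul]

variable [CompleteSpace E]

/-- Absolute summability over the coarse index and both fine indices; it licenses every reordering
below. -/
theorem summable_triple {h q : ℤ → ℝ} {a : ℤ → E} (hh : Summable fun l => |h l|)
    (hq : Summable fun l => |q l|) (ha : ∀ l, ‖a l‖ ≤ M) :
    Summable fun z : ℤ × ℤ × ℤ =>
      (h (z.2.1 - 2 * z.1) * h (z.2.2 - 2 * z.1) * q z.2.1) • a z.2.2 := by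
  have h1 : Summable fun z : ℤ × ℤ => |h z.1| * |q z.2| :=
    hh.mul_of_nonneg hq (fun _ => abs_nonneg _) fun _ => abs_nonneg _
  have h2 : Summable fun z : ℤ × ℤ × ℤ => |h z.1| * (|h z.2.1| * |q z.2.2|) :=
    hh.mul_of_nonneg h1 (fun _ => abs_nonneg _) fun _ => by positivity
  have hi : Function.Injective fun z : ℤ × ℤ × ℤ =>
      (z.2.1 - 2 * z.1, z.2.2 - 2 * z.1, z.2.1) := fun x y h => by
    simp only [Prod.mk.injEq] at h
    ext <;> omega
  refine Summable.of_norm_bounded ((h2.comp_injective hi).mul_right M) fun z => ?_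
  simp only [norm_smul, norm_mul, Real.norm_eq_abs, Function.comp_apply]
  calc |h (z.2.1 - 2 * z.1)| * |h (z.2.2 - 2 * z.1)| * |q z.2.1| * ‖a z.2.2‖
      ≤ |h (z.2.1 - 2 * z.1)| * |h (z.2.2 - 2 * z.1)| * |q z.2.1| * M := by
        gcongr; exact ha _
    _ = _ := by ring

/-- One level of the synthesis operator followed by its adjoint, in terms of coefficients. -/
theorem hasSum_synthesis {h q α : ℤ → ℝ} {a β : ℤ → E} (hh : Summable fun l => |h l|)
    (hq : Summable fun l => |q l|) (ha : ∀ l, ‖a l‖ ≤ M)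
    (hα : ∀ k, HasSum (fun l => h (l - 2 * k) * q l) (α k))
    (hβ : ∀ k, HasSum (fun l => h (l - 2 * k) • a l) (β k)) :
    HasSum (fun k => α k • β k)
      (∑' z : ℤ × ℤ × ℤ, (h (z.2.1 - 2 * z.1) * h (z.2.2 - 2 * z.1) * q z.2.1) • a z.2.2) := by
  have hs := summable_triple hh hq ha
  refine hs.hasSum.prod_fiberwise fun k => ?_
  have hk := (hs.prod_factor k).hasSum
  have h1 := hk.prod_fiberwise (g := fun m => (h (m - 2 * k) * q m) • β k) fun m =>
    hasSum_of_forall_eq ((hβ k).const_smul (h (m - 2 * k) * q m)) fun l => by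
      rw [smul_smul]; congr 1; ring
  rw [((hα k).smul_const (β k)).unique h1]
  exact hk

theorem hasSum_coarse_coeff (hb : IsAmalgam w b) {h : ℤ → ℝ} (hh : Summable fun l => |h l|)
    {v : ℝ → ℝ} (hv : ∀ x, HasSum (fun l : ℤ => h l * w (x - l)) (v (x / 2)))
    (hZ : Continuous Z) (hM : ∀ x, ‖Z x‖ ≤ M) (k : ℤ) :
    HasSum (fun l : ℤ => h (l - 2 * k) • ∫ x, w (x - l) • Z x) (∫ x, v (x / 2 - k) • Z x) := by
  have h1 := hb.hasSum_integral_series hh hv (Z := fun x => Z (x + 2 * k)) (by fun_prop)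
    (M := M) fun x => hM _
  rw [← (Equiv.subRight (2 * k)).hasSum_iff] at h1
  have e : ∫ x, v (x / 2) • Z (x + 2 * k) = ∫ x, v (x / 2 - k) • Z x := by
    rw [← integral_add_right_eq_self (fun x => v (x / 2 - k) • Z x) (2 * k : ℝ)]
    refine integral_congr_ae (ae_of_all _ fun x => ?_)
    simp only
    congr 2
    ring
  rw [e] at h1
  refine hasSum_of_forall_eq h1 fun l => ?_
  rw [Function.comp_apply, Equiv.subRight_apply]
  congr 1
  rw [← integral_add_right_eq_self (fun x => w (x - l) • Z x) (2 * k : ℝ)]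
  refine integral_congr_ae (ae_of_all _ fun x => ?_)
  simp only
  congr 2
  push_cast; ring

theorem hasSum_coarse_value {h : ℤ → ℝ} {v : ℝ → ℝ}
    (hv : ∀ x, HasSum (fun l : ℤ => h l * w (x - l)) (v (x / 2))) (x : ℝ) (k : ℤ) :
    HasSum (fun l : ℤ => h (l - 2 * k) * w (x - l)) (v (x / 2 - k)) := by
  have h1 := hv (x - 2 * k)
  rw [← (Equiv.subRight (2 * k)).hasSum_iff, show (x - 2 * k) / 2 = x / 2 - k by ring] at h1
  refine hasSum_of_forall_eq h1 fun l => ?_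
  rw [Function.comp_apply, Equiv.subRight_apply]
  congr 2
  push_cast; ring

/-- The two-level decomposition `V₁ = V₀ ⊕ W₀` for bounded continuous functions. -/
theorem hasSum_two_level (hw : IsFWavelet w m₀) (hψ : IsMWavelet w m₀ ψ) (hb : IsAmalgam w b)
    (hb' : IsAmalgam ψ b') (hZ : Continuous Z) (hM : ∀ x, ‖Z x‖ ≤ M) (x : ℝ) :
    (∑' k : ℤ, w (x / 2 - k) • ∫ y, w (y / 2 - k) • Z y) +
      ∑' k : ℤ, ψ (x / 2 - k) • ∫ y, ψ (y / 2 - k) • Z y =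
      (2 : ℝ) • ∑' l : ℤ, w (x - l) • ∫ y, w (y - l) • Z y := by
  have hh := hb.summable_scalingCoeff
  have hg := summable_mirrorCoeff hb
  have hvw := hw.hasSum_scalingCoeff hb
  have hvψ := hψ.hasSum_mirrorCoeff hw hb hb'
  have hq := hb.summable_abs x
  have ha : ∀ l : ℤ, ‖∫ y, w (y - l) • Z y‖ ≤ (∫ y, |w y|) * M := fun l =>
    hb.norm_integral_le hM l
  have s1 := hasSum_synthesis hh hq ha (hasSum_coarse_value hvw x)
    (hasSum_coarse_coeff hb hh hvw hZ hM)
  have s2 := hasSum_synthesis hg hq ha (hasSum_coarse_value hvψ x)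
    (hasSum_coarse_coeff hb hg hvψ hZ hM)
  rw [s1.tsum_eq, s2.tsum_eq, ← (summable_triple hh hq ha).tsum_add (summable_triple hg hq ha)]
  have hs := ((summable_triple hh hq ha).add (summable_triple hg hq ha)).hasSum
  -- Sum over the coarse index first: the Gram identity collapses the double sum over fine indices
  -- to its diagonal.
  have hs' := ((Equiv.prodComm (ℤ × ℤ) ℤ).hasSum_iff.2 hs).prod_fiberwise
    (g := fun z : ℤ × ℤ => (if z.1 = z.2 then (2 : ℝ) else 0) •
      (w (x - z.1) • ∫ y, w (y - z.2) • Z y)) fun z =>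
    hasSum_of_forall_eq ((hw.hasSum_gram hb z.2 z.1).smul_const _) fun k => by
      simp only [Function.comp_apply, Equiv.prodComm_apply, Prod.swap, smul_smul]
      rw [← add_smul]
      congr 1
      ring
  have hs2 := hs'.prod_fiberwise
    (g := fun l : ℤ => (2 : ℝ) • (w (x - l) • ∫ y, w (y - l) • Z y)) fun l => by
      refine hasSum_of_forall_eq
        (hasSum_ite_eq l ((2 : ℝ) • (w (x - l) • ∫ y, w (y - l) • Z y))) fun m => ?_
      simp only [eq_comm (a := l)]
      split_ifs with hm
      · rw [hm]
      · rw [zero_smul]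
  rw [← hs2.tsum_eq, tsum_const_smul'']

/-! ### Multiresolution projections -/

theorem summable_levelTerm {g : ℝ → ℝ} (hb : IsAmalgam g b) (hM : ∀ x, ‖Z x‖ ≤ M) (n : ℕ)
    (t : ℝ) : Summable fun k : ℤ => levelTerm g Z n k t := by
  refine Summable.of_norm_bounded
    ((hb.summable_abs (2 ^ n * t)).mul_right ((∫ x, |g x|) * M)) fun k => ?_
  rw [levelTerm_eq, norm_smul, Real.norm_eq_abs]
  exact mul_le_mul_of_nonneg_left (hb.norm_integral_le (Z := fun u => Z (u / 2 ^ n))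
    (fun x => hM _) k) (abs_nonneg _)

theorem tsum_levelTerm_succ (hw : IsFWavelet w m₀) (hψ : IsMWavelet w m₀ ψ) (hb : IsAmalgam w b)
    (hb' : IsAmalgam ψ b') (hZ : Continuous Z) (hM : ∀ x, ‖Z x‖ ≤ M) (n : ℕ) (t : ℝ) :
    ∑' k : ℤ, levelTerm w Z (n + 1) k t =
      ∑' k : ℤ, levelTerm w Z n k t + ∑' k : ℤ, levelTerm ψ Z n k t := by
  have h := hasSum_two_level hw hψ hb hb' (Z := fun u => Z (u / 2 ^ (n + 1)))
    (by fun_prop) (fun x => hM _) (2 ^ (n + 1) * t)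
  have hx : 2 ^ (n + 1) * t / 2 = 2 ^ n * t := by rw [pow_succ]; ring
  have e : ∀ (g : ℝ → ℝ) (k : ℤ), ∫ y, g (y / 2 - k) • Z (y / 2 ^ (n + 1)) =
      (2 : ℝ) • ∫ u, g (u - k) • Z (u / 2 ^ n) := fun g k => by
    have := Measure.integral_comp_div (fun u => g (u - k) • Z (u / 2 ^ n)) 2
    rw [abs_of_pos two_pos] at this
    rw [← this]
    refine integral_congr_ae (ae_of_all _ fun y => ?_)
    simp only
    rw [pow_succ', div_div]
  simp only [e, hx, smul_comm _ (2 : ℝ), ← levelTerm_eq] at h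
  rw [tsum_const_smul'', tsum_const_smul'', ← smul_add] at h
  exact (smul_right_injective E (two_ne_zero' ℝ) h).symm

theorem tsum_levelTerm_eq_sum (hw : IsFWavelet w m₀) (hψ : IsMWavelet w m₀ ψ)
    (hb : IsAmalgam w b) (hb' : IsAmalgam ψ b') (hZ : Continuous Z) (hM : ∀ x, ‖Z x‖ ≤ M)
    (n : ℕ) (t : ℝ) :
    ∑' k : ℤ, levelTerm w Z n k t =
      ∑' k : ℤ, levelTerm w Z 0 k t + ∑ j ∈ Finset.range n, ∑' k : ℤ, levelTerm ψ Z j k t := by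
  induction n with
  | zero => simp
  | succ n ih =>
    rw [tsum_levelTerm_succ hw hψ hb hb' hZ hM, ih, Finset.sum_range_succ, add_assoc]

/-- Pointwise convergence of the multiresolution projections. -/
theorem tendsto_tsum_levelTerm (hw : IsFWavelet w m₀) (hb : IsAmalgam w b) (hZ : Continuous Z)
    (hM : ∀ x, ‖Z x‖ ≤ M) (t : ℝ) :
    Tendsto (fun n : ℕ => ∑' k : ℤ, levelTerm w Z n k t) atTop (𝓝 (Z t)) := by
  have hi := hb.integrable
  have hθ := hw.integral_ne_zero
  have hbd : ∀ y, ‖Z y - Z t‖ ≤ M + M := fun y => (norm_sub_le _ _).trans (add_le_add (hM _) (hM _))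
  have hint : ∀ (n : ℕ) (c : ℝ), Integrable fun u => w u • (Z ((u + c) / 2 ^ n) - Z t) :=
    fun n c => hi.smul_bdd (M + M) (by fun_prop) (ae_of_all _ fun u => hbd _)
  -- Indexing from ⌊2^n t⌋ bounds the weights by b(k) for every n. Subtracting Z(t) inside the
  -- integral is allowed by the partition of unity, since the weights times ∫ w add up to 1.
  set D : ℕ → ℤ → E := fun n k =>
    w (Int.fract (2 ^ n * t) + k) • ∫ u, w u • (Z ((u + (⌊2 ^ n * t⌋ - k)) / 2 ^ n) - Z t) with hD
  have hdiff : ∀ n : ℕ, ∑' k : ℤ, levelTerm w Z n k t = ∑' k, D n k + Z t := fun n => by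
    have h1 := (summable_levelTerm hb hM n t).hasSum
    have h2 := (hw.hasSum_translates hb (2 ^ n * t)).smul_const ((∫ y, w y) • Z t)
    rw [smul_smul, inv_mul_cancel₀ hθ, one_smul] at h2
    have h3 := h1.sub h2
    rw [← (Equiv.subLeft ⌊2 ^ n * t⌋).hasSum_iff] at h3
    have h4 : HasSum (D n) (∑' k : ℤ, levelTerm w Z n k t - Z t) := by
      refine hasSum_of_forall_eq h3 fun k => ?_
      simp only [Function.comp_apply, Equiv.subLeft_apply, levelTerm_eq, hD]
      rw [← smul_sub]
      congr 1
      · congr 1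
        rw [← Int.self_sub_floor]; push_cast; ring
      · rw [← integral_add_right_eq_self
            (fun u => w (u - ((⌊2 ^ n * t⌋ - k : ℤ) : ℝ)) • Z (u / 2 ^ n))
            ((⌊2 ^ n * t⌋ - k : ℤ) : ℝ), ← integral_smul_const,
          ← integral_sub]
        · refine integral_congr_ae (ae_of_all _ fun u => ?_)
          simp only
          rw [add_sub_cancel_right, ← smul_sub]
          push_cast; rfl
        · simp only [add_sub_cancel_right]
          exact hi.smul_bdd M (by fun_prop) (ae_of_all _ fun u => hM _)
        · exact hi.smul_const _
    rw [h4.tsum_eq]; abel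
  simp only [hdiff]
  suffices h : Tendsto (fun n => ∑' k, D n k) atTop (𝓝 (∑' _ : ℤ, (0 : E))) by
    simpa using h.add_const (Z t)
  have hfl : Tendsto (fun n : ℕ => (⌊(2 : ℝ) ^ n * t⌋ : ℝ) / 2 ^ n) atTop (𝓝 t) := by
    have h0 : Tendsto (fun n : ℕ => Int.fract ((2 : ℝ) ^ n * t) / 2 ^ n) atTop (𝓝 0) := by
      refine squeeze_zero (fun n => div_nonneg (Int.fract_nonneg _) (by positivity))
        (fun n => div_le_div_of_nonneg_right (Int.fract_lt_one _).le (by positivity)) ?_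
      exact tendsto_const_nhds.div_atTop (tendsto_pow_atTop_atTop_of_one_lt one_lt_two)
    have h1 := h0.const_sub t
    rw [sub_zero] at h1
    refine h1.congr fun n => ?_
    rw [← Int.self_sub_floor]
    field_simp
    ring
  -- Dominated convergence twice: over k, with majorant b, and for each k in the integral, where the
  -- argument of Z tends to t.
  refine tendsto_tsum_of_dominated_convergence
    (bound := fun k => b k * ((∫ x, |w x|) * (M + M))) (hb.summable.mul_right _) (fun k => ?_)
    (Eventually.of_forall fun n k => ?_)
  · have hlim : Tendsto (fun n : ℕ => ∫ u, w u • (Z ((u + (⌊2 ^ n * t⌋ - k)) / 2 ^ n) - Z t))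
        atTop (𝓝 (∫ _ : ℝ, (0 : E))) := by
      refine tendsto_integral_of_dominated_convergence (fun u => |w u| * (M + M))
        (fun n => (hint n _).aestronglyMeasurable) (hi.abs.mul_const _)
        (fun n => ae_of_all _ fun u => ?_) (ae_of_all _ fun u => ?_)
      · rw [norm_smul, Real.norm_eq_abs]
        exact mul_le_mul_of_nonneg_left (hbd _) (abs_nonneg _)
      · have harg : Tendsto (fun n : ℕ => (u + (⌊2 ^ n * t⌋ - k)) / 2 ^ n) atTop (𝓝 t) := by
          have h0 : Tendsto (fun n : ℕ => (u - k) / 2 ^ n) atTop (𝓝 0) :=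
            tendsto_const_nhds.div_atTop (tendsto_pow_atTop_atTop_of_one_lt one_lt_two)
          have := h0.add hfl
          rw [zero_add] at this
          refine this.congr fun n => ?_
          ring
        have h1 := ((hZ.tendsto t).comp harg).sub_const (Z t)
        rw [sub_self] at h1
        simpa using h1.const_smul (w u)
    rw [integral_zero] at hlim
    refine squeeze_zero_norm (a := fun n => b k *
      ‖∫ u, w u • (Z ((u + (⌊2 ^ n * t⌋ - k)) / 2 ^ n) - Z t)‖) (fun n => ?_) ?_
    · rw [hD, norm_smul, Real.norm_eq_abs]
      exact mul_le_mul_of_nonneg_right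
        (hb.bound k _ ⟨Int.fract_nonneg _, (Int.fract_lt_one _).le⟩) (norm_nonneg _)
    · simpa using hlim.norm.const_mul (b k)
  · rw [hD, norm_smul, Real.norm_eq_abs]
    refine mul_le_mul (hb.bound k _ ⟨Int.fract_nonneg _, (Int.fract_lt_one _).le⟩) ?_
      (norm_nonneg _) (hb.nonneg k)
    refine (norm_integral_le_of_norm_le (hi.abs.mul_const (M + M))
      (ae_of_all _ fun u => ?_)).trans_eq (integral_mul_const _ _)
    rw [norm_smul, Real.norm_eq_abs]
    exact mul_le_mul_of_nonneg_left (hbd _) (abs_nonneg _)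

end Expansion

end SubPhi

/-! ### Exponential moments on the closed linear span of the process. -/

namespace SubPhi

section Hilbert

variable {Ω : Type*} [MeasurableSpace Ω] {P : Measure Ω} {φ : ℝ → ℝ} {X : ℝ → Ω → ℝ} {C : ℝ}

theorem IsSub.memLp_two {ξ : Ω → ℝ} (hφ : IsNFunction φ) (h : IsSub P φ ξ) : MemLp ξ 2 P :=
  (h.mgfBound_tau hφ).memLp_two hφ h.1.aemeasurable (tau_nonneg _)

theorem IsSub.rms_le {ξ : Ω → ℝ} (hφ : IsNFunction φ) (h : IsSub P φ ξ) :
    rms P ξ ≤ tau P φ ξ * Real.sqrt (momentConst φ 2 1) :=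
  (h.mgfBound_tau hφ).rms_le hφ h.1.aemeasurable (tau_nonneg _)

theorem rms_congr_ae {ξ η : Ω → ℝ} (h : ξ =ᵐ[P] η) : rms P ξ = rms P η := by
  rw [rms, rms]
  congr 1
  refine integral_congr_ae ?_
  filter_upwards [h] with ω hω
  rw [hω]

theorem rms_coe (y : Lp ℝ 2 P) : rms P y = ‖y‖ := by
  rw [rms, ← Real.sqrt_sq (norm_nonneg y), ← real_inner_self_eq_norm_sq, L2.inner_def]
  congr 1
  refine integral_congr_ae (ae_of_all _ fun ω => ?_)
  simp [sq]

theorem coe_toL2 {ξ : Ω → ℝ} (h : MemLp ξ 2 P) : toL2 P ξ =ᵐ[P] ξ := by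
  rw [toL2, dif_pos h]
  exact h.coeFn_toLp

/-- The closed linear span in `L_2(Ω)` of a process. -/
noncomputable def closedSpan (P : Measure Ω) (X : ℝ → Ω → ℝ) : Submodule ℝ (Lp ℝ 2 P) :=
  (Submodule.span ℝ (range fun t => toL2 P (X t))).topologicalClosure

theorem toL2_mem_closedSpan (t : ℝ) : toL2 P (X t) ∈ closedSpan P X :=
  Submodule.le_topologicalClosure _ (Submodule.subset_span ⟨t, rfl⟩)

instance completeSpace_closedSpan : CompleteSpace (closedSpan P X) :=
  (Submodule.isClosed_topologicalClosure _).completeSpace_coe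

/-- The orthogonal projection onto the span commutes with the Bochner integral and fixes the
integrand. -/
theorem integral_mem_closedSpan {g : ℝ → ℝ}
    (hg : Integrable fun t => g t • toL2 P (X t)) :
    ∫ t, g t • toL2 P (X t) ∈ closedSpan P X := by
  rw [← Submodule.starProjection_eq_self_iff, ← ContinuousLinearMap.integral_comp_comm _ hg]
  refine integral_congr_ae (ae_of_all _ fun t => ?_)
  exact Submodule.starProjection_eq_self_iff.2
    (Submodule.smul_mem _ _ (toL2_mem_closedSpan t))

theorem norm_toL2 {ξ : Ω → ℝ} (h : MemLp ξ 2 P) : ‖toL2 P ξ‖ = rms P ξ := by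
  rw [← rms_coe, rms_congr_ae (coe_toL2 h)]

theorem norm_toL2_le (hφ : IsNFunction φ) (hX : IsStrictlySubProcess P φ X C) :
    ∃ M, ∀ t, ‖toL2 P (X t)‖ ≤ M := by
  obtain ⟨B, hB⟩ := hX.1.2
  refine ⟨B * Real.sqrt (momentConst φ 2 1), fun t => ?_⟩
  rw [norm_toL2 ((hX.1.1 t).memLp_two hφ)]
  refine ((hX.1.1 t).rms_le hφ).trans ?_
  gcongr
  exact hB ⟨t, rfl⟩

theorem continuous_toL2 (hφ : IsNFunction φ) (hX : IsStrictlySubProcess P φ X C)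
    (hc : TauContinuous P φ X) : Continuous fun t => toL2 P (X t) := by
  rw [continuous_iff_continuousAt]
  intro t
  rw [ContinuousAt, tendsto_iff_norm_sub_tendsto_zero]
  have h1 := (hc t).mul_const (Real.sqrt (momentConst φ 2 1))
  rw [zero_mul] at h1
  refine squeeze_zero (fun _ => norm_nonneg _) (fun s => ?_) h1
  have hsub : IsSub P φ fun ω => X s ω - X t ω := by
    have := (hX.1.1 s).add hφ ((hX.1.1 t).const_mul hφ (-1))
    simpa [sub_eq_add_neg] using this
  refine le_of_eq_of_le ?_ (hsub.rms_le hφ)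
  rw [← rms_coe]
  refine rms_congr_ae ?_
  filter_upwards [Lp.coeFn_sub (toL2 P (X s)) (toL2 P (X t)),
    coe_toL2 ((hX.1.1 s).memLp_two hφ), coe_toL2 ((hX.1.1 t).memLp_two hφ)] with ω h1 h2 h3
  rw [h1, Pi.sub_apply, h2, h3]

variable [IsProbabilityMeasure P]

theorem mgfBound_of_mem_span (hφ : IsNFunction φ) (hX : IsStrictlySubProcess P φ X C)
    {y : Lp ℝ 2 P} (hy : y ∈ Submodule.span ℝ (range fun t => toL2 P (X t))) :
    MgfBound P φ y (C * ‖y‖) := by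
  obtain ⟨n, c, g, hsum⟩ := Submodule.mem_span_set'.1 hy
  choose t ht using fun i => (g i).2
  have hae : (fun ω => ∑ i, c i * X (t i) ω) =ᵐ[P] y := by
    rw [← hsum]
    have h1 : ∀ i ∈ Finset.univ, (c i • (g i : Lp ℝ 2 P) : Lp ℝ 2 P) =ᵐ[P]
        fun ω => c i * X (t i) ω := fun i _ => by
      filter_upwards [Lp.coeFn_smul (c i) (g i : Lp ℝ 2 P),
        coe_toL2 ((hX.1.1 (t i)).memLp_two hφ)] with ω h1 h2
      rw [h1, Pi.smul_apply, smul_eq_mul, ← h2, ← ht i]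
    filter_upwards [Lp.coeFn_finsetSum Finset.univ fun i => c i • (g i : Lp ℝ 2 P),
      (ae_all_iff.2 fun i => h1 i (Finset.mem_univ i))] with ω h2 h3
    rw [h2, Finset.sum_apply]
    exact Finset.sum_congr rfl fun i _ => (h3 i).symm
  have hsub : IsSub P φ fun ω => ∑ i, c i * X (t i) ω :=
    IsSub.sum hφ _ _ fun i _ => (hX.1.1 (t i)).const_mul hφ (c i)
  have htau := hX.2.2.2 n (fun i => X (t i)) c fun i => ⟨t i, rfl⟩
  rw [rms_congr_ae hae, rms_coe] at htau
  exact ((hsub.mgfBound_tau hφ).mono hφ (tau_nonneg _) htau).congr_ae hae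

/-- An approximating sequence from the algebraic span has an almost surely convergent subsequence,
and its norms converge too; Fatou then passes the bound to the limit. -/
theorem mgfBound_of_mem (hφ : IsNFunction φ) (hX : IsStrictlySubProcess P φ X C)
    {y : Lp ℝ 2 P} (hy : y ∈ closedSpan P X) : MgfBound P φ y (C * ‖y‖) := by
  obtain ⟨ys, hys, hlim⟩ := mem_closure_iff_seq_limit.1 (show y ∈ closure _ from hy)
  obtain ⟨ns, hns, hae⟩ := (tendstoInMeasure_of_tendsto_Lp hlim).exists_seq_tendsto_ae
  exact MgfBound.of_tendsto hφ (fun n => (Lp.aestronglyMeasurable (ys (ns n))).aemeasurable)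
    (fun n => mgfBound_of_mem_span hφ hX (hys (ns n))) hae
    ((hlim.comp hns.tendsto_atTop).norm.const_mul C)

theorem tau_le_of_ae_eq (hφ : IsNFunction φ) (hX : IsStrictlySubProcess P φ X C)
    {y : Lp ℝ 2 P} (hy : y ∈ closedSpan P X) {ξ : Ω → ℝ} (h : ξ =ᵐ[P] y) :
    tau P φ ξ ≤ C * rms P ξ := by
  have hC := hX.2.2.1
  rw [rms_congr_ae h, rms_coe]
  exact tau_le (by positivity) ((mgfBound_of_mem hφ hX hy).congr_ae h.symm)

theorem mgfBound_of_ae_eq (hφ : IsNFunction φ) (hX : IsStrictlySubProcess P φ X C)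
    {y : Lp ℝ 2 P} (hy : y ∈ closedSpan P X) {ξ : Ω → ℝ} (h : ξ =ᵐ[P] y) :
    MgfBound P φ ξ (C * rms P ξ) := by
  rw [rms_congr_ae h, rms_coe]
  exact (mgfBound_of_mem hφ hX hy).congr_ae h.symm

end Hilbert

end SubPhi

/-! ### Convergence of the wavelet series to the process in L_2(Ω). -/

namespace SubPhi

section Series

theorem norm_sum_sub_tsum_le {ι E : Type*} [NormedAddCommGroup E] [CompleteSpace E] {f : ι → E}
    (hf : Summable fun i => ‖f i‖) (s : Finset ι) :
    ‖∑ i ∈ s, f i - ∑' i, f i‖ ≤ ∑' i, ‖f i‖ - ∑ i ∈ s, ‖f i‖ := by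
  rw [← hf.of_norm.sum_add_tsum_compl (s := s), ← hf.sum_add_tsum_compl (s := s), sub_add_cancel_left,
    norm_neg, add_sub_cancel_left]
  exact norm_tsum_le_tsum_norm (hf.subtype _)

/-- The terms with |k| = K occur both in the partial sum and in the tail, hence only an inequality.
-/
theorem tsum_sub_sum_Icc_le {f : ℤ → ℝ} (hf : Summable f) (hf0 : ∀ k, 0 ≤ f k) (K : ℕ) :
    ∑' k, f k - ∑ k ∈ Finset.Icc (-(K : ℤ)) K, f k ≤ ∑' k : {k : ℤ // (K : ℤ) ≤ |k|}, f k := by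
  have h := hf.tsum_subtype_add_tsum_subtype_compl {k : ℤ | (K : ℤ) ≤ |k|}
  rw [sub_le_iff_le_add, ← h]
  refine add_le_add le_rfl ?_
  have hsub : {k : ℤ | (K : ℤ) ≤ |k|}ᶜ ⊆ (Finset.Icc (-(K : ℤ)) K : Finset ℤ) := fun k hk => by
    simp only [mem_compl_iff, mem_ofPred_eq, not_le] at hk
    simpa [← abs_le] using hk.le
  rw [← Finset.tsum_subtype']
  exact Summable.tsum_le_tsum_of_inj (Set.inclusion hsub) (Set.inclusion_injective hsub)
    (fun c _ => hf0 c) (fun i => le_rfl) (hf.subtype _) (hf.subtype _)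

theorem tsum_subtype_le_tsum {f : ℤ → ℝ} (hf : Summable f) (hf0 : ∀ k, 0 ≤ f k) (s : Set ℤ) :
    ∑' k : s, f k ≤ ∑' k, f k := by
  rw [← hf.tsum_subtype_add_tsum_subtype_compl s]
  exact le_add_of_nonneg_right (tsum_nonneg fun k => hf0 k)

theorem continuous_dilate {g : ℝ → ℝ} (hg : Continuous g) (j : ℕ) (k : ℤ) :
    Continuous (dilate g j k) := by
  unfold dilate
  fun_prop

/-- The pairs `(j, k)` with `j < n` and `|k| ≤ K j`. -/
noncomputable def levelIndices (n : ℕ) (K : ℕ → ℕ) : Finset (ℕ × ℤ) :=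
  ((Finset.range n).sigma fun j => Finset.Icc (-(K j : ℤ)) (K j : ℤ)).map
    (Equiv.sigmaEquivProd ℕ ℤ).toEmbedding

theorem mem_levelIndices {n : ℕ} {K : ℕ → ℕ} {z : ℕ × ℤ} :
    z ∈ levelIndices n K ↔ z.1 < n ∧ |z.2| ≤ K z.1 := by
  rw [levelIndices, Finset.mem_map_equiv]
  simp [abs_le]

theorem sum_levelIndices {E : Type*} [AddCommMonoid E] (n : ℕ) (K : ℕ → ℕ) (f : ℕ × ℤ → E) :
    ∑ z ∈ levelIndices n K, f z =
      ∑ j ∈ Finset.range n, ∑ k ∈ Finset.Icc (-(K j : ℤ)) (K j : ℤ), f (j, k) := by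
  rw [levelIndices, Finset.sum_map, Finset.sum_sigma]
  rfl

theorem tendsto_Icc_neg_atTop {K : ℕ → ℕ} (hK : Tendsto K atTop atTop) :
    Tendsto (fun n => Finset.Icc (-(K n : ℤ)) (K n : ℤ)) atTop atTop := by
  refine tendsto_atTop.2 fun s => ?_
  have : ∀ k ∈ s, ∀ᶠ n in atTop, k ∈ Finset.Icc (-(K n : ℤ)) (K n : ℤ) := fun k _ => by
    filter_upwards [hK.eventually_ge_atTop k.natAbs] with n hn
    rw [Finset.mem_Icc, ← abs_le, Int.abs_eq_natAbs]
    omega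
  filter_upwards [(Finset.eventually_all s).2 this] with n hn k hk using hn k hk

/-- A finite index set involves finitely many levels, so growth of each k_j separately, without
uniformity in j, suffices. -/
theorem tendsto_levelIndices_atTop {K : ℕ → ℕ → ℕ} (hK : ∀ j, Tendsto (fun n => K n j) atTop atTop) :
    Tendsto (fun n => levelIndices n (K n)) atTop atTop := by
  refine tendsto_atTop.2 fun s => ?_
  have : ∀ z ∈ s, ∀ᶠ n in atTop, z ∈ levelIndices n (K n) := fun z _ => by
    filter_upwards [(hK z.1).eventually_ge_atTop z.2.natAbs, eventually_gt_atTop z.1] with n h1 h2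
    rw [mem_levelIndices, Int.abs_eq_natAbs]
    omega
  filter_upwards [(Finset.eventually_all s).2 this] with n hn z hz using hn z hz

variable {Ω : Type*} [MeasurableSpace Ω] {P : Measure Ω} {φ : ℝ → ℝ} {X : ℝ → Ω → ℝ} {C : ℝ}
  {w ψ : ℝ → ℝ} {m₀ : ℝ → ℂ} {b b' : ℤ → ℝ}

theorem norm_levelTerm (g : ℝ → ℝ) (j : ℕ) (k : ℤ) (t : ℝ) :
    ‖levelTerm g (fun s => toL2 P (X s)) j k t‖ = termM P X g j k t := by
  rw [levelTerm, norm_smul, termM, eta, msIntegral, rms_coe, Real.norm_eq_abs, mul_comm]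

theorem termM_nonneg (g : ℝ → ℝ) (j : ℕ) (k : ℤ) (t : ℝ) : 0 ≤ termM P X g j k t := by
  rw [← norm_levelTerm]; exact norm_nonneg _

theorem termF_nonneg (g : ℝ → ℝ) (k : ℤ) (t : ℝ) : 0 ≤ termF P X g k t :=
  termM_nonneg g 0 k t

theorem continuous_termM {g : ℝ → ℝ} (hg : Continuous g) (j : ℕ) (k : ℤ) :
    Continuous (termM P X g j k) :=
  continuous_const.mul (continuous_dilate hg j k).abs

/-- The approximant `approx` as an element of `L_2(Ω)`. -/
noncomputable def approxL2 (P : Measure Ω) (X : ℝ → Ω → ℝ) (w ψ : ℝ → ℝ) (n K₀ : ℕ) (K : ℕ → ℕ)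
    (t : ℝ) : Lp ℝ 2 P :=
  (∑ k ∈ Finset.Icc (-(K₀ : ℤ)) (K₀ : ℤ), levelTerm w (fun s => toL2 P (X s)) 0 k t) +
    ∑ z ∈ levelIndices n K, levelTerm ψ (fun s => toL2 P (X s)) z.1 z.2 t

theorem approx_ae_eq (w ψ : ℝ → ℝ) (n K₀ : ℕ) (K : ℕ → ℕ) (t : ℝ) :
    approx P X w ψ n K₀ K t =ᵐ[P] approxL2 P X w ψ n K₀ K t := by
  have h (g : ℝ → ℝ) : ∀ᵐ ω ∂P, ∀ z : ℕ × ℤ, levelTerm g (fun s => toL2 P (X s)) z.1 z.2 t ω =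
      eta P X g z.1 z.2 ω * dilate g z.1 z.2 t := ae_all_iff.2 fun z => by
    filter_upwards [Lp.coeFn_smul (dilate g z.1 z.2 t)
      (∫ s, dilate g z.1 z.2 s • toL2 P (X s))] with ω hω
    rw [levelTerm, hω, Pi.smul_apply, smul_eq_mul, mul_comm]
    rfl
  filter_upwards [h w, h ψ,
    Lp.coeFn_add (∑ k ∈ Finset.Icc (-(K₀ : ℤ)) (K₀ : ℤ), levelTerm w (fun s => toL2 P (X s)) 0 k t)
      (∑ z ∈ levelIndices n K, levelTerm ψ (fun s => toL2 P (X s)) z.1 z.2 t),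
    Lp.coeFn_fun_finsetSum (Finset.Icc (-(K₀ : ℤ)) (K₀ : ℤ)) fun k =>
      levelTerm w (fun s => toL2 P (X s)) 0 k t,
    Lp.coeFn_fun_finsetSum (levelIndices n K) fun z =>
      levelTerm ψ (fun s => toL2 P (X s)) z.1 z.2 t] with ω h1 h2 h3 h4 h5
  rw [approxL2, h3, Pi.add_apply, h4, h5, sum_levelIndices, approx]
  simp only [h2 (_, _), h1 (0, _)]
  rfl

theorem levelTerm_mem_closedSpan {g : ℝ → ℝ} (hb : IsAmalgam g b) (hφ : IsNFunction φ)
    (hX : IsStrictlySubProcess P φ X C) (hXc : TauContinuous P φ X) (j : ℕ) (k : ℤ) (t : ℝ) :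
    levelTerm g (fun s => toL2 P (X s)) j k t ∈ closedSpan P X := by
  obtain ⟨M, hM⟩ := norm_toL2_le hφ hX
  refine Submodule.smul_mem _ _ (integral_mem_closedSpan ?_)
  have h1 : Integrable (dilate g j k) :=
    ((hb.integrable_comp_sub k).comp_mul_left' (by positivity : (2 : ℝ) ^ j ≠ 0)).const_mul _
  exact h1.smul_bdd M (continuous_toL2 hφ hX hXc).aestronglyMeasurable (ae_of_all _ hM)

theorem approxL2_mem_closedSpan (hb : IsAmalgam w b) (hb' : IsAmalgam ψ b') (hφ : IsNFunction φ)
    (hX : IsStrictlySubProcess P φ X C) (hXc : TauContinuous P φ X) (n K₀ : ℕ) (K : ℕ → ℕ)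
    (t : ℝ) : approxL2 P X w ψ n K₀ K t ∈ closedSpan P X :=
  Submodule.add_mem _
    (Submodule.sum_mem _ fun _ _ => levelTerm_mem_closedSpan hb hφ hX hXc _ _ _)
    (Submodule.sum_mem _ fun _ _ => levelTerm_mem_closedSpan hb' hφ hX hXc _ _ _)

/-- The wavelet expansion of the process in `L_2(Ω)`. -/
theorem toL2_eq_tsum (hw : IsFWavelet w m₀) (hψ : IsMWavelet w m₀ ψ) (hb : IsAmalgam w b)
    (hb' : IsAmalgam ψ b') (hφ : IsNFunction φ) (hX : IsStrictlySubProcess P φ X C)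
    (hXc : TauContinuous P φ X) {t : ℝ}
    (hM : Summable fun z : ℕ × ℤ => termM P X ψ z.1 z.2 t) :
    toL2 P (X t) = ∑' k, levelTerm w (fun s => toL2 P (X s)) 0 k t +
      ∑' z : ℕ × ℤ, levelTerm ψ (fun s => toL2 P (X s)) z.1 z.2 t := by
  obtain ⟨M, hZM⟩ := norm_toL2_le hφ hX
  have hZ := continuous_toL2 hφ hX hXc
  have hs : Summable fun z : ℕ × ℤ => levelTerm ψ (fun s => toL2 P (X s)) z.1 z.2 t := by
    refine Summable.of_norm ?_
    simpa only [norm_levelTerm] using hM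
  have h1 := (hs.hasSum.prod_fiberwise fun j => (hs.prod_factor j).hasSum).tendsto_sum_nat
  have h2 := h1.const_add (∑' k, levelTerm w (fun s => toL2 P (X s)) 0 k t)
  -- By telescoping, partial sums over levels are projections, which tend to X(t); absolute
  -- summability makes them tend to the full double series as well.
  refine tendsto_nhds_unique (tendsto_tsum_levelTerm hw hb hZ hZM t) (h2.congr fun n => ?_)
  exact (tsum_levelTerm_eq_sum hw hψ hb hb' hZ hZM n t).symm

/-- The error is the sum of the omitted terms, whose L_2 norms are exactly `termF` and `termM`. -/
theorem rms_approx_sub_le (hw : IsFWavelet w m₀) (hψ : IsMWavelet w m₀ ψ) (hb : IsAmalgam w b)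
    (hb' : IsAmalgam ψ b') (hφ : IsNFunction φ) (hX : IsStrictlySubProcess P φ X C)
    (hXc : TauContinuous P φ X) {t : ℝ} (hF : Summable fun k => termF P X w k t)
    (hM : Summable fun z : ℕ × ℤ => termM P X ψ z.1 z.2 t) (n K₀ : ℕ) (K : ℕ → ℕ) :
    rms P (fun ω => approx P X w ψ n K₀ K t ω - X t ω) ≤
      (∑' k, termF P X w k t - ∑ k ∈ Finset.Icc (-(K₀ : ℤ)) K₀, termF P X w k t) +
      (∑' z : ℕ × ℤ, termM P X ψ z.1 z.2 t - ∑ z ∈ levelIndices n K, termM P X ψ z.1 z.2 t) := by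
  have e : (fun ω => approx P X w ψ n K₀ K t ω - X t ω) =ᵐ[P]
      (approxL2 P X w ψ n K₀ K t - toL2 P (X t) : Lp ℝ 2 P) := by
    filter_upwards [Lp.coeFn_sub (approxL2 P X w ψ n K₀ K t) (toL2 P (X t)),
      approx_ae_eq w ψ n K₀ K t, coe_toL2 ((hX.1.1 t).memLp_two hφ)] with ω h1 h2 h3
    rw [h1, Pi.sub_apply, h2, h3]
  rw [rms_congr_ae e, rms_coe, toL2_eq_tsum hw hψ hb hb' hφ hX hXc hM, approxL2, add_sub_add_comm]
  refine (norm_add_le _ _).trans (add_le_add ?_ ?_)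
  · refine (norm_sum_sub_tsum_le ?_ _).trans_eq ?_ <;> simp only [norm_levelTerm]
    · exact hF
    · rfl
  · refine (norm_sum_sub_tsum_le ?_ _).trans_eq ?_ <;> simp only [norm_levelTerm]
    exact hM

end Series

end SubPhi

/-! ### Uniform control of tails, and exponential moments of the error. -/

namespace SubPhi

section Uniform

variable {ι : Type*} {f : ι → ℝ → ℝ} {s : Set ℝ}

theorem eventually_tsum_sub_sum_le (hf : SummableUniformlyOn f s) {S : ℕ → Finset ι}
    (hS : Tendsto S atTop atTop) {δ : ℝ} (hδ : 0 < δ) :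
    ∀ᶠ n in atTop, ∀ t ∈ s, ∑' i, f i t - ∑ i ∈ S n, f i t ≤ δ := by
  have h := Metric.tendstoUniformlyOn_iff.1 hf.hasSumUniformlyOn.tendstoUniformlyOn δ hδ
  filter_upwards [hS.eventually h] with n hn t ht
  exact (le_abs_self _).trans (hn t ht).le

theorem continuousOn_tsum_of_summableUniformlyOn (hf : SummableUniformlyOn f s)
    (hc : ∀ i, Continuous (f i)) : ContinuousOn (fun t => ∑' i, f i t) s :=
  hf.hasSumUniformlyOn.tendstoUniformlyOn.continuousOn
    (Frequently.of_forall fun S => (continuous_finsetSum S fun i _ => hc i).continuousOn)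

end Uniform

section Tail

variable {Ω : Type*} [MeasurableSpace Ω] {P : Measure Ω} {φ : ℝ → ℝ} {X : ℝ → Ω → ℝ} {C T t : ℝ}
  {w ψ : ℝ → ℝ} {m₀ : ℝ → ℂ} {b b' : ℤ → ℝ}

theorem tsum_termM_eq (hM : Summable fun z : ℕ × ℤ => termM P X ψ z.1 z.2 t) (n : ℕ) :
    ∑' z : ℕ × ℤ, termM P X ψ z.1 z.2 t = ∑ j ∈ Finset.range n, ∑' k, termM P X ψ j k t +
      ∑' j, ∑' k, termM P X ψ (n + j) k t := by
  rw [hM.tsum_prod, ← hM.prod.sum_add_tsum_nat_add n]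
  simp only [add_comm]

theorem tsum_sub_sum_le_tail (hF : Summable fun k => termF P X w k t)
    (hM : Summable fun z : ℕ × ℤ => termM P X ψ z.1 z.2 t) (n K₀ : ℕ) (K : ℕ → ℕ) :
    (∑' k, termF P X w k t - ∑ k ∈ Finset.Icc (-(K₀ : ℤ)) K₀, termF P X w k t) +
      (∑' z : ℕ × ℤ, termM P X ψ z.1 z.2 t - ∑ z ∈ levelIndices n K, termM P X ψ z.1 z.2 t) ≤
    tail P X w ψ n K₀ K t := by
  rw [tail, add_assoc]
  refine add_le_add (tsum_sub_sum_Icc_le hF (fun k => termF_nonneg w k t) K₀) ?_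
  rw [tsum_termM_eq hM n, sum_levelIndices, add_sub_right_comm, ← Finset.sum_sub_distrib]
  refine add_le_add (Finset.sum_le_sum fun j _ => ?_) le_rfl
  exact tsum_sub_sum_Icc_le (hM.prod_factor j) (fun k => termM_nonneg ψ j k t) (K j)

theorem tail_le_tsum (hF : Summable fun k => termF P X w k t)
    (hM : Summable fun z : ℕ × ℤ => termM P X ψ z.1 z.2 t) (n K₀ : ℕ) (K : ℕ → ℕ) :
    tail P X w ψ n K₀ K t ≤ ∑' k, termF P X w k t + ∑' z : ℕ × ℤ, termM P X ψ z.1 z.2 t := by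
  rw [tail, add_assoc, tsum_termM_eq hM n]
  refine add_le_add (tsum_subtype_le_tsum hF (fun k => termF_nonneg w k t) _) ?_
  refine add_le_add (Finset.sum_le_sum fun j _ => ?_) le_rfl
  exact tsum_subtype_le_tsum (hM.prod_factor j) (fun k => termM_nonneg ψ j k t) _

/-- A real supremum of an unbounded family is 0 by default, so boundedness must be proved: the full
sum is continuous on a compact interval and dominates every tail. -/
theorem bddAbove_range_tail (hwc : Continuous w) (hψc : Continuous ψ)
    (hF : SummableUniformlyOn (fun (k : ℤ) t => termF P X w k t) (Icc 0 T))
    (hM : SummableUniformlyOn (fun (z : ℕ × ℤ) t => termM P X ψ z.1 z.2 t) (Icc 0 T))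
    (n K₀ : ℕ) (K : ℕ → ℕ) :
    BddAbove (range fun t : Icc (0 : ℝ) T => tail P X w ψ n K₀ K t) := by
  have hc := (continuousOn_tsum_of_summableUniformlyOn hF fun k => continuous_termM hwc 0 k).add
    (continuousOn_tsum_of_summableUniformlyOn hM fun z => continuous_termM hψc z.1 z.2)
  obtain ⟨B, hB⟩ := isCompact_Icc.bddAbove_image hc
  refine ⟨B, ?_⟩
  rintro _ ⟨⟨t, ht⟩, rfl⟩
  exact (tail_le_tsum (hF.summable ht) (hM.summable ht) n K₀ K).trans (hB ⟨t, ht, rfl⟩)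

end Tail

section Approx

variable {Ω : Type*} [MeasurableSpace Ω] {P : Measure Ω} {φ : ℝ → ℝ} {X : ℝ → Ω → ℝ} {C T : ℝ}
  {w ψ : ℝ → ℝ} {m₀ : ℝ → ℂ} {b b' : ℤ → ℝ}

theorem measurable_approx (hwc : Continuous w) (hψc : Continuous ψ) (n K₀ : ℕ) (K : ℕ → ℕ) :
    Measurable (Function.uncurry (approx P X w ψ n K₀ K)) := by
  have h (g : ℝ → ℝ) (hg : Continuous g) (j : ℕ) (k : ℤ) :
      Measurable fun z : ℝ × Ω => eta P X g j k z.2 * dilate g j k z.1 :=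
    ((Lp.stronglyMeasurable _).measurable.comp measurable_snd).mul
      ((continuous_dilate hg j k).measurable.comp measurable_fst)
  refine Measurable.add (Finset.measurable_fun_sum _ fun k _ => h w hwc 0 k) ?_
  exact Finset.measurable_fun_sum _ fun j _ => Finset.measurable_fun_sum _ fun k _ => h ψ hψc j k

theorem measurable_rms [SFinite P] {Y : ℝ → Ω → ℝ} (hY : Measurable (Function.uncurry Y)) :
    Measurable fun t => rms P (Y t) :=
  Real.continuous_sqrt.measurable.comp
    ((hY.pow_const 2).stronglyMeasurable.integral_prod_right').measurable

theorem memLp_approx (w ψ : ℝ → ℝ) (n K₀ : ℕ) (K : ℕ → ℕ) (t : ℝ) :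
    MemLp (approx P X w ψ n K₀ K t) 2 P :=
  (Lp.memLp _).ae_eq (approx_ae_eq w ψ n K₀ K t).symm

theorem rms_rpow (Y : Ω → ℝ) (p : ℝ) : rms P Y ^ p = (∫ ω, Y ω ^ 2 ∂P) ^ (p / 2) := by
  rw [rms, Real.sqrt_eq_rpow, ← Real.rpow_mul (integral_nonneg fun _ => sq_nonneg _)]
  congr 1
  ring

theorem rms_sub_le {Y Z : Ω → ℝ} (hY : MemLp Y 2 P) (hZ : MemLp Z 2 P) :
    rms P (fun ω => Y ω - Z ω) ≤ rms P Y + rms P Z := by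
  have e : (fun ω => Y ω - Z ω) =ᵐ[P] (hY.toLp Y - hZ.toLp Z : Lp ℝ 2 P) := by
    filter_upwards [Lp.coeFn_sub (hY.toLp Y) (hZ.toLp Z), hY.coeFn_toLp, hZ.coeFn_toLp]
      with ω h1 h2 h3
    rw [h1, Pi.sub_apply, h2, h3]
  rw [rms_congr_ae e, rms_congr_ae hY.coeFn_toLp.symm, rms_congr_ae hZ.coeFn_toLp.symm, rms_coe,
    rms_coe, rms_coe]
  exact norm_sub_le _ _

theorem eventually_rms_approx_sub_le (hw : IsFWavelet w m₀) (hψ : IsMWavelet w m₀ ψ)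
    (hb : IsAmalgam w b) (hb' : IsAmalgam ψ b') (hφ : IsNFunction φ)
    (hX : IsStrictlySubProcess P φ X C) (hXc : TauContinuous P φ X)
    (hF : SummableUniformlyOn (fun (k : ℤ) t => termF P X w k t) (Icc 0 T))
    (hM : SummableUniformlyOn (fun (z : ℕ × ℤ) t => termM P X ψ z.1 z.2 t) (Icc 0 T))
    {K₀ : ℕ → ℕ} {K : ℕ → ℕ → ℕ} (hK₀ : Tendsto K₀ atTop atTop)
    (hK : ∀ j, Tendsto (fun n => K n j) atTop atTop) {δ : ℝ} (hδ : 0 < δ) :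
    ∀ᶠ n in atTop, ∀ t ∈ Icc 0 T,
      rms P (fun ω => approx P X w ψ n (K₀ n) (K n) t ω - X t ω) ≤ δ := by
  filter_upwards [eventually_tsum_sub_sum_le hF (tendsto_Icc_neg_atTop hK₀) (half_pos hδ),
    eventually_tsum_sub_sum_le hM (tendsto_levelIndices_atTop hK) (half_pos hδ)] with n h1 h2 t ht
  refine (rms_approx_sub_le hw hψ hb hb' hφ hX hXc (hF.summable ht) (hM.summable ht) _ _ _).trans ?_
  exact (add_le_add (h1 t ht) (h2 t ht)).trans_eq (add_halves δ)

variable [IsProbabilityMeasure P]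

theorem mgfBound_process (hφ : IsNFunction φ) (hX : IsStrictlySubProcess P φ X C) (t : ℝ) :
    MgfBound P φ (X t) (C * rms P (X t)) :=
  mgfBound_of_ae_eq hφ hX (toL2_mem_closedSpan t) (coe_toL2 ((hX.1.1 t).memLp_two hφ)).symm

theorem mgfBound_approx (hb : IsAmalgam w b) (hb' : IsAmalgam ψ b') (hφ : IsNFunction φ)
    (hX : IsStrictlySubProcess P φ X C) (hXc : TauContinuous P φ X) (n K₀ : ℕ) (K : ℕ → ℕ)
    (t : ℝ) : MgfBound P φ (approx P X w ψ n K₀ K t) (C * rms P (approx P X w ψ n K₀ K t)) :=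
  mgfBound_of_ae_eq hφ hX (approxL2_mem_closedSpan hb hb' hφ hX hXc n K₀ K t)
    (approx_ae_eq w ψ n K₀ K t)

theorem mgfBound_approx_sub (hb : IsAmalgam w b) (hb' : IsAmalgam ψ b') (hφ : IsNFunction φ)
    (hX : IsStrictlySubProcess P φ X C) (hXc : TauContinuous P φ X) (n K₀ : ℕ) (K : ℕ → ℕ)
    (t : ℝ) : MgfBound P φ (fun ω => approx P X w ψ n K₀ K t ω - X t ω)
      (C * rms P fun ω => approx P X w ψ n K₀ K t ω - X t ω) := by
  refine mgfBound_of_ae_eq hφ hX (Submodule.sub_mem _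
    (approxL2_mem_closedSpan hb hb' hφ hX hXc n K₀ K t) (toL2_mem_closedSpan t)) ?_
  filter_upwards [Lp.coeFn_sub (approxL2 P X w ψ n K₀ K t) (toL2 P (X t)),
    approx_ae_eq w ψ n K₀ K t, coe_toL2 ((hX.1.1 t).memLp_two hφ)] with ω h1 h2 h3
  rw [h1, Pi.sub_apply, h2, h3]

theorem tau_approx_sub_approx_le (hb : IsAmalgam w b) (hb' : IsAmalgam ψ b') (hφ : IsNFunction φ)
    (hX : IsStrictlySubProcess P φ X C) (hXc : TauContinuous P φ X) (n K₀ n' K₀' : ℕ)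
    (K K' : ℕ → ℕ) (t : ℝ) :
    tau P φ (fun ω => approx P X w ψ n K₀ K t ω - approx P X w ψ n' K₀' K' t ω) ≤
      C * (rms P (fun ω => approx P X w ψ n K₀ K t ω - X t ω) +
        rms P (fun ω => approx P X w ψ n' K₀' K' t ω - X t ω)) := by
  have h : tau P φ (fun ω => approx P X w ψ n K₀ K t ω - approx P X w ψ n' K₀' K' t ω) ≤
      C * rms P (fun ω => approx P X w ψ n K₀ K t ω - approx P X w ψ n' K₀' K' t ω) := by
    refine tau_le_of_ae_eq hφ hX (Submodule.sub_mem _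
      (approxL2_mem_closedSpan hb hb' hφ hX hXc n K₀ K t)
      (approxL2_mem_closedSpan hb hb' hφ hX hXc n' K₀' K' t)) ?_
    filter_upwards [Lp.coeFn_sub (approxL2 P X w ψ n K₀ K t) (approxL2 P X w ψ n' K₀' K' t),
      approx_ae_eq w ψ n K₀ K t, approx_ae_eq w ψ n' K₀' K' t] with ω h1 h2 h3
    rw [h1, Pi.sub_apply, h2, h3]
  refine h.trans (mul_le_mul_of_nonneg_left ?_ hX.2.2.1.le)
  have hXt := (hX.1.1 t).memLp_two hφ
  have := rms_sub_le ((memLp_approx (X := X) w ψ n K₀ K t).sub hXt)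
    ((memLp_approx (X := X) w ψ n' K₀' K' t).sub hXt)
  simp only [Pi.sub_apply, sub_sub_sub_cancel_right] at this
  exact this

end Approx

end SubPhi

/-! ### Path properties, convergence in L_p and the tail inequalities. -/

namespace SubPhi

section Paths

theorem tendsto_zero_of_eventually_le_ofReal {α : Type*} {l : Filter α} {F : α → ENNReal}
    {G : ℝ → ℝ} (hG : Tendsto G (𝓝[>] 0) (𝓝 0))
    (h : ∀ δ, 0 < δ → ∀ᶠ a in l, F a ≤ ENNReal.ofReal (G δ)) : Tendsto F l (𝓝 0) := by
  rw [ENNReal.tendsto_nhds_zero]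
  intro η hη
  have hG' := ENNReal.tendsto_ofReal hG
  rw [ENNReal.ofReal_zero] at hG'
  obtain ⟨δ, h1, h2⟩ :=
    ((ENNReal.tendsto_nhds_zero.1 hG' η hη).and self_mem_nhdsWithin).exists
  exact (h δ h2).mono fun a ha => ha.trans h1

theorem lintegral_rpow_le_of_le {W : ℝ → ℝ} {p T B : ℝ} (hp : 0 ≤ p)
    (hW0 : ∀ t ∈ Icc 0 T, 0 ≤ W t) (hW : ∀ t ∈ Icc 0 T, W t ≤ B) :
    ∫⁻ t in Icc (0 : ℝ) T, ENNReal.ofReal (W t ^ p) ≤ ENNReal.ofReal (B ^ p * T) := by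
  rcases lt_or_ge T 0 with hT | hT
  · simp [hT]
  have hB : 0 ≤ B := (hW0 0 ⟨le_rfl, hT⟩).trans (hW 0 ⟨le_rfl, hT⟩)
  calc ∫⁻ t in Icc (0 : ℝ) T, ENNReal.ofReal (W t ^ p)
      ≤ ∫⁻ _ in Icc (0 : ℝ) T, ENNReal.ofReal (B ^ p) :=
        setLIntegral_mono' measurableSet_Icc fun t ht =>
          ENNReal.ofReal_le_ofReal (Real.rpow_le_rpow (hW0 t ht) (hW t ht) hp)
    _ = ENNReal.ofReal (B ^ p * T) := by
        rw [setLIntegral_const, Real.volume_Icc, sub_zero, ENNReal.ofReal_mul (by positivity)]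

theorem tendsto_const_mul_rpow_mul (C p T : ℝ) (hp : 0 < p) :
    Tendsto (fun δ : ℝ => (C * δ) ^ p * T) (𝓝[>] 0) (𝓝 0) := by
  have h : Tendsto (fun δ : ℝ => (C * δ) ^ p * T) (𝓝 0) (𝓝 ((C * 0) ^ p * T)) :=
    ((tendsto_id.const_mul C).rpow_const (Or.inr hp.le)).mul_const T
  rw [mul_zero, Real.zero_rpow hp.ne', zero_mul] at h
  exact h.mono_left nhdsWithin_le_nhds

variable {Ω : Type*} [MeasurableSpace Ω] {P : Measure Ω} {φ : ℝ → ℝ} {X : ℝ → Ω → ℝ} {C T p : ℝ}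
  {w ψ : ℝ → ℝ} {m₀ : ℝ → ℂ} {b b' : ℤ → ℝ} {Y : ℝ → Ω → ℝ}

theorem exists_rms_approx_le (hwc : Continuous w) (hψc : Continuous ψ) (n K₀ : ℕ) (K : ℕ → ℕ) :
    ∃ B, ∀ t ∈ Icc 0 T, rms P (approx P X w ψ n K₀ K t) ≤ B := by
  have hc (g : ℝ → ℝ) (hg : Continuous g) (j : ℕ) (k : ℤ) :
      Continuous (levelTerm g (fun s => toL2 P (X s)) j k) :=
    (continuous_dilate hg j k).smul continuous_const
  have h : Continuous (approxL2 P X w ψ n K₀ K) :=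
    (continuous_finsetSum _ fun k _ => hc w hwc 0 k).add
      (continuous_finsetSum _ fun z _ => hc ψ hψc z.1 z.2)
  obtain ⟨B, hB⟩ := isCompact_Icc.bddAbove_image (K := Icc 0 T) h.norm.continuousOn
  refine ⟨B, fun t ht => ?_⟩
  rw [rms_congr_ae (approx_ae_eq w ψ n K₀ K t), rms_coe]
  exact hB ⟨t, ht, rfl⟩

variable [IsProbabilityMeasure P]

/-- The moment bound with q = 1 makes the path integral finite in expectation, hence almost surely.
-/
theorem inLp_of_rms_le (hφ : IsNFunction φ) (hp : 1 ≤ p) (hC : 0 ≤ C)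
    (hY : Measurable (Function.uncurry Y)) (h : ∀ t, MgfBound P φ (Y t) (C * rms P (Y t))) {B : ℝ}
    (hB : ∀ t ∈ Icc 0 T, rms P (Y t) ≤ B) : InLp P p T Y := by
  have hp0 : 0 < p := zero_lt_one.trans_le hp
  have hrms : ∀ t, 0 ≤ rms P (Y t) := fun t => Real.sqrt_nonneg _
  have h1 := lintegral_pathInt_rpow_le (T := T) hφ hp hY ((measurable_rms hY).const_mul C)
    (fun t => mul_nonneg hC (hrms t)) (fun t _ => h t) le_rfl one_pos
  have h2 := lintegral_rpow_le_of_le (T := T) (W := fun t => C * rms P (Y t)) hp0.le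
    (fun t _ => mul_nonneg hC (hrms t)) fun t ht => mul_le_mul_of_nonneg_left (hB t ht) hC
  simp only [ENNReal.rpow_one] at h1
  have h3 := h1.trans_lt (ENNReal.mul_lt_top ENNReal.ofReal_lt_top
    (h2.trans_lt ENNReal.ofReal_lt_top))
  filter_upwards [ae_lt_top (measurable_pathInt hY) h3.ne] with ω hω
  exact ENNReal.rpow_lt_top_of_nonneg (by positivity) hω.ne

theorem tendstoLpInProb_approx (hφ : IsNFunction φ) (hp : 1 ≤ p) (hw : IsFWavelet w m₀)
    (hψ : IsMWavelet w m₀ ψ) (hb : IsAmalgam w b) (hb' : IsAmalgam ψ b')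
    (hX : IsStrictlySubProcess P φ X C) (hXm : Measurable (Function.uncurry X))
    (hXc : TauContinuous P φ X)
    (hF : SummableUniformlyOn (fun (k : ℤ) t => termF P X w k t) (Icc 0 T))
    (hM : SummableUniformlyOn (fun (z : ℕ × ℤ) t => termM P X ψ z.1 z.2 t) (Icc 0 T))
    {K₀ : ℕ → ℕ} {K : ℕ → ℕ → ℕ} (hK₀ : Tendsto K₀ atTop atTop)
    (hK : ∀ j, Tendsto (fun n => K n j) atTop atTop) :
    TendstoLpInProb P p T (fun n => approx P X w ψ n (K₀ n) (K n)) X := by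
  have hp0 : 0 < p := zero_lt_one.trans_le hp
  have hC := hX.2.2.1
  have hma := fun n => measurable_approx (P := P) (X := X) hb.continuous hb'.continuous n (K₀ n) (K n)
  refine ⟨fun n => ?_, ?_, fun ε hε => ?_⟩
  · obtain ⟨B, hB⟩ := exists_rms_approx_le (P := P) (X := X) (T := T) hb.continuous hb'.continuous n
      (K₀ n) (K n)
    exact inLp_of_rms_le hφ hp hC.le (hma n) (mgfBound_approx hb hb' hφ hX hXc n (K₀ n) (K n)) hB
  · obtain ⟨B, hB⟩ := norm_toL2_le hφ hX
    refine inLp_of_rms_le (B := B) hφ hp hC.le hXm (mgfBound_process hφ hX) fun t _ => ?_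
    rw [← norm_toL2 ((hX.1.1 t).memLp_two hφ)]
    exact hB t
  -- Bound given by Markov's inequality at q = l = 1 when the mean-square error is at most δ on
  -- [0,T].
  · have hG : Tendsto (fun δ : ℝ => momentConst φ (p * 1) 1 * ((C * δ) ^ p * T / ε ^ p) ^ (1 : ℝ))
        (𝓝[>] 0) (𝓝 0) := by
      simpa using ((tendsto_const_mul_rpow_mul C p T hp0).div_const (ε ^ p)).const_mul
        (momentConst φ (p * 1) 1)
    refine tendsto_zero_of_eventually_le_ofReal hG fun δ hδ => ?_
    filter_upwards [eventually_rms_approx_sub_le hw hψ hb hb' hφ hX hXc hF hM hK₀ hK hδ] with n hn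
    have hYm : Measurable (Function.uncurry fun t ω =>
      approx P X w ψ n (K₀ n) (K n) t ω - X t ω) := (hma n).sub hXm
    have hset : {ω | ENNReal.ofReal ε <
        pathInt p T (fun t ω => approx P X w ψ n (K₀ n) (K n) t ω - X t ω) ω ^ (1 / p)} ⊆
        {ω | ENNReal.ofReal (ε ^ p) <
          pathInt p T (fun t ω => approx P X w ψ n (K₀ n) (K n) t ω - X t ω) ω} := fun ω hω => by
      rw [mem_ofPred_eq, ← ENNReal.ofReal_rpow_of_nonneg hε.le hp0.le]
      rw [mem_ofPred_eq, one_div] at hω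
      exact (ENNReal.lt_rpow_inv_iff hp0).1 hω
    rcases lt_or_ge T 0 with hT | hT
    · refine (measure_mono hset).trans ?_
      simp [pathInt, hT]
    refine (measure_mono hset).trans (measure_pathInt_gt_le hφ hp hYm
      ((measurable_rms hYm).const_mul C)
      (fun t => mul_nonneg hC.le (Real.sqrt_nonneg _))
      (fun t _ => mgfBound_approx_sub hb hb' hφ hX hXc n (K₀ n) (K n) t) le_rfl one_pos
      (by positivity) (by positivity) ?_)
    exact lintegral_rpow_le_of_le hp0.le (fun t _ => mul_nonneg hC.le (Real.sqrt_nonneg _))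
      fun t ht => mul_le_mul_of_nonneg_left (hn t ht) hC.le

theorem tendsto_lintegral_tau_approx_sub (hφ : IsNFunction φ) (hp : 1 ≤ p) (hw : IsFWavelet w m₀)
    (hψ : IsMWavelet w m₀ ψ) (hb : IsAmalgam w b) (hb' : IsAmalgam ψ b')
    (hX : IsStrictlySubProcess P φ X C) (hXc : TauContinuous P φ X)
    (hF : SummableUniformlyOn (fun (k : ℤ) t => termF P X w k t) (Icc 0 T))
    (hM : SummableUniformlyOn (fun (z : ℕ × ℤ) t => termM P X ψ z.1 z.2 t) (Icc 0 T))
    {K₀ : ℕ → ℕ} {K : ℕ → ℕ → ℕ} (hK₀ : Tendsto K₀ atTop atTop)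
    (hK : ∀ j, Tendsto (fun n => K n j) atTop atTop) :
    Tendsto (fun nm : ℕ × ℕ => ∫⁻ t in Icc (0 : ℝ) T, ENNReal.ofReal
      (tau P φ (fun ω => approx P X w ψ nm.1 (K₀ nm.1) (K nm.1) t ω -
        approx P X w ψ nm.2 (K₀ nm.2) (K nm.2) t ω) ^ p)) atTop (𝓝 0) := by
  have hp0 : 0 < p := zero_lt_one.trans_le hp
  refine tendsto_zero_of_eventually_le_ofReal (tendsto_const_mul_rpow_mul (C * 2) p T hp0)
    fun δ hδ => ?_
  have h := eventually_rms_approx_sub_le hw hψ hb hb' hφ hX hXc hF hM hK₀ hK hδ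
  rw [← prod_atTop_atTop_eq]
  filter_upwards [h.prod_mk h] with nm hnm
  refine lintegral_rpow_le_of_le hp0.le (fun t _ => tau_nonneg _) fun t ht => ?_
  refine (tau_approx_sub_approx_le hb hb' hφ hX hXc _ _ _ _ _ _ t).trans ?_
  rw [mul_assoc, two_mul]
  exact mul_le_mul_of_nonneg_left (add_le_add (hnm.1 t ht) (hnm.2 t ht)) hX.2.2.1.le

theorem lintegral_tau_rpow_lt_top (hφ : IsNFunction φ) (hp : 0 ≤ p)
    (hX : IsStrictlySubProcess P φ X C)
    (h : ∫⁻ t in Icc (0 : ℝ) T, ENNReal.ofReal ((∫ ω, X t ω ^ 2 ∂P) ^ (p / 2)) < ⊤) :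
    ∫⁻ t in Icc (0 : ℝ) T, ENNReal.ofReal (tau P φ (X t) ^ p) < ⊤ := by
  have hC := hX.2.2.1
  have hrms : ∀ t, 0 ≤ rms P (X t) := fun t => Real.sqrt_nonneg _
  refine lt_of_le_of_lt (lintegral_mono fun t => ?_) (lt_of_eq_of_lt
    (lintegral_const_mul' (ENNReal.ofReal (C ^ p)) _ ENNReal.ofReal_ne_top)
    (ENNReal.mul_lt_top ENNReal.ofReal_lt_top h))
  rw [← ENNReal.ofReal_mul (by positivity), ← rms_rpow,
    ← Real.mul_rpow hC.le (hrms t)]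
  refine ENNReal.ofReal_le_ofReal (Real.rpow_le_rpow (tau_nonneg _) ?_ hp)
  exact tau_le (mul_nonneg hC.le (hrms t)) (mgfBound_process hφ hX t)

/-- Both inequalities use the same W(t) = C · rms of the error; they differ only in how ∫ W^p is
bounded, exactly or by the supremum of the tails. -/
theorem tailBound_approx_rms {f : ℝ → ℝ} (hφ : IsNFunction φ) (hf : IsDensity φ f) (hT : 0 ≤ T)
    (hp : 1 ≤ p) (hw : IsFWavelet w m₀)
    (hψ : IsMWavelet w m₀ ψ) (hb : IsAmalgam w b) (hb' : IsAmalgam ψ b')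
    (hX : IsStrictlySubProcess P φ X C) (hXm : Measurable (Function.uncurry X))
    (hXc : TauContinuous P φ X)
    (hF : SummableUniformlyOn (fun (k : ℤ) t => termF P X w k t) (Icc 0 T))
    (hM : SummableUniformlyOn (fun (z : ℕ × ℤ) t => termM P X ψ z.1 z.2 t) (Icc 0 T))
    (n K₀ : ℕ) (K : ℕ → ℕ) :
    TailBound P φ f p T (fun t ω => approx P X w ψ n K₀ K t ω - X t ω)
      (C ^ p * ∫ t in (0 : ℝ)..T, (∫ ω, (approx P X w ψ n K₀ K t ω - X t ω) ^ 2 ∂P) ^ (p / 2)) ∧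
    TailBound P φ f p T (fun t ω => approx P X w ψ n K₀ K t ω - X t ω)
      (tailConst P X w ψ C p T n K₀ K) := by
  have hp0 : 0 < p := zero_lt_one.trans_le hp
  have hC := hX.2.2.1
  have hYm : Measurable (Function.uncurry fun t ω => approx P X w ψ n K₀ K t ω - X t ω) :=
    (measurable_approx hb.continuous hb'.continuous n K₀ K).sub hXm
  have hbdd := bddAbove_range_tail hb.continuous hb'.continuous hF hM n K₀ K
  set R : ℝ → ℝ := fun t => rms P fun ω => approx P X w ψ n K₀ K t ω - X t ω with hR
  set B := ⨆ t : Icc (0 : ℝ) T, tail P X w ψ n K₀ K t with hB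
  have hRm : Measurable R := measurable_rms hYm
  have hR0 : ∀ t, 0 ≤ R t := fun t => Real.sqrt_nonneg _
  have hRB : ∀ t ∈ Icc 0 T, R t ≤ B := fun t ht =>
    ((rms_approx_sub_le hw hψ hb hb' hφ hX hXc (hF.summable ht) (hM.summable ht) n K₀ K).trans
      (tsum_sub_sum_le_tail (hF.summable ht) (hM.summable ht) n K₀ K)).trans
      (le_ciSup hbdd ⟨t, ht⟩)
  have hB0 : 0 ≤ B := (hR0 0).trans (hRB 0 ⟨le_rfl, hT⟩)
  have hmgf : ∀ t ∈ Icc 0 T, MgfBound P φ (fun ω => approx P X w ψ n K₀ K t ω - X t ω) (C * R t) :=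
    fun t _ => mgfBound_approx_sub hb hb' hφ hX hXc n K₀ K t
  refine ⟨tailBound_of_mgfBound hφ hf hp hYm (hRm.const_mul C) (fun t => mul_nonneg hC.le (hR0 t))
    hmgf ?_, tailBound_of_mgfBound hφ hf hp hYm (hRm.const_mul C)
    (fun t => mul_nonneg hC.le (hR0 t)) hmgf ?_⟩
  -- Boundedness by the supremum of the tails ensures that the real integral in the constant is not
  -- the default value 0.
  · have hint : IntegrableOn (fun t => R t ^ p) (Icc 0 T) := by
      refine Measure.integrableOn_of_bounded (M := B ^ p) (by simp)
        (hRm.pow_const p).aestronglyMeasurable ?_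
      filter_upwards [ae_restrict_mem measurableSet_Icc] with t ht
      rw [Real.norm_of_nonneg (Real.rpow_nonneg (hR0 t) p)]
      exact Real.rpow_le_rpow (hR0 t) (hRB t ht) hp0.le
    simp only [← rms_rpow]
    rw [intervalIntegral.integral_of_le hT, ← integral_Icc_eq_integral_Ioc,
      ENNReal.ofReal_mul (by positivity), ofReal_integral_eq_lintegral_ofReal hint
        (ae_of_all _ fun t => Real.rpow_nonneg (hR0 t) p),
      ← lintegral_const_mul' _ _ ENNReal.ofReal_ne_top]
    refine lintegral_mono fun t => ?_
    rw [← ENNReal.ofReal_mul (by positivity), ← Real.mul_rpow hC.le (hR0 t)]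
  · refine (lintegral_rpow_le_of_le hp0.le (fun t _ => mul_nonneg hC.le (hR0 t)) fun t ht =>
      mul_le_mul_of_nonneg_left (hRB t ht) hC.le).trans_eq ?_
    rw [tailConst, Real.mul_rpow hC.le hB0]
    congr 1
    ring

end Paths

end SubPhi
-- The theorem, assembled from the preceding parts.
theorem mainTheorem6 {Ω : Type*} [MeasurableSpace Ω] (P : Measure Ω) [IsProbabilityMeasure P]
    -- the N-function and its density
    (φ f : ℝ → ℝ) (hφ : SubPhi.IsNFunction φ) (hQ : SubPhi.AssumptionQ φ)
    (hf : SubPhi.IsDensity φ f)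
    -- the wavelets
    (w ψ : ℝ → ℝ) (m₀ : ℝ → ℂ) (hw : SubPhi.IsFWavelet w m₀) (hψ : SubPhi.IsMWavelet w m₀ ψ)
    (hwc : Continuous w) (hψc : Continuous ψ)
    (Φ : ℝ → ℝ) (hwS : SubPhi.AssumptionS w Φ) (hψS : SubPhi.AssumptionS ψ Φ)
    -- the functions `c` and `A`
    (c A : ℝ → ℝ) (x₀ : ℝ) (hA : ∀ a, 0 < a → 0 < A a)
    (hcA : ∀ a, 0 < a → ∀ x, x₀ ≤ x → c (a * x) ≤ c x * A a)
    (hceven : ∀ x, c (-x) = c x) (hcmono : MonotoneOn c (Set.Ici 0)) (hc0 : 1 < c 0)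
    (hcΦ : Integrable (fun x : ℝ => c x * Φ |x|) volume)
    -- the process
    (X : ℝ → Ω → ℝ) (C_X : ℝ) (hX : SubPhi.IsStrictlySubProcess P φ X C_X)
    (hXmeas : Measurable (Function.uncurry X)) (hXcont : SubPhi.TauContinuous P φ X)
    (hXc : ∀ t, SubPhi.tau P φ (X t) ≤ c t)
    (T p : ℝ) (hT : 0 < T) (hp : 1 ≤ p)
    -- uniform convergence of the series on `[0, T]`
    (hF : SummableUniformlyOn (fun (k : ℤ) (t : ℝ) => SubPhi.termF P X w k t) (Set.Icc 0 T))
    (hM : SummableUniformlyOn (fun (jk : ℕ × ℤ) (t : ℝ) => SubPhi.termM P X ψ jk.1 jk.2 t)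
      (Set.Icc 0 T)) :
    ((∫⁻ t in Set.Icc (0 : ℝ) T, ENNReal.ofReal ((∫ ω, X t ω ^ 2 ∂P) ^ (p / 2)) < ⊤) →
      ∫⁻ t in Set.Icc (0 : ℝ) T, ENNReal.ofReal (SubPhi.tau P φ (X t) ^ p) < ⊤) ∧
    (∀ (K₀ : ℕ → ℕ) (K : ℕ → ℕ → ℕ), Tendsto K₀ atTop atTop →
      (∀ j, Tendsto (fun n => K n j) atTop atTop) →
      Tendsto (fun nm : ℕ × ℕ => ∫⁻ t in Set.Icc (0 : ℝ) T, ENNReal.ofReal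
          (SubPhi.tau P φ (fun ω => SubPhi.approx P X w ψ nm.1 (K₀ nm.1) (K nm.1) t ω -
            SubPhi.approx P X w ψ nm.2 (K₀ nm.2) (K nm.2) t ω) ^ p)) atTop (𝓝 0) ∧
      SubPhi.TendstoLpInProb P p T (fun n => SubPhi.approx P X w ψ n (K₀ n) (K n)) X) ∧
    (∀ (n K₀ : ℕ) (K : ℕ → ℕ),
      SubPhi.TailBound P φ f p T (fun t ω => SubPhi.approx P X w ψ n K₀ K t ω - X t ω)
        (C_X ^ p * ∫ t in (0 : ℝ)..T,
          (∫ ω, (SubPhi.approx P X w ψ n K₀ K t ω - X t ω) ^ 2 ∂P) ^ (p / 2)) ∧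
      SubPhi.TailBound P φ f p T (fun t ω => SubPhi.approx P X w ψ n K₀ K t ω - X t ω)
        (SubPhi.tailConst P X w ψ C_X p T n K₀ K)) := by
  obtain ⟨b, hb⟩ := hwS.exists_isAmalgam hwc
  obtain ⟨b', hb'⟩ := hψS.exists_isAmalgam hψc
  exact ⟨SubPhi.lintegral_tau_rpow_lt_top hφ (zero_le_one.trans hp) hX,
    fun K₀ K hK₀ hK =>
      ⟨SubPhi.tendsto_lintegral_tau_approx_sub hφ hp hw hψ hb hb' hX hXcont hF hM hK₀ hK,
        SubPhi.tendstoLpInProb_approx hφ hp hw hψ hb hb' hX hXmeas hXcont hF hM hK₀ hK⟩,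
    fun n K₀ K =>
      SubPhi.tailBound_approx_rms hφ hf hT.le hp hw hψ hb hb' hX hXmeas hXcont hF hM n K₀ K⟩
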